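/- **Setting.** For $A=(A_{ij}{}^k)\in\mathbb R^8$ $(1\le i,j,k\le 2)$ let $\mathcal N(A)$ be the Type B model: the manifold $\mathbb R^+\times\mathbb R$ with coordinates $(x^1,x^2)$ and the connection $\nabla_{\partial_i}\partial_j=\Gamma_{ij}{}^k\partial_k$ with $\Gamma_{ij}{}^k=(x^1)^{-1}A_{ij}{}^k$. Write $\mathcal N(A)=\mathcal N(\{\{A_{11}{}^1,A_{11}{}^2\},\{A_{12}{}^1,A_{12}{}^2\}\},\{\{A_{21}{}^1,A_{21}{}^2\},\{A_{22}{}^1,A_{22}{}^2\}\})$. The model is torsion free if $A_{12}{}^k=A_{21}{}^k$ for $k=1,2$; vanishing torsion is allowed below. Let $\mathfrak K(\mathcal N)$ be the Lie algebra (under the Lie bracket) of smooth vector fields $v=v^k\partial_k$ on $\mathbb R^+\times\mathbb R$ satisfying, for all $i,j,k$, $$\partial_i\partial_j v^k+v^l\partial_l\Gamma_{ij}{}^k-\Gamma_{ij}{}^l\partial_l v^k+\Gamma_{il}{}^k\partial_j v^l+\Gamma_{lj}{}^k\partial_i v^l=0 .$$ Two models are linearly equivalent if a shear $(x^1,x^2)\mapsto(x^1,bx^1+ax^2)$,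 $a\ne0$, carries one connection to the other. **Lie algebras.** $\mathfrak K_{\mathcal B}$: $[e_1,e_2]=e_1$ on $\mathbb R^2$. $A^0_{4,9}$: $[e_2,e_3]=e_1$, $[e_1,e_4]=e_1$, $[e_2,e_4]=e_2$ on $\mathbb R^4$ (other brackets of basis vectors zero). $\mathfrak{so}(2,1)$: $[e_1,e_2]=e_1$, $[e_2,e_3]=e_3$, $[e_3,e_1]=2e_2$ on $\mathbb R^3$. $\mathbb A_6$: the $6$-dimensional Lie algebra of the affine group of the plane. **Models.** With $T=(T^1,T^2)$ put - $\mathcal N_0^6(T)=\mathcal N(\{\{0,0\},\{T^1,T^2\}\},\{\{-T^1,-T^2\},\{0,0\}\})$; - $\mathcal N_1^6(\pm;T)=\mathcal N(\{\{1,0\},\{T^1,T^2\}\},\{\{-T^1,-T^2\},\{\pm1,0\}\})$; - $\mathcal N_2^6(c;T)=\mathcal N(\{\{-1+c,0\},\{T^1,c+T^2\}\},\{\{-T^1,c-T^2\},\{0,0\}\})$, $c\ne0$; - $\mathcal N_3^6(T)=\mathcal N(\{\{-2,1\},\{T^1,-1+T^2\}\},\{\{-T^1,-1-T^2\},\{0,0\}\})$;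 - $\mathcal N_4^6(T)=\mathcal N(\{\{0,1\},\{T^1,T^2\}\},\{\{-T^1,-T^2\},\{0,0\}\})$; - $\mathcal N_5^6(T)=\mathcal N(\{\{-1,0\},\{T^1,T^2\}\},\{\{-T^1,-T^2\},\{0,0\}\})$; - $\mathcal N_6^6(c;T)=\mathcal N(\{\{c,0\},\{T^1,T^2\}\},\{\{-T^1,-T^2\},\{0,0\}\})$, $c\ne0,-1$; - $\mathcal N_1^4(\kappa;T)=\mathcal N(\{\{2\kappa,1\},\{T^1,T^2+\kappa\}\},\{\{-T^1,-T^2+\kappa\},\{0,0\}\})$, $\kappa\ne0,-1$; - $\mathcal N_2^4(\kappa,\theta;T)=\mathcal N(\{\{-1+\theta+2\kappa,0\},\{T^1,T^2+\kappa\}\},\{\{-T^1,-T^2+\kappa\},\{0,0\}\})$, $\theta\ne0$, $\kappa(\kappa+\theta)\ne0$; - $\mathcal N_3^4(c;T)=\mathcal N(\{\{2c-1,0\},\{T^1,T^2+c\}\},\{\{-T^1,-T^2+c\},\{0,0\}\})$, $c\ne0$; - $\mathcal N_1^3(\pm;T)=\mathcal N(\{\{-\frac32,0\},\{T^1,-\frac12+T^2\}\},\{\{-T^1,-\frac12-T^2\},\{\pm\frac12,0\}\})$;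 - $\mathcal N_2^3(c;T)=\mathcal N(\{\{-\frac32,0\},\{1+T^1,-\frac12+T^2\}\},\{\{1-T^1,-\frac12-T^2\},\{c,2\}\})$, $c\in\mathbb R$; - $\mathcal N_3^3(T)=\mathcal N(\{\{-1,0\},\{T^1,-1+T^2\}\},\{\{-T^1,-1-T^2\},\{-1,0\}\})$; - $\mathcal N_4^3(T)=\mathcal N(\{\{-1,0\},\{T^1,-1+T^2\}\},\{\{-T^1,-1-T^2\},\{1,0\}\})$. **Lemma.** Generically, i.e. for all $A\in\mathbb R^8$ off the zero set of some nonzero polynomial, $\dim\mathfrak K(\mathcal N(A))=2$ and $\mathfrak K(\mathcal N(A))\cong\mathfrak K_{\mathcal B}$; moreover $\mathfrak K(\mathcal N(A))\cong\mathfrak K_{\mathcal B}$ whenever $\dim\mathfrak K(\mathcal N(A))\not>2$. If $\dim\mathfrak K(\mathcal N)>2$, then $\mathcal N$ is linearly equivalent to a model listed in one of the following items, and $\mathfrak K(\mathcal N)$ is isomorphic to the Lie algebra of that item; every model listed in an item has a Killing algebra isomorphic to the Lie algebra of that item. Here $\varepsilon$ is any nonzero real, and $T^1$, $T^2$ are any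 reals. 1. $\mathbb A_6$: $\mathcal N_0^6(0)$, $\mathcal N_1^6(\pm;0)$, $\mathcal N_2^6(c;0)$, $\mathcal N_3^6(0)$, $\mathcal N_4^6(0)$, $\mathcal N_5^6(0)$, $\mathcal N_6^6(c;0)$. In this case $\mathcal N$ is torsion free. 2. $\mathfrak K_{\mathcal B}\oplus\mathfrak K_{\mathcal B}$: $\mathcal N_0^6(0,\varepsilon)$, $\mathcal N_2^6(c;(0,\varepsilon))$, $\mathcal N_3^6(0,\varepsilon)$, $\mathcal N_4^6(0,\varepsilon)$, $\mathcal N_6^6(c;(0,\varepsilon))$, $\mathcal N_1^4(\kappa;(0,T^2))$, $\mathcal N_2^4(\kappa,\theta;(0,T^2))$. 3. $A^0_{4,9}$: $\mathcal N_5^6(0,\varepsilon)$, $\mathcal N_3^4(c;(0,T^2))$. 4. $\mathfrak{so}(2,1)$: $\mathcal N_2^6(-\tfrac12;(\varepsilon,0))$, $\mathcal N_1^3(\pm;(T^1,0))$, $\mathcal N_2^3(c;(T^1,0))$, $\mathcal N_3^3(0)$, $\mathcal N_4^3(0)$. In particular, if $\mathcal N$ has nonzero torsion and $\dim\mathfrak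 K(\mathcal N)>2$, then $\mathfrak K(\mathcal N)$ is isomorphic to $\mathfrak K_{\mathcal B}\oplus\mathfrak K_{\mathcal B}$, $A^0_{4,9}$ or $\mathfrak{so}(2,1)$. -/

import Mathlib

open scoped ContDiff

namespace TypeB

/-! ## Vector fields on the right half plane -/

/-- The coordinate plane; `x 0` and `x 1` are the coordinates `x¹` and `x²`. -/
abbrev Plane : Type := Fin 2 → ℝ

/-- The manifold `ℝ⁺ × ℝ` underlying every Type B model. -/
def halfPlane : Set Plane := {x | 0 < x 0}

/-- The partial derivative `∂f/∂xⁱ`. -/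
noncomputable def pd (i : Fin 2) (f : Plane → ℝ) : Plane → ℝ :=
  fun x => fderiv ℝ f x (Pi.single i 1)

theorem isOpen_halfPlane : IsOpen halfPlane :=
  isOpen_lt continuous_const (continuous_apply 0)

theorem two_le_infty : (2 : WithTop ℕ∞) ≤ ∞ := by
  exact WithTop.coe_le_coe.2 (le_top : (2 : ℕ∞) ≤ ⊤)

theorem contDiffAt_of_mem {F : Type*} [NormedAddCommGroup F] [NormedSpace ℝ F] {f : Plane → F}
    (hf : ContDiffOn ℝ ∞ f halfPlane) {x : Plane} (hx : x ∈ halfPlane) : ContDiffAt ℝ ∞ f x :=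
  hf.contDiffAt (isOpen_halfPlane.mem_nhds hx)

theorem differentiableAt_of_mem {F : Type*} [NormedAddCommGroup F] [NormedSpace ℝ F]
    {f : Plane → F} (hf : ContDiffOn ℝ ∞ f halfPlane) {x : Plane} (hx : x ∈ halfPlane) :
    DifferentiableAt ℝ f x :=
  (contDiffAt_of_mem hf hx).differentiableAt (by simp)

/-- The smooth vector fields on `ℝ⁺ × ℝ`. A field is represented by its pair of components,
extended by zero off the half plane, so that two fields are equal exactly when they agree on
the half plane. -/
def VectorFields : Submodule ℝ (Plane → Plane) where
  carrier := {v | ContDiffOn ℝ ∞ v halfPlane ∧ ∀ x ∉ halfPlane, v x = 0}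
  add_mem' := fun {v w} hv hw =>
    ⟨hv.1.add hw.1, fun x hx => by simp [hv.2 x hx, hw.2 x hx]⟩
  zero_mem' := ⟨contDiffOn_const, fun _ _ => rfl⟩
  smul_mem' := fun c v hv => ⟨contDiffOn_const.smul hv.1, fun x hx => by simp [hv.2 x hx]⟩

open Classical in
/-- The Lie bracket of vector fields, `[v, w]ᵏ = vˡ ∂ₗ wᵏ - wˡ ∂ₗ vᵏ` on the half plane. -/
noncomputable def bracket (v w : Plane → Plane) : Plane → Plane :=
  fun x => if x ∈ halfPlane then VectorField.lieBracket ℝ v w x else 0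

theorem bracket_of_mem (v w : Plane → Plane) {x : Plane} (hx : x ∈ halfPlane) :
    bracket v w x = VectorField.lieBracket ℝ v w x := if_pos hx

theorem bracket_of_notMem (v w : Plane → Plane) {x : Plane} (hx : x ∉ halfPlane) :
    bracket v w x = 0 := if_neg hx

theorem bracket_eventuallyEq (v w : Plane → Plane) {x : Plane} (hx : x ∈ halfPlane) :
    bracket v w =ᶠ[nhds x] VectorField.lieBracket ℝ v w := by
  filter_upwards [isOpen_halfPlane.mem_nhds hx] with y hy
  exact bracket_of_mem v w hy

theorem bracket_mem {v w : Plane → Plane} (hv : v ∈ VectorFields) (hw : w ∈ VectorFields) :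
    bracket v w ∈ VectorFields := by
  refine ⟨fun x hx => ?_, fun x hx => bracket_of_notMem v w hx⟩
  have h : ContDiffAt ℝ ∞ (VectorField.lieBracket ℝ v w) x :=
    (contDiffAt_of_mem hv.1 hx).lieBracket_vectorField (contDiffAt_of_mem hw.1 hx) (by simp)
  exact (h.congr_of_eventuallyEq (bracket_eventuallyEq v w hx)).contDiffWithinAt

noncomputable instance : Bracket VectorFields VectorFields where
  bracket v w := ⟨bracket v.1 w.1, bracket_mem v.2 w.2⟩

theorem coe_bracket (v w : VectorFields) : (⁅v, w⁆ : VectorFields).1 = bracket v.1 w.1 := rfl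

noncomputable instance : LieRing VectorFields where
  add_lie u v w := by
    apply Subtype.ext; funext x
    by_cases hx : x ∈ halfPlane
    · have := VectorField.lieBracket_add_left (𝕜 := ℝ) (W := w.1)
        (differentiableAt_of_mem u.2.1 hx) (differentiableAt_of_mem v.2.1 hx)
      simpa [coe_bracket, bracket_of_mem _ _ hx] using this
    · simp [coe_bracket, bracket_of_notMem _ _ hx]
  lie_add u v w := by
    apply Subtype.ext; funext x
    by_cases hx : x ∈ halfPlane
    · have := VectorField.lieBracket_add_right (𝕜 := ℝ) (V := u.1)
        (differentiableAt_of_mem v.2.1 hx) (differentiableAt_of_mem w.2.1 hx)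
      simpa [coe_bracket, bracket_of_mem _ _ hx] using this
    · simp [coe_bracket, bracket_of_notMem _ _ hx]
  lie_self u := by
    apply Subtype.ext; funext x
    by_cases hx : x ∈ halfPlane
    · simp [coe_bracket, bracket_of_mem _ _ hx]
    · simp [coe_bracket, bracket_of_notMem _ _ hx]
  leibniz_lie u v w := by
    apply Subtype.ext; funext x
    by_cases hx : x ∈ halfPlane
    · have := VectorField.leibniz_identity_lieBracket (𝕜 := ℝ) (n := ∞)
        (by simpa using two_le_infty)
        (contDiffAt_of_mem u.2.1 hx) (contDiffAt_of_mem v.2.1 hx) (contDiffAt_of_mem w.2.1 hx)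
      simp only [Submodule.coe_add, coe_bracket, Pi.add_apply, bracket_of_mem _ _ hx]
      rw [Filter.EventuallyEq.lieBracket_vectorField_eq Filter.EventuallyEq.rfl
          (bracket_eventuallyEq v.1 w.1 hx),
        Filter.EventuallyEq.lieBracket_vectorField_eq (bracket_eventuallyEq u.1 v.1 hx)
          Filter.EventuallyEq.rfl,
        Filter.EventuallyEq.lieBracket_vectorField_eq Filter.EventuallyEq.rfl
          (bracket_eventuallyEq u.1 w.1 hx)]
      exact this
    · simp [coe_bracket, bracket_of_notMem _ _ hx]

noncomputable instance : LieAlgebra ℝ VectorFields where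
  lie_smul c v w := by
    apply Subtype.ext; funext x
    by_cases hx : x ∈ halfPlane
    · have := VectorField.lieBracket_const_smul_right (𝕜 := ℝ) (V := v.1) (c := c)
        (differentiableAt_of_mem w.2.1 hx)
      simpa [coe_bracket, bracket_of_mem _ _ hx] using this
    · simp [coe_bracket, bracket_of_notMem _ _ hx]

/-! ## The affine Killing equations -/

/-- The right-hand side of the affine Killing equation `K_{ij}^k` for the vector field `v` and the
connection with Christoffel symbols `Γ i j k = Γ_{ij}^k`, where `∇_{∂ᵢ} ∂ⱼ = Γ_{ij}^k ∂ₖ`. These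
are the components of the Lie derivative of the connection in the direction of `v`. -/
noncomputable def killingExpr (Γ : Fin 2 → Fin 2 → Fin 2 → Plane → ℝ) (v : Plane → Plane)
    (i j k : Fin 2) (x : Plane) : ℝ :=
  pd i (pd j (fun y => v y k)) x +
    ∑ l, (v x l * pd l (Γ i j k) x - Γ i j l x * pd l (fun y => v y k) x +
      Γ i l k x * pd j (fun y => v y l) x + Γ l j k x * pd i (fun y => v y l) x)

section calculus

variable {f g : Plane → ℝ} {x : Plane}

theorem pd_smooth (i : Fin 2) (hf : ContDiffOn ℝ ∞ f halfPlane) :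
    ContDiffOn ℝ ∞ (pd i f) halfPlane := by
  have h := hf.fderiv_of_isOpen isOpen_halfPlane (m := ∞) (by simp)
  exact h.clm_apply contDiffOn_const

theorem pd_add (i : Fin 2) (hf : ContDiffOn ℝ ∞ f halfPlane) (hg : ContDiffOn ℝ ∞ g halfPlane)
    (hx : x ∈ halfPlane) : pd i (fun y => f y + g y) x = pd i f x + pd i g x := by
  simp only [pd]
  rw [fderiv_fun_add (differentiableAt_of_mem hf hx) (differentiableAt_of_mem hg hx)]; rfl

theorem pd_sub (i : Fin 2) (hf : ContDiffOn ℝ ∞ f halfPlane) (hg : ContDiffOn ℝ ∞ g halfPlane)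
    (hx : x ∈ halfPlane) : pd i (fun y => f y - g y) x = pd i f x - pd i g x := by
  simp only [pd]
  rw [fderiv_fun_sub (differentiableAt_of_mem hf hx) (differentiableAt_of_mem hg hx)]; rfl

theorem pd_mul (i : Fin 2) (hf : ContDiffOn ℝ ∞ f halfPlane) (hg : ContDiffOn ℝ ∞ g halfPlane)
    (hx : x ∈ halfPlane) :
    pd i (fun y => f y * g y) x = pd i f x * g x + f x * pd i g x := by
  simp only [pd]
  rw [fderiv_fun_mul (differentiableAt_of_mem hf hx) (differentiableAt_of_mem hg hx)]
  simp; ring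

theorem pd_congr (i : Fin 2) (h : Set.EqOn f g halfPlane) (hx : x ∈ halfPlane) :
    pd i f x = pd i g x := by
  have : f =ᶠ[nhds x] g := by
    filter_upwards [isOpen_halfPlane.mem_nhds hx] with y hy using h hy
  simp only [pd, this.fderiv_eq]

theorem pd_comm (i j : Fin 2) (hf : ContDiffOn ℝ ∞ f halfPlane) (hx : x ∈ halfPlane) :
    pd i (pd j f) x = pd j (pd i f) x := by
  have hd : DifferentiableAt ℝ (fderiv ℝ f) x :=
    differentiableAt_of_mem (hf.fderiv_of_isOpen isOpen_halfPlane (m := ∞) (by simp)) hx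
  have hs := (contDiffAt_of_mem hf hx).isSymmSndFDerivAt (by simpa using two_le_infty)
  have e : ∀ a b : Fin 2, pd a (pd b f) x =
      fderiv ℝ (fderiv ℝ f) x (Pi.single a 1) (Pi.single b 1) := by
    intro a b
    have : pd b f = fun y => fderiv ℝ f y (Pi.single b 1) := rfl
    rw [this, pd, fderiv_clm_apply hd (differentiableAt_const _)]
    simp
  rw [e, e, hs]

end calculus

theorem component_smooth {v : Plane → Plane} (hv : v ∈ VectorFields) (k : Fin 2) :
    ContDiffOn ℝ ∞ (fun y => v y k) halfPlane :=
  contDiffOn_pi.1 hv.1 k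

theorem bracket_component {u v : Plane → Plane} (hu : u ∈ VectorFields) (hv : v ∈ VectorFields)
    (k : Fin 2) {x : Plane} (hx : x ∈ halfPlane) :
    bracket u v x k = ∑ l, (u x l * pd l (fun y => v y k) x - v x l * pd l (fun y => u y k) x) := by
  have key : ∀ {w : Plane → Plane}, w ∈ VectorFields → ∀ z : Plane,
      fderiv ℝ w x z k = ∑ l, z l * pd l (fun y => w y k) x := by
    intro w hw z
    have h1 : fderiv ℝ (fun y => w y k) x z = fderiv ℝ w x z k := by
      rw [fderiv_apply (differentiableAt_of_mem hw.1 hx)]; rfl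
    rw [← h1]
    conv_lhs => rw [pi_eq_sum_univ' z]
    simp only [map_sum, map_smul, smul_eq_mul, pd]
  rw [bracket_of_mem _ _ hx, VectorField.lieBracket, Pi.sub_apply, key hv, key hu,
    ← Finset.sum_sub_distrib]

theorem pd_killingExpr {Γ : Fin 2 → Fin 2 → Fin 2 → Plane → ℝ}
    (hΓ : ∀ i j k, ContDiffOn ℝ ∞ (Γ i j k) halfPlane) {v : Plane → Plane}
    (hv : v ∈ VectorFields) (i j k m : Fin 2) {x : Plane} (hx : x ∈ halfPlane) :
    pd m (killingExpr Γ v i j k) x = pd m (pd i (pd j (fun y => v y k))) x +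
      ∑ l, (pd m (fun y => v y l) x * pd l (Γ i j k) x + v x l * pd m (pd l (Γ i j k)) x
        - (pd m (Γ i j l) x * pd l (fun y => v y k) x + Γ i j l x * pd m (pd l (fun y => v y k)) x)
        + (pd m (Γ i l k) x * pd j (fun y => v y l) x + Γ i l k x * pd m (pd j (fun y => v y l)) x)
        + (pd m (Γ l j k) x * pd i (fun y => v y l) x
          + Γ l j k x * pd m (pd i (fun y => v y l)) x)) := by
  have hV := component_smooth hv
  have e : killingExpr Γ v i j k = fun x => pd i (pd j (fun y => v y k)) x +
    ∑ l, (v x l * pd l (Γ i j k) x - Γ i j l x * pd l (fun y => v y k) x +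
      Γ i l k x * pd j (fun y => v y l) x + Γ l j k x * pd i (fun y => v y l) x) := rfl
  rw [e]
  simp only [Fin.sum_univ_two]
  simp (disch := first
    | exact hx
    | (repeat' first
        | exact hV _
        | exact hΓ _ _ _
        | apply pd_smooth
        | apply ContDiffOn.mul
        | apply ContDiffOn.add
        | apply ContDiffOn.sub)) only [pd_add, pd_sub, pd_mul]

theorem pd_bracket {u v : Plane → Plane} (hu : u ∈ VectorFields) (hv : v ∈ VectorFields)
    (j k : Fin 2) {x : Plane} (hx : x ∈ halfPlane) :
    pd j (fun y => bracket u v y k) x =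
      ∑ l, (pd j (fun y => u y l) x * pd l (fun y => v y k) x
        + u x l * pd j (pd l (fun y => v y k)) x
        - (pd j (fun y => v y l) x * pd l (fun y => u y k) x
        + v x l * pd j (pd l (fun y => u y k)) x)) := by
  have hU := component_smooth hu
  have hV := component_smooth hv
  rw [pd_congr j (fun y hy => bracket_component hu hv k hy) hx]
  simp only [Fin.sum_univ_two]
  simp (disch := first
    | exact hx
    | (repeat' first
        | exact hU _
        | exact hV _
        | apply pd_smooth
        | apply ContDiffOn.mul
        | apply ContDiffOn.add
        | apply ContDiffOn.sub)) only [pd_add, pd_sub, pd_mul]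

theorem pd_pd_bracket {u v : Plane → Plane} (hu : u ∈ VectorFields) (hv : v ∈ VectorFields)
    (i j k : Fin 2) {x : Plane} (hx : x ∈ halfPlane) :
    pd i (pd j (fun y => bracket u v y k)) x =
      ∑ l, ((pd i (pd j (fun y => u y l)) x * pd l (fun y => v y k) x
          + pd j (fun y => u y l) x * pd i (pd l (fun y => v y k)) x)
        + (pd i (fun y => u y l) x * pd j (pd l (fun y => v y k)) x
          + u x l * pd i (pd j (pd l (fun y => v y k))) x)
        - ((pd i (pd j (fun y => v y l)) x * pd l (fun y => u y k) x
          + pd j (fun y => v y l) x * pd i (pd l (fun y => u y k)) x)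
        + (pd i (fun y => v y l) x * pd j (pd l (fun y => u y k)) x
          + v x l * pd i (pd j (pd l (fun y => u y k))) x))) := by
  have hU := component_smooth hu
  have hV := component_smooth hv
  rw [pd_congr i (fun y hy => pd_bracket hu hv j k hy) hx]
  simp only [Fin.sum_univ_two]
  simp (disch := first
    | exact hx
    | (repeat' first
        | exact hU _
        | exact hV _
        | apply pd_smooth
        | apply ContDiffOn.mul
        | apply ContDiffOn.add
        | apply ContDiffOn.sub)) only [pd_add, pd_sub, pd_mul]

theorem killing_bracket {Γ : Fin 2 → Fin 2 → Fin 2 → Plane → ℝ}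
    (hΓ : ∀ i j k, ContDiffOn ℝ ∞ (Γ i j k) halfPlane) {u v : Plane → Plane}
    (hu : u ∈ VectorFields) (hv : v ∈ VectorFields)
    (Ku : ∀ i j k, ∀ x ∈ halfPlane, killingExpr Γ u i j k x = 0)
    (Kv : ∀ i j k, ∀ x ∈ halfPlane, killingExpr Γ v i j k x = 0)
    (i j k : Fin 2) {x : Plane} (hx : x ∈ halfPlane) :
    killingExpr Γ (bracket u v) i j k x = 0 := by
  have hU := component_smooth hu
  have hV := component_smooth hv
  have du : ∀ m, pd m (killingExpr Γ u i j k) x = 0 := fun m => by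
    rw [pd_congr m (g := fun _ => 0) (fun y hy => Ku i j k y hy) hx]; simp [pd]
  have dv : ∀ m, pd m (killingExpr Γ v i j k) x = 0 := fun m => by
    rw [pd_congr m (g := fun _ => 0) (fun y hy => Kv i j k y hy) hx]; simp [pd]
  have c3 : ∀ {f : Plane → ℝ}, ContDiffOn ℝ ∞ f halfPlane → ∀ m,
      pd m (pd i (pd j f)) x = pd i (pd j (pd m f)) x := fun {f} hf m => by
    rw [pd_comm m i (pd_smooth j hf) hx, pd_congr i (fun y hy => pd_comm m j hf hy) hx]
  have du0 := du 0
  have du1 := du 1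
  have dv0 := dv 0
  have dv1 := dv 1
  rw [pd_killingExpr hΓ hu _ _ _ _ hx, c3 (hU _)] at du0 du1
  rw [pd_killingExpr hΓ hv _ _ _ _ hx, c3 (hV _)] at dv0 dv1
  have ku := fun a b c => Ku a b c x hx
  have kv := fun a b c => Kv a b c x hx
  simp only [killingExpr, pd_pd_bracket hu hv _ _ _ hx, pd_bracket hu hv _ _ hx,
    bracket_component hu hv _ hx]
  simp only [killingExpr] at ku kv
  have cU : ∀ a b l, pd a (pd b (fun y => u y l)) x = pd b (pd a (fun y => u y l)) x :=
    fun a b l => pd_comm a b (hU l) hx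
  have cV : ∀ a b l, pd a (pd b (fun y => v y l)) x = pd b (pd a (fun y => v y l)) x :=
    fun a b l => pd_comm a b (hV l) hx
  have cΓ : ∀ a b p q r, pd a (pd b (Γ p q r)) x = pd b (pd a (Γ p q r)) x :=
    fun a b p q r => pd_comm a b (hΓ p q r) hx
  simp only [Fin.sum_univ_two, cU 0 i, cU 1 i, cU 0 j, cU 1 j, cV 0 i, cV 1 i, cV 0 j, cV 1 j,
    cΓ 1 0] at du0 du1 dv0 dv1 ku kv ⊢
  have kj0 := kv 0 j k
  have kj1 := kv 1 j k
  have lj0 := ku 0 j k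
  have lj1 := ku 1 j k
  rw [cV] at kj0 kj1
  rw [cU] at lj0 lj1
  linear_combination u x 0 * dv0 + u x 1 * dv1 - v x 0 * du0 - v x 1 * du1
    + pd i (fun y => u y 0) x * kj0 + pd i (fun y => u y 1) x * kj1
    + pd j (fun y => u y 0) x * kv i 0 k + pd j (fun y => u y 1) x * kv i 1 k
    - pd 0 (fun y => u y k) x * kv i j 0 - pd 1 (fun y => u y k) x * kv i j 1
    - pd i (fun y => v y 0) x * lj0 - pd i (fun y => v y 1) x * lj1
    - pd j (fun y => v y 0) x * ku i 0 k - pd j (fun y => v y 1) x * ku i 1 k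
    + pd 0 (fun y => v y k) x * ku i j 0 + pd 1 (fun y => v y k) x * ku i j 1
    + (u x 1 * Γ i j 0 x - u x 0 * Γ i j 1 x) * cV 1 0 k
    - (v x 1 * Γ i j 0 x - v x 0 * Γ i j 1 x) * cU 1 0 k

/-! ## Type B models and their Killing algebras -/

/-- The coefficients `A i j k = A_{ij}^k` of a Type B model, listed as
`![![![A₁₁¹, A₁₁²], ![A₁₂¹, A₁₂²]], ![![A₂₁¹, A₂₁²], ![A₂₂¹, A₂₂²]]]`. They form an
`8`-dimensional space. -/
abbrev Coeff : Type := Fin 2 → Fin 2 → Fin 2 → ℝ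

/-- The Christoffel symbols `Γ_{ij}^k = (x¹)⁻¹ A_{ij}^k` of the Type B model with coefficients
`A`. -/
noncomputable def christoffel (A : Coeff) (i j k : Fin 2) : Plane → ℝ :=
  fun x => (x 0)⁻¹ * A i j k

theorem christoffel_smooth (A : Coeff) (i j k : Fin 2) :
    ContDiffOn ℝ ∞ (christoffel A i j k) halfPlane := by
  refine ContDiffOn.mul (ContDiffOn.inv (contDiff_apply ℝ ℝ 0).contDiffOn ?_) contDiffOn_const
  exact fun x hx => (show 0 < x 0 from hx).ne'

/-- The torsion of the model vanishes: `Γ_{12}^k = Γ_{21}^k` for all `k`. -/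
def IsTorsionFree (A : Coeff) : Prop := ∀ k, A 0 1 k = A 1 0 k

theorem killingExpr_add {Γ : Fin 2 → Fin 2 → Fin 2 → Plane → ℝ} {u v : Plane → Plane}
    (hu : u ∈ VectorFields) (hv : v ∈ VectorFields) (i j k : Fin 2) {x : Plane}
    (hx : x ∈ halfPlane) :
    killingExpr Γ (u + v) i j k x = killingExpr Γ u i j k x + killingExpr Γ v i j k x := by
  have hU := component_smooth hu
  have hV := component_smooth hv
  have h1 : ∀ a c, ∀ y ∈ halfPlane, pd a (fun y => (u + v) y c) y =
      pd a (fun y => u y c) y + pd a (fun y => v y c) y :=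
    fun a c y hy => pd_add a (hU c) (hV c) hy
  have h2 : pd i (pd j (fun y => (u + v) y k)) x =
      pd i (pd j (fun y => u y k)) x + pd i (pd j (fun y => v y k)) x := by
    rw [pd_congr i (h1 j k) hx]
    exact pd_add i (pd_smooth j (hU k)) (pd_smooth j (hV k)) hx
  simp only [Pi.add_apply] at h1 h2
  simp only [killingExpr, Fin.sum_univ_two, Pi.add_apply, h2, h1 _ _ x hx]
  ring

theorem killingExpr_smul {Γ : Fin 2 → Fin 2 → Fin 2 → Plane → ℝ} {u : Plane → Plane}
    (hu : u ∈ VectorFields) (c : ℝ) (i j k : Fin 2) {x : Plane} (hx : x ∈ halfPlane) :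
    killingExpr Γ (c • u) i j k x = c * killingExpr Γ u i j k x := by
  have hU := component_smooth hu
  have h0 : ∀ a {f : Plane → ℝ}, ContDiffOn ℝ ∞ f halfPlane → ∀ y ∈ halfPlane,
      pd a (fun y => c * f y) y = c * pd a f y := fun a {f} hf y hy => by
    rw [pd_mul a contDiffOn_const hf hy]; simp [pd]
  have h1 : ∀ a d, ∀ y ∈ halfPlane, pd a (fun y => (c • u) y d) y = c * pd a (fun y => u y d) y :=
    fun a d y hy => h0 a (hU d) y hy
  have h2 : pd i (pd j (fun y => (c • u) y k)) x = c * pd i (pd j (fun y => u y k)) x := by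
    rw [pd_congr i (h1 j k) hx]
    exact h0 i (pd_smooth j (hU k)) x hx
  simp only [Pi.smul_apply, smul_eq_mul] at h1 h2
  simp only [killingExpr, Fin.sum_univ_two, Pi.smul_apply, smul_eq_mul, h2, h1 _ _ x hx]
  ring

/-- The Lie algebra of affine Killing vector fields of the Type B model with coefficients `A`. -/
noncomputable def killing (A : Coeff) : LieSubalgebra ℝ VectorFields where
  carrier := {v | ∀ i j k, ∀ x ∈ halfPlane, killingExpr (christoffel A) v.1 i j k x = 0}
  add_mem' := fun {u v} hu hv i j k x hx => by
    rw [Submodule.coe_add, killingExpr_add u.2 v.2 i j k hx, hu i j k x hx, hv i j k x hx, add_zero]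
  zero_mem' := fun i j k x hx => by
    have := killingExpr_smul (Γ := christoffel A) (VectorFields.zero_mem) 0 i j k hx
    simpa using this
  smul_mem' := fun c v hv i j k x hx => by
    rw [Submodule.coe_smul, killingExpr_smul v.2 c i j k hx, hv i j k x hx, mul_zero]
  lie_mem' := fun {u v} hu hv i j k _ hx =>
    killing_bracket (christoffel_smooth A) u.2 v.2 hu hv i j k hx

/-- Linear equivalence of Type B models: some shear `(x¹, x²) ↦ (x¹, b x¹ + a x²)` with `a ≠ 0`,
whose matrix is `M`, carries the connection of `A` to the connection of `B`. Since the shear is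
linear and preserves `x¹`, this is the identity `Φ_*(∇_{∂ᵢ} ∂ⱼ) = ∇_{Φ_* ∂ᵢ} Φ_* ∂ⱼ`. -/
def LinEquiv (A B : Coeff) : Prop :=
  ∃ a b : ℝ, a ≠ 0 ∧ ∃ M : Matrix (Fin 2) (Fin 2) ℝ, M = !![1, 0; b, a] ∧
    ∀ i j k, ∑ l, M k l * A i j l = ∑ p, ∑ q, M p i * M q j * B p q k

/-! ## The models -/

/-- `𝒩₀⁶(T)` -/
def N06 (T₁ T₂ : ℝ) : Coeff := ![![![0, 0], ![T₁, T₂]], ![![-T₁, -T₂], ![0, 0]]]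

/-- `𝒩₁⁶(±; T)`, with `s = ±1` -/
def N16 (s T₁ T₂ : ℝ) : Coeff := ![![![1, 0], ![T₁, T₂]], ![![-T₁, -T₂], ![s, 0]]]

/-- `𝒩₂⁶(c; T)`, where `c ≠ 0` -/
def N26 (c T₁ T₂ : ℝ) : Coeff := ![![![-1 + c, 0], ![T₁, c + T₂]], ![![-T₁, c - T₂], ![0, 0]]]

/-- `𝒩₃⁶(T)` -/
def N36 (T₁ T₂ : ℝ) : Coeff := ![![![-2, 1], ![T₁, -1 + T₂]], ![![-T₁, -1 - T₂], ![0, 0]]]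

/-- `𝒩₄⁶(T)` -/
def N46 (T₁ T₂ : ℝ) : Coeff := ![![![0, 1], ![T₁, T₂]], ![![-T₁, -T₂], ![0, 0]]]

/-- `𝒩₅⁶(T)` -/
def N56 (T₁ T₂ : ℝ) : Coeff := ![![![-1, 0], ![T₁, T₂]], ![![-T₁, -T₂], ![0, 0]]]

/-- `𝒩₆⁶(c; T)`, where `c ≠ 0, -1` -/
def N66 (c T₁ T₂ : ℝ) : Coeff := ![![![c, 0], ![T₁, T₂]], ![![-T₁, -T₂], ![0, 0]]]

/-- `𝒩₁⁴(κ; T)`, where `κ ≠ 0, -1` -/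
def N14 (κ T₁ T₂ : ℝ) : Coeff := ![![![2 * κ, 1], ![T₁, T₂ + κ]], ![![-T₁, -T₂ + κ], ![0, 0]]]

/-- `𝒩₂⁴(κ, θ; T)`, where `θ ≠ 0` and `κ (κ + θ) ≠ 0` -/
def N24 (κ θ T₁ T₂ : ℝ) : Coeff :=
  ![![![-1 + θ + 2 * κ, 0], ![T₁, T₂ + κ]], ![![-T₁, -T₂ + κ], ![0, 0]]]

/-- `𝒩₃⁴(c; T)`, where `c ≠ 0` -/
def N34 (c T₁ T₂ : ℝ) : Coeff := ![![![2 * c - 1, 0], ![T₁, T₂ + c]], ![![-T₁, -T₂ + c], ![0, 0]]]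

/-- `𝒩₁³(±; T)`, with `s = ±1` -/
noncomputable def N13 (s T₁ T₂ : ℝ) : Coeff :=
  ![![![-3 / 2, 0], ![T₁, -1 / 2 + T₂]], ![![-T₁, -1 / 2 - T₂], ![s / 2, 0]]]

/-- `𝒩₂³(c; T)` -/
noncomputable def N23 (c T₁ T₂ : ℝ) : Coeff :=
  ![![![-3 / 2, 0], ![1 + T₁, -1 / 2 + T₂]], ![![1 - T₁, -1 / 2 - T₂], ![c, 2]]]

/-- `𝒩₃³(T)`; for `T = 0` this is the Lorentzian hyperbolic plane -/
def N33 (T₁ T₂ : ℝ) : Coeff := ![![![-1, 0], ![T₁, -1 + T₂]], ![![-T₁, -1 - T₂], ![-1, 0]]]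

/-- `𝒩₄³(T)`; for `T = 0` this is the hyperbolic plane -/
def N43 (T₁ T₂ : ℝ) : Coeff := ![![![-1, 0], ![T₁, -1 + T₂]], ![![-T₁, -1 - T₂], ![1, 0]]]

/-- The models listed with Killing algebra `𝔸₆`: all `𝒩ᵢ⁶` with vanishing torsion. -/
inductive ModelA6 : Coeff → Prop
  | n06 : ModelA6 (N06 0 0)
  | n16 (s : ℝ) (hs : s = 1 ∨ s = -1) : ModelA6 (N16 s 0 0)
  | n26 (c : ℝ) (hc : c ≠ 0) : ModelA6 (N26 c 0 0)
  | n36 : ModelA6 (N36 0 0)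
  | n46 : ModelA6 (N46 0 0)
  | n56 : ModelA6 (N56 0 0)
  | n66 (c : ℝ) (hc : c ≠ 0) (hc' : c ≠ -1) : ModelA6 (N66 c 0 0)

/-- The models listed with Killing algebra `𝔎_ℬ ⊕ 𝔎_ℬ`. -/
inductive ModelKBKB : Coeff → Prop
  | n06 (ε : ℝ) (hε : ε ≠ 0) : ModelKBKB (N06 0 ε)
  | n26 (c ε : ℝ) (hc : c ≠ 0) (hε : ε ≠ 0) : ModelKBKB (N26 c 0 ε)
  | n36 (ε : ℝ) (hε : ε ≠ 0) : ModelKBKB (N36 0 ε)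
  | n46 (ε : ℝ) (hε : ε ≠ 0) : ModelKBKB (N46 0 ε)
  | n66 (c ε : ℝ) (hc : c ≠ 0) (hc' : c ≠ -1) (hε : ε ≠ 0) : ModelKBKB (N66 c 0 ε)
  | n14 (κ T₂ : ℝ) (hκ : κ ≠ 0) (hκ' : κ ≠ -1) : ModelKBKB (N14 κ 0 T₂)
  | n24 (κ θ T₂ : ℝ) (hθ : θ ≠ 0) (hκ : κ * (κ + θ) ≠ 0) : ModelKBKB (N24 κ θ 0 T₂)

/-- The models listed with Killing algebra `A⁰_{4,9}`. -/
inductive ModelA49 : Coeff → Prop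
  | n56 (ε : ℝ) (hε : ε ≠ 0) : ModelA49 (N56 0 ε)
  | n34 (c T₂ : ℝ) (hc : c ≠ 0) : ModelA49 (N34 c 0 T₂)

/-- The models listed with Killing algebra `𝔰𝔬(2,1)`. -/
inductive ModelSO21 : Coeff → Prop
  | n26 (ε : ℝ) (hε : ε ≠ 0) : ModelSO21 (N26 (-1 / 2) ε 0)
  | n13 (s T₁ : ℝ) (hs : s = 1 ∨ s = -1) : ModelSO21 (N13 s T₁ 0)
  | n23 (c T₁ : ℝ) : ModelSO21 (N23 c T₁ 0)
  | n33 : ModelSO21 (N33 0 0)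
  | n43 : ModelSO21 (N43 0 0)

/-! ## The abstract Lie algebras

The basis `e₁, e₂, …` is the standard basis, so the coordinates of `x` are `x 0, x 1, …`. -/

/-- `𝔎_ℬ`: the Lie algebra on `ℝ²` with `[e₁, e₂] = e₁`. -/
def KB : Type := Fin 2 → ℝ

noncomputable instance : AddCommGroup KB := inferInstanceAs (AddCommGroup (Fin 2 → ℝ))
noncomputable instance : Module ℝ KB := inferInstanceAs (Module ℝ (Fin 2 → ℝ))

noncomputable instance : LieRing KB where
  bracket x y := (![x 0 * y 1 - x 1 * y 0, 0] : Fin 2 → ℝ)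
  add_lie x y z := by
    change (_ : Fin 2 → ℝ) = _ + _
    ext i; fin_cases i <;> simp [show ∀ j, (x + y) j = x j + y j from fun _ => rfl]; ring
  lie_add x y z := by
    change (_ : Fin 2 → ℝ) = _ + _
    ext i; fin_cases i <;> simp [show ∀ j, (y + z) j = y j + z j from fun _ => rfl]; ring
  lie_self x := by
    change (_ : Fin 2 → ℝ) = 0
    ext i; fin_cases i <;> simp; ring
  leibniz_lie x y z := by
    change (_ : Fin 2 → ℝ) = _ + _
    ext i; fin_cases i <;> simp; ring

noncomputable instance : LieAlgebra ℝ KB where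
  lie_smul c x y := by
    refine funext fun i => ?_
    change (![x 0 * (c * y 1) - x 1 * (c * y 0), 0] : Fin 2 → ℝ) i =
      c * (![x 0 * y 1 - x 1 * y 0, 0] : Fin 2 → ℝ) i
    fin_cases i <;> simp; ring

/-- `A⁰_{4,9}`: the Lie algebra on `ℝ⁴` with nonzero brackets
`[e₂, e₃] = e₁`, `[e₁, e₄] = e₁`, `[e₂, e₄] = e₂`. -/
def A49 : Type := Fin 4 → ℝ

noncomputable instance : AddCommGroup A49 := inferInstanceAs (AddCommGroup (Fin 4 → ℝ))
noncomputable instance : Module ℝ A49 := inferInstanceAs (Module ℝ (Fin 4 → ℝ))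

noncomputable instance : LieRing A49 where
  bracket x y := (![(x 1 * y 2 - x 2 * y 1) + (x 0 * y 3 - x 3 * y 0),
    x 1 * y 3 - x 3 * y 1, 0, 0] : Fin 4 → ℝ)
  add_lie x y z := by
    change (_ : Fin 4 → ℝ) = _ + _
    ext i; fin_cases i <;> simp [show ∀ j, (x + y) j = x j + y j from fun _ => rfl] <;> ring
  lie_add x y z := by
    change (_ : Fin 4 → ℝ) = _ + _
    ext i; fin_cases i <;> simp [show ∀ j, (y + z) j = y j + z j from fun _ => rfl] <;> ring
  lie_self x := by
    change (_ : Fin 4 → ℝ) = 0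
    ext i; fin_cases i <;> simp <;> ring
  leibniz_lie x y z := by
    change (_ : Fin 4 → ℝ) = _ + _
    ext i; fin_cases i <;> simp <;> ring

noncomputable instance : LieAlgebra ℝ A49 where
  lie_smul c x y := by
    refine funext fun i => ?_
    change (![(x 1 * (c * y 2) - x 2 * (c * y 1)) + (x 0 * (c * y 3) - x 3 * (c * y 0)),
      x 1 * (c * y 3) - x 3 * (c * y 1), 0, 0] : Fin 4 → ℝ) i =
      c * (![(x 1 * y 2 - x 2 * y 1) + (x 0 * y 3 - x 3 * y 0),
      x 1 * y 3 - x 3 * y 1, 0, 0] : Fin 4 → ℝ) i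
    fin_cases i <;> simp <;> ring

/-- `𝔰𝔬(2,1)`: the Lie algebra on `ℝ³` with
`[e₁, e₂] = e₁`, `[e₂, e₃] = e₃`, `[e₃, e₁] = 2 e₂`. -/
def SO21 : Type := Fin 3 → ℝ

noncomputable instance : AddCommGroup SO21 := inferInstanceAs (AddCommGroup (Fin 3 → ℝ))
noncomputable instance : Module ℝ SO21 := inferInstanceAs (Module ℝ (Fin 3 → ℝ))

noncomputable instance : LieRing SO21 where
  bracket x y := (![x 0 * y 1 - x 1 * y 0, 2 * (x 2 * y 0 - x 0 * y 2),
    x 1 * y 2 - x 2 * y 1] : Fin 3 → ℝ)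
  add_lie x y z := by
    change (_ : Fin 3 → ℝ) = _ + _
    ext i; fin_cases i <;> simp [show ∀ j, (x + y) j = x j + y j from fun _ => rfl] <;> ring
  lie_add x y z := by
    change (_ : Fin 3 → ℝ) = _ + _
    ext i; fin_cases i <;> simp [show ∀ j, (y + z) j = y j + z j from fun _ => rfl] <;> ring
  lie_self x := by
    change (_ : Fin 3 → ℝ) = 0
    ext i; fin_cases i <;> simp <;> ring
  leibniz_lie x y z := by
    change (_ : Fin 3 → ℝ) = _ + _
    ext i; fin_cases i <;> simp <;> ring

noncomputable instance : LieAlgebra ℝ SO21 where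
  lie_smul c x y := by
    refine funext fun i => ?_
    change (![x 0 * (c * y 1) - x 1 * (c * y 0), 2 * (x 2 * (c * y 0) - x 0 * (c * y 2)),
      x 1 * (c * y 2) - x 2 * (c * y 1)] : Fin 3 → ℝ) i =
      c * (![x 0 * y 1 - x 1 * y 0, 2 * (x 2 * y 0 - x 0 * y 2),
      x 1 * y 2 - x 2 * y 1] : Fin 3 → ℝ) i
    fin_cases i <;> simp <;> ring

section affine

attribute [local instance] LieRing.ofAssociativeRing

/-- The Lie algebra of the full affine group of the plane, as the `3 × 3` real matrices with
vanishing last row. -/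
def affineMatrices : LieSubalgebra ℝ (Matrix (Fin 3) (Fin 3) ℝ) where
  carrier := {X | ∀ j, X 2 j = 0}
  add_mem' := fun hX hY j => by simp [hX j, hY j]
  zero_mem' := fun _ => rfl
  smul_mem' := fun c X hX j => by simp [hX j]
  lie_mem' := fun {X Y} hX hY j => by
    simp [Ring.lie_def, Matrix.mul_apply, show ∀ j, X 2 j = 0 from hX, show ∀ j, Y 2 j = 0 from hY]

/-- `𝔸₆`: the `6`-dimensional Lie algebra of the full affine group of the plane. -/
def A6 : Type := affineMatrices

noncomputable instance : LieRing A6 := inferInstanceAs (LieRing affineMatrices)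
noncomputable instance : LieAlgebra ℝ A6 := inferInstanceAs (LieAlgebra ℝ affineMatrices)

end affine

end TypeB

/-!
Every Killing algebra contains `Y = ∂₂` and `X = x¹ ∂₁ + x² ∂₂`, with `[Y, X] = Y`. A Killing field
is determined by its one-jet at a point (`jet_injective`), so the Killing algebra is
finite-dimensional, and `ad Y` is nilpotent because `[Y, X] = Y` (`isNilpotent_ad_of_lie_eq`). If
the dimension is two, then `X` and `Y` form a basis and the algebra is `𝔎_ℬ`.

If the dimension is more than two, nilpotency of `ad Y` leaves two possibilities
(`cases_of_two_lt_rank`).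

* Some Killing field commutes with `Y` and is not a multiple of it. Its components depend on `x¹`
  alone, and the Killing equations become algebraic (`isDiagonal_or_isRound`): the model has
  `A₂₂ = 0` and `A₁₂¹ = A₂₁¹ = 0` (a diagonal model), or it is equivalent to `𝒩₁⁶(±; 0)`. Diagonal
  models are brought to normal form by a shear. If they are flat and torsion free, they have
  Killing algebra `𝔸₆`; otherwise every Killing field is `α x¹ ∂₁ + (γ x² + φ(x¹)) ∂₂`
  (`IsDiagonal.fst_component`), and the explicit solutions `φ` give `𝔎_ℬ ⊕ 𝔎_ℬ` or `A⁰_{4,9}`.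

* Only multiples of `Y` commute with `Y`. Then there is a Killing field `Z` with `[Y, Z] = X` and
  `[X, Z] = Z` (`exists_lie_eq`). These two relations determine the two-jet of `Z` at `(1, 0)` from
  its value there, so the Killing equations become polynomial equations in the coefficients
  (`exists_isSpecial`), and their solutions are diagonal or equivalent to a listed model
  (`IsSpecial.exists_model`). The string `Y, X, Z` of `ad Y` cannot be continued
  (`IsSpecial.lie_ne`), so `Y`, `X`, `Z` is a basis and the algebra is `𝔰𝔬(2,1)`.

For the flat torsion-free models, two affine functions with independent differentials are written
down. A vector field that maps them to affine combinations of them is Killing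
(`FlatChart.mem_killing`), which embeds `𝔸₆`, and the one-jet bounds the dimension by six.

In all these cases the polynomial `genericPoly` vanishes at the coefficients, so the dimension is
two off its zero set.
-/

namespace TypeB

/-! ### The Killing equations in coordinates -/

theorem pd_const (i : Fin 2) (c : ℝ) (x : Plane) : pd i (fun _ => c) x = 0 := by
  simp [pd]

theorem smooth_const (c : ℝ) : ContDiffOn ℝ ∞ (fun _ : Plane => c) halfPlane := contDiffOn_const

theorem smooth_coord (i : Fin 2) : ContDiffOn ℝ ∞ (fun x : Plane => x i) halfPlane :=
  (contDiff_apply ℝ ℝ i).contDiffOn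

theorem pd_coord (i j : Fin 2) (x : Plane) :
    pd i (fun y => y j) x = if j = i then 1 else 0 := by
  have h : HasFDerivAt (fun y : Plane => y j)
      (ContinuousLinearMap.proj (R := ℝ) (φ := fun _ : Fin 2 => ℝ) j) x :=
    (ContinuousLinearMap.proj (R := ℝ) (φ := fun _ : Fin 2 => ℝ) j).hasFDerivAt
  simp [pd, h.fderiv, Pi.single_apply]

theorem pd_const_mul (i : Fin 2) (c : ℝ) {f : Plane → ℝ} (hf : ContDiffOn ℝ ∞ f halfPlane)
    {x : Plane} (hx : x ∈ halfPlane) : pd i (fun y => c * f y) x = c * pd i f x := by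
  rw [pd_mul i (smooth_const c) hf hx, pd_const]; ring

/-- Partial derivatives of a function of the first coordinate. -/
theorem pd_comp_fst (i : Fin 2) {φ : ℝ → ℝ} {d : ℝ} {x : Plane} (h : HasDerivAt φ d (x 0)) :
    pd i (fun y => φ (y 0)) x = if i = 0 then d else 0 := by
  have h0 : HasFDerivAt (fun y : Plane => y 0)
      (ContinuousLinearMap.proj (R := ℝ) (φ := fun _ : Fin 2 => ℝ) 0) x :=
    (ContinuousLinearMap.proj (R := ℝ) (φ := fun _ : Fin 2 => ℝ) 0).hasFDerivAt
  have h1 := h.comp_hasFDerivAt x h0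
  have h2 : (fun y : Plane => φ (y 0)) = φ ∘ fun y => y 0 := rfl
  rw [pd, h2, h1.fderiv]
  fin_cases i <;> simp

theorem smooth_comp_fst {φ : ℝ → ℝ} (h : ContDiffOn ℝ ∞ φ (Set.Ioi 0)) :
    ContDiffOn ℝ ∞ (fun x : Plane => φ (x 0)) halfPlane :=
  h.comp (smooth_coord 0) fun _ hx => hx

theorem pd_christoffel (A : Coeff) (i j k l : Fin 2) {x : Plane} (hx : x ∈ halfPlane) :
    pd l (christoffel A i j k) x = if l = 0 then -(A i j k / x 0 ^ 2) else 0 := by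
  have hx' : x 0 ≠ 0 := (show 0 < x 0 from hx).ne'
  have h : HasDerivAt (fun t : ℝ => t⁻¹ * A i j k) (-(A i j k / x 0 ^ 2)) (x 0) := by
    have := (hasDerivAt_inv hx').mul_const (A i j k)
    exact this.congr_deriv (by ring)
  exact pd_comp_fst l h

/-- The Killing equations, cleared of denominators. -/
theorem mem_killing_iff {A : Coeff} {v : VectorFields} :
    v ∈ killing A ↔ ∀ i j k, ∀ x ∈ halfPlane,
      x 0 ^ 2 * pd i (pd j (fun y => v.1 y k)) x = A i j k * v.1 x 0 +
        x 0 * ∑ l, (A i j l * pd l (fun y => v.1 y k) x - A i l k * pd j (fun y => v.1 y l) x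
          - A l j k * pd i (fun y => v.1 y l) x) := by
  have key : ∀ i j k, ∀ x ∈ halfPlane, x 0 ^ 2 * killingExpr (christoffel A) v.1 i j k x =
      x 0 ^ 2 * pd i (pd j (fun y => v.1 y k)) x - (A i j k * v.1 x 0 +
        x 0 * ∑ l, (A i j l * pd l (fun y => v.1 y k) x - A i l k * pd j (fun y => v.1 y l) x
          - A l j k * pd i (fun y => v.1 y l) x)) := by
    intro i j k x hx
    have hx' : x 0 ≠ 0 := (show 0 < x 0 from hx).ne'
    simp only [killingExpr, Fin.sum_univ_two, pd_christoffel A _ _ _ _ hx, if_true,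
      show (1 : Fin 2) ≠ 0 from by decide, if_false]
    simp only [christoffel]
    field_simp
    ring
  constructor
  · intro h i j k x hx
    have h1 := key i j k x hx
    rw [show killingExpr (christoffel A) v.1 i j k x = 0 from h i j k x hx] at h1
    linarith
  · intro h i j k x hx
    have hx' : x 0 ≠ 0 := (show 0 < x 0 from hx).ne'
    have h1 := key i j k x hx
    rw [h i j k x hx, sub_self] at h1
    exact (mul_eq_zero.1 h1).resolve_left (pow_ne_zero 2 hx')

open Classical in
/-- The vector field `f ∂₁ + g ∂₂` on the half plane. -/
noncomputable def ofComponents (f g : Plane → ℝ) (hf : ContDiffOn ℝ ∞ f halfPlane)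
    (hg : ContDiffOn ℝ ∞ g halfPlane) : VectorFields :=
  ⟨fun x => if x ∈ halfPlane then ![f x, g x] else 0, by
    constructor
    · have h : ContDiffOn ℝ ∞ (fun x => ![f x, g x]) halfPlane :=
        contDiffOn_pi.2 fun k => by fin_cases k <;> simpa
      exact h.congr fun x hx => if_pos hx
    · exact fun x hx => if_neg hx⟩

section ofComponents

variable {f g : Plane → ℝ} {hf : ContDiffOn ℝ ∞ f halfPlane} {hg : ContDiffOn ℝ ∞ g halfPlane}
  {x : Plane}

theorem ofComponents_apply (k : Fin 2) (hx : x ∈ halfPlane) :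
    (ofComponents f g hf hg).1 x k = (![f, g] k) x := by
  have : (ofComponents f g hf hg).1 x = ![f x, g x] := if_pos hx
  rw [this]; fin_cases k <;> rfl

theorem pd_ofComponents (i k : Fin 2) (hx : x ∈ halfPlane) :
    pd i (fun y => (ofComponents f g hf hg).1 y k) x = pd i (![f, g] k) x :=
  pd_congr i (fun _ hy => ofComponents_apply k hy) hx

theorem pd_pd_ofComponents (i j k : Fin 2) (hx : x ∈ halfPlane) :
    pd i (pd j (fun y => (ofComponents f g hf hg).1 y k)) x = pd i (pd j (![f, g] k)) x :=
  pd_congr i (fun _ hy => pd_ofComponents j k hy) hx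

end ofComponents

theorem vectorField_ext {u v : VectorFields}
    (h : ∀ x ∈ halfPlane, ∀ k, u.1 x k = v.1 x k) : u = v := by
  apply Subtype.ext; funext x
  by_cases hx : x ∈ halfPlane
  · exact funext (h x hx)
  · rw [u.2.2 x hx, v.2.2 x hx]

/-- The Lie bracket in coordinates. -/
theorem lie_apply (u v : VectorFields) (k : Fin 2) {x : Plane} (hx : x ∈ halfPlane) :
    (⁅u, v⁆ : VectorFields).1 x k = u.1 x 0 * pd 0 (fun y => v.1 y k) x
      + u.1 x 1 * pd 1 (fun y => v.1 y k) x - v.1 x 0 * pd 0 (fun y => u.1 y k) x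
      - v.1 x 1 * pd 1 (fun y => u.1 y k) x := by
  rw [coe_bracket, bracket_component u.2 v.2 k hx, Fin.sum_univ_two]; ring

/-! ### Explicit vector fields -/

/-- Second order data of a function `φ` on the positive reals: `φ` is smooth there, with
derivatives `φ₁` and `φ₂`. -/
structure HasTwoDerivs (φ φ₁ φ₂ : ℝ → ℝ) : Prop where
  smooth : ContDiffOn ℝ ∞ φ (Set.Ioi 0)
  first : ∀ t, 0 < t → HasDerivAt φ (φ₁ t) t
  second : ∀ t, 0 < t → HasDerivAt φ₁ (φ₂ t) t

/-- The vector field `(α x¹ + β x¹ x²) ∂₁ + (β (x²)² / 2 + γ x² + φ(x¹)) ∂₂`. All Killing fields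
of the listed models are of this shape, except for those with Killing algebra `𝔸₆`. -/
noncomputable def field (α β γ : ℝ) (φ : ℝ → ℝ) (hφ : ContDiffOn ℝ ∞ φ (Set.Ioi 0)) :
    VectorFields :=
  ofComponents (fun x => α * x 0 + β * (x 0 * x 1))
    (fun x => β / 2 * (x 1 * x 1) + γ * x 1 + φ (x 0))
    (((smooth_const α).mul (smooth_coord 0)).add
      ((smooth_const β).mul ((smooth_coord 0).mul (smooth_coord 1))))
    ((((smooth_const _).mul ((smooth_coord 1).mul (smooth_coord 1))).add
      ((smooth_const γ).mul (smooth_coord 1))).add (smooth_comp_fst hφ))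

section field

variable {α β γ : ℝ} {φ φ₁ φ₂ : ℝ → ℝ} {hφ : ContDiffOn ℝ ∞ φ (Set.Ioi 0)} {x : Plane}

theorem field_zero (hx : x ∈ halfPlane) :
    (field α β γ φ hφ).1 x 0 = α * x 0 + β * (x 0 * x 1) := ofComponents_apply 0 hx

theorem field_one (hx : x ∈ halfPlane) :
    (field α β γ φ hφ).1 x 1 = β / 2 * (x 1 * x 1) + γ * x 1 + φ (x 0) := ofComponents_apply 1 hx

theorem pd_field_zero (i : Fin 2) (hx : x ∈ halfPlane) :
    pd i (fun y => (field α β γ φ hφ).1 y 0) x = if i = 0 then α + β * x 1 else β * x 0 := by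
  rw [field, pd_ofComponents i 0 hx]
  have h0 := smooth_coord 0
  have h1 := smooth_coord 1
  simp only [Matrix.cons_val_zero]
  rw [pd_add i ((smooth_const α).mul h0) ((smooth_const β).mul (h0.mul h1)) hx,
    pd_const_mul i α h0 hx, pd_const_mul i β (h0.mul h1) hx, pd_mul i h0 h1 hx,
    pd_coord, pd_coord]
  fin_cases i <;> simp

theorem pd_field_one (h : HasTwoDerivs φ φ₁ φ₂) (i : Fin 2) (hx : x ∈ halfPlane) :
    pd i (fun y => (field α β γ φ hφ).1 y 1) x =
      if i = 0 then φ₁ (x 0) else β * x 1 + γ := by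
  rw [field, pd_ofComponents i 1 hx]
  have h1 := smooth_coord 1
  have h2 := smooth_comp_fst h.smooth
  simp only [Matrix.cons_val_one, Matrix.cons_val_zero]
  rw [pd_add i (((smooth_const _).mul (h1.mul h1)).add ((smooth_const γ).mul h1)) h2 hx,
    pd_add i ((smooth_const _).mul (h1.mul h1)) ((smooth_const γ).mul h1) hx,
    pd_const_mul i _ (h1.mul h1) hx, pd_const_mul i _ h1 hx, pd_mul i h1 h1 hx, pd_coord,
    pd_comp_fst i (h.first _ hx)]
  fin_cases i
  · simp
  · simp; ring

theorem pd_pd_field_zero (i j : Fin 2) (hx : x ∈ halfPlane) :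
    pd i (pd j (fun y => (field α β γ φ hφ).1 y 0)) x = if i = j then 0 else β := by
  rw [pd_congr i (fun y hy => pd_field_zero j hy) hx]
  fin_cases j
  · simp only [Fin.zero_eta, if_true]
    rw [pd_add i (smooth_const α) ((smooth_const β).mul (smooth_coord 1)) hx,
      pd_const_mul i β (smooth_coord 1) hx, pd_coord, pd_const]
    fin_cases i <;> simp
  · simp only [Fin.mk_one, show (1 : Fin 2) ≠ 0 from by decide, if_false]
    rw [pd_const_mul i β (smooth_coord 0) hx, pd_coord]
    fin_cases i <;> simp

theorem pd_pd_field_one (h : HasTwoDerivs φ φ₁ φ₂) (i j : Fin 2) (hx : x ∈ halfPlane) :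
    pd i (pd j (fun y => (field α β γ φ hφ).1 y 1)) x =
      if i = j then (if i = 0 then φ₂ (x 0) else β) else 0 := by
  rw [pd_congr i (fun y hy => pd_field_one h j hy) hx]
  fin_cases j
  · simp only [Fin.zero_eta, if_true]
    rw [pd_comp_fst i (h.second _ hx)]
    split_ifs <;> rfl
  · simp only [Fin.mk_one, show (1 : Fin 2) ≠ 0 from by decide, if_false]
    rw [pd_add i ((smooth_const β).mul (smooth_coord 1)) (smooth_const γ) hx,
      pd_const_mul i β (smooth_coord 1) hx, pd_coord, pd_const]
    fin_cases i <;> simp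

end field

theorem hasTwoDerivs_const (c : ℝ) : HasTwoDerivs (fun _ => c) (fun _ => 0) (fun _ => 0) :=
  ⟨contDiffOn_const, fun t _ => hasDerivAt_const t c, fun t _ => hasDerivAt_const t 0⟩

theorem hasTwoDerivs_id : HasTwoDerivs (fun t => t) (fun _ => 1) (fun _ => 0) :=
  ⟨contDiffOn_id, fun t _ => hasDerivAt_id t, fun t _ => hasDerivAt_const t 1⟩

theorem hasTwoDerivs_sq (q : ℝ) :
    HasTwoDerivs (fun t => q * t ^ 2) (fun t => 2 * q * t) (fun _ => 2 * q) :=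
  ⟨contDiffOn_const.mul (contDiffOn_id.pow 2),
    fun t _ => ((hasDerivAt_pow 2 t).const_mul q).congr_deriv (by simp; ring),
    fun t _ => ((hasDerivAt_id t).const_mul (2 * q)).congr_deriv (by simp)⟩

theorem contDiffOn_log_Ioi : ContDiffOn ℝ ∞ Real.log (Set.Ioi 0) :=
  Real.contDiffOn_log.mono fun t ht => (show 0 < t from ht).ne'

theorem hasTwoDerivs_log : HasTwoDerivs Real.log (fun t => t⁻¹) (fun t => -(t ^ 2)⁻¹) :=
  ⟨contDiffOn_log_Ioi, fun _ ht => Real.hasDerivAt_log ht.ne', fun _ ht => hasDerivAt_inv ht.ne'⟩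

theorem hasTwoDerivs_mul_log :
    HasTwoDerivs (fun t => t * Real.log t) (fun t => Real.log t + 1) (fun t => t⁻¹) :=
  ⟨contDiffOn_id.mul contDiffOn_log_Ioi, fun _ ht => Real.hasDerivAt_mul_log ht.ne',
    fun _ ht => (Real.hasDerivAt_log ht.ne').add_const 1⟩

theorem hasTwoDerivs_rpow (θ : ℝ) : HasTwoDerivs (fun t => t ^ θ) (fun t => θ * t ^ (θ - 1))
    (fun t => θ * ((θ - 1) * t ^ (θ - 1 - 1))) := by
  refine ⟨fun t ht => ?_, fun t ht => Real.hasDerivAt_rpow_const (Or.inl ht.ne'),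
    fun t ht => (Real.hasDerivAt_rpow_const (Or.inl ht.ne')).const_mul θ⟩
  exact (Real.contDiffAt_rpow_const_of_ne (show 0 < t from ht).ne').contDiffWithinAt

theorem HasTwoDerivs.const_mul {φ φ₁ φ₂ : ℝ → ℝ} (h : HasTwoDerivs φ φ₁ φ₂) (c : ℝ) :
    HasTwoDerivs (fun t => c * φ t) (fun t => c * φ₁ t) (fun t => c * φ₂ t) :=
  ⟨contDiffOn_const.mul h.smooth, fun t ht => (h.first t ht).const_mul c,
    fun t ht => (h.second t ht).const_mul c⟩

/-- The dilation field `X = x¹ ∂₁ + x² ∂₂`. -/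
noncomputable def dilation : VectorFields :=
  field 1 0 1 (fun _ => 0) (hasTwoDerivs_const 0).smooth

/-- The translation field `Y = ∂₂`. -/
noncomputable def translation : VectorFields :=
  field 0 0 0 (fun _ => 1) (hasTwoDerivs_const 1).smooth

theorem dilation_mem (A : Coeff) : dilation ∈ killing A := by
  rw [mem_killing_iff]
  intro i j k x hx
  have h := hasTwoDerivs_const 0
  unfold dilation
  fin_cases k
  · simp [Fin.sum_univ_two, pd_pd_field_zero _ _ hx, pd_field_zero _ hx, pd_field_one h _ hx,
      field_zero hx]
    fin_cases i <;> fin_cases j <;> simp <;> ring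
  · simp [Fin.sum_univ_two, pd_pd_field_one h _ _ hx, pd_field_zero _ hx, pd_field_one h _ hx,
      field_zero hx]
    fin_cases i <;> fin_cases j <;> simp <;> ring

theorem translation_mem (A : Coeff) : translation ∈ killing A := by
  rw [mem_killing_iff]
  intro i j k x hx
  have h := hasTwoDerivs_const 1
  unfold translation
  fin_cases k
  · simp [Fin.sum_univ_two, pd_pd_field_zero _ _ hx, pd_field_zero _ hx, pd_field_one h _ hx,
      field_zero hx]
  · simp [Fin.sum_univ_two, pd_pd_field_one h _ _ hx, pd_field_zero _ hx, pd_field_one h _ hx,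
      field_zero hx]

/-- Bracketing with `∂₂` differentiates the components along `x²`. -/
theorem translation_lie_apply (v : VectorFields) (k : Fin 2) {x : Plane} (hx : x ∈ halfPlane) :
    (⁅translation, v⁆ : VectorFields).1 x k = pd 1 (fun y => v.1 y k) x := by
  have h := hasTwoDerivs_const 1
  rw [lie_apply _ _ _ hx]
  unfold translation
  fin_cases k <;>
    simp [pd_field_zero _ hx, pd_field_one h _ hx, field_zero hx, field_one hx]

theorem dilation_lie_apply (v : VectorFields) (k : Fin 2) {x : Plane} (hx : x ∈ halfPlane) :
    (⁅dilation, v⁆ : VectorFields).1 x k = x 0 * pd 0 (fun y => v.1 y k) x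
      + x 1 * pd 1 (fun y => v.1 y k) x - v.1 x k := by
  have h := hasTwoDerivs_const 0
  rw [lie_apply _ _ _ hx]
  unfold dilation
  fin_cases k <;>
    simp [pd_field_zero _ hx, pd_field_one h _ hx, field_zero hx, field_one hx]

theorem translation_apply (k : Fin 2) {x : Plane} (hx : x ∈ halfPlane) :
    translation.1 x k = if k = 0 then 0 else 1 := by
  unfold translation
  fin_cases k <;> simp [field_zero hx, field_one hx]

theorem dilation_apply (k : Fin 2) {x : Plane} (hx : x ∈ halfPlane) :
    dilation.1 x k = x k := by
  unfold dilation
  fin_cases k <;> simp [field_zero hx, field_one hx]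

theorem translation_lie_dilation : ⁅translation, dilation⁆ = translation := by
  refine vectorField_ext fun x hx k => ?_
  rw [translation_lie_apply _ _ hx, translation_apply _ hx,
    pd_congr 1 (fun y hy => dilation_apply k hy) hx, pd_coord]
  fin_cases k <;> simp

/-- `X = x¹ ∂₁ + x² ∂₂` as a Killing field. -/
noncomputable def dilationK (A : Coeff) : killing A := ⟨dilation, dilation_mem A⟩

/-- `Y = ∂₂` as a Killing field. -/
noncomputable def translationK (A : Coeff) : killing A := ⟨translation, translation_mem A⟩

theorem translationK_lie_dilationK (A : Coeff) :
    ⁅translationK A, dilationK A⁆ = translationK A := Subtype.ext translation_lie_dilation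

/-- The base point `(1, 0)`. -/
def basePoint : Plane := ![1, 0]

@[simp] theorem basePoint_zero : basePoint 0 = 1 := rfl

@[simp] theorem basePoint_one : basePoint 1 = 0 := rfl

theorem basePoint_mem : basePoint ∈ halfPlane := by simp [halfPlane]

theorem linearIndependent_translation_dilation (A : Coeff) {s t : ℝ}
    (h : s • translationK A + t • dilationK A = 0) : s = 0 ∧ t = 0 := by
  have h' : s • translation + t • dilation = 0 := congrArg Subtype.val h
  have h1 : ∀ k, s * translation.1 basePoint k + t * dilation.1 basePoint k = 0 := fun k =>
    congrFun (congrFun (congrArg Subtype.val h') basePoint) k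
  have h2 := h1 0
  have h3 := h1 1
  simp only [translation_apply _ basePoint_mem, dilation_apply _ basePoint_mem] at h2 h3
  simp at h2 h3
  exact ⟨h3, h2⟩

/-! ### A Killing field is determined by its one-jet -/

theorem hasDerivAt_comp_line {f : Plane → ℝ} (hf : ContDiffOn ℝ ∞ f halfPlane) (p w : Plane)
    {t : ℝ} (ht : p + t • w ∈ halfPlane) :
    HasDerivAt (fun s : ℝ => f (p + s • w)) (∑ i, w i * pd i f (p + t • w)) t := by
  have h1 : HasDerivAt (fun s : ℝ => p + s • w) w t := by
    simpa using ((hasDerivAt_id t).smul_const w).const_add p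
  have h2 := (differentiableAt_of_mem hf ht).hasFDerivAt.comp_hasDerivAt t h1
  refine h2.congr_deriv ?_
  refine (congrArg (fderiv ℝ f (p + t • w)) (pi_eq_sum_univ' w)).trans ?_
  simp only [map_sum, map_smul, smul_eq_mul, pd]

/-- Along a segment from `basePoint`, the one-jet of a Killing field solves a linear ordinary
differential equation, so it vanishes if it vanishes at `basePoint`. -/
theorem killing_eq_zero_of_jet {A : Coeff} {v : VectorFields} (hv : v ∈ killing A)
    (h0 : ∀ k, v.1 basePoint k = 0) (h1 : ∀ i k, pd i (fun y => v.1 y k) basePoint = 0) :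
    v = 0 := by
  have hV := component_smooth v.2
  rw [mem_killing_iff] at hv
  refine vectorField_ext fun x hx k => ?_
  set w : Plane := x - basePoint with hw
  have hx0 : 0 < x 0 := hx
  obtain ⟨m, hm, hm1, hmx⟩ : ∃ m : ℝ, 0 < m ∧ m ≤ 1 ∧ m ≤ x 0 :=
    ⟨min 1 (x 0), lt_min one_pos hx0, min_le_left _ _, min_le_right _ _⟩
  have hγm : ∀ t ∈ Set.Icc (0 : ℝ) 1, m ≤ (basePoint + t • w) 0 := by
    intro t ht
    have : (basePoint + t • w) 0 = 1 + t * (x 0 - 1) := by simp [hw]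
    rw [this]
    nlinarith [ht.1, ht.2]
  have hγ : ∀ t ∈ Set.Icc (0 : ℝ) 1, basePoint + t • w ∈ halfPlane := fun t ht =>
    hm.trans_le (hγm t ht)
  let J : ℝ → (Fin 2 → ℝ) × (Fin 2 → Fin 2 → ℝ) := fun t =>
    (fun k => v.1 (basePoint + t • w) k, fun j k => pd j (fun y => v.1 y k) (basePoint + t • w))
  let J' : ℝ → (Fin 2 → ℝ) × (Fin 2 → Fin 2 → ℝ) := fun t =>
    (fun k => ∑ i, w i * pd i (fun y => v.1 y k) (basePoint + t • w),
      fun j k => ∑ i, w i * pd i (pd j (fun y => v.1 y k)) (basePoint + t • w))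
  have hJ : ∀ t ∈ Set.Icc (0 : ℝ) 1, HasDerivAt J (J' t) t := by
    intro t ht
    refine HasDerivAt.prodMk (hasDerivAt_pi.2 fun k => ?_)
      (hasDerivAt_pi.2 fun j => hasDerivAt_pi.2 fun k => ?_)
    · exact hasDerivAt_comp_line (hV k) _ _ (hγ t ht)
    · exact hasDerivAt_comp_line (pd_smooth j (hV k)) _ _ (hγ t ht)
  obtain ⟨a, ha0, ha⟩ : ∃ a : ℝ, 0 ≤ a ∧ ∀ i j k, |A i j k| ≤ a :=
    ⟨‖A‖, norm_nonneg _, fun i j k =>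
      (norm_le_pi_norm (A i j) k).trans ((norm_le_pi_norm (A i) j).trans (norm_le_pi_norm A i))⟩
  set W := |w 0| + |w 1| with hWdef
  have hW : 0 ≤ W := by positivity
  set C := (a + 6 * a * (1 + x 0)) / m ^ 2 with hC
  have hC0 : 0 ≤ C := by positivity
  have bound : ∀ t ∈ Set.Ico (0 : ℝ) 1, ‖J' t‖ ≤ (W * (1 + C)) * ‖J t‖ := by
    intro t ht'
    have ht : t ∈ Set.Icc (0 : ℝ) 1 := ⟨ht'.1, ht'.2.le⟩
    set z := basePoint + t • w with hz
    have b0 : ∀ k, |v.1 z k| ≤ ‖J t‖ := fun k =>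
      (norm_le_pi_norm (J t).1 k).trans (norm_fst_le _)
    have b1 : ∀ j k, |pd j (fun y => v.1 y k) z| ≤ ‖J t‖ := fun j k =>
      (norm_le_pi_norm ((J t).2 j) k).trans
        ((norm_le_pi_norm (J t).2 j).trans (norm_snd_le _))
    have hN := norm_nonneg (J t)
    have hzm : m ≤ z 0 := hγm t ht
    have hz1 : z 0 ≤ 1 + x 0 := by
      have : z 0 = 1 + t * (x 0 - 1) := by simp [hz, hw]
      rw [this]; nlinarith [ht.1, ht.2]
    have b2 : ∀ i j k, |pd i (pd j (fun y => v.1 y k)) z| ≤ C * ‖J t‖ := by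
      intro i j k
      have e := hv i j k z (hγ t ht)
      have hp : ∀ (c d : ℝ), |c| ≤ a → |d| ≤ ‖J t‖ → |c * d| ≤ a * ‖J t‖ := fun c d hc hd => by
        rw [abs_mul]; exact mul_le_mul hc hd (abs_nonneg _) ha0
      have hsum : |∑ l, (A i j l * pd l (fun y => v.1 y k) z
          - A i l k * pd j (fun y => v.1 y l) z
          - A l j k * pd i (fun y => v.1 y l) z)| ≤ 6 * (a * ‖J t‖) := by
        have h3 : ∀ l, |A i j l * pd l (fun y => v.1 y k) z
          - A i l k * pd j (fun y => v.1 y l) z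
          - A l j k * pd i (fun y => v.1 y l) z| ≤ 3 * (a * ‖J t‖) := by
          intro l
          have q1 := abs_le.1 (hp _ _ (ha i j l) (b1 l k))
          have q2 := abs_le.1 (hp _ _ (ha i l k) (b1 j l))
          have q3 := abs_le.1 (hp _ _ (ha l j k) (b1 i l))
          exact abs_le.2 ⟨by linarith, by linarith⟩
        rw [Fin.sum_univ_two]
        refine (abs_add_le _ _).trans ?_
        linarith [h3 0, h3 1]
      have hz0 : 0 < z 0 := hm.trans_le hzm
      have e1 : z 0 ^ 2 * |pd i (pd j (fun y => v.1 y k)) z| ≤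
          (a + 6 * a * (1 + x 0)) * ‖J t‖ := by
        rw [← abs_of_pos (pow_pos hz0 2), ← abs_mul, e]
        refine (abs_add_le _ _).trans ?_
        rw [abs_mul (z 0), abs_of_pos hz0]
        have q1 := hp _ _ (ha i j k) (b0 0)
        have q2 : z 0 * |∑ l, (A i j l * pd l (fun y => v.1 y k) z
          - A i l k * pd j (fun y => v.1 y l) z
          - A l j k * pd i (fun y => v.1 y l) z)| ≤ (1 + x 0) * (6 * (a * ‖J t‖)) :=
          mul_le_mul hz1 hsum (abs_nonneg _) (by linarith)
        linarith
      have e2 : m ^ 2 * |pd i (pd j (fun y => v.1 y k)) z| ≤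
          z 0 ^ 2 * |pd i (pd j (fun y => v.1 y k)) z| :=
        mul_le_mul_of_nonneg_right (pow_le_pow_left₀ hm.le hzm 2) (abs_nonneg _)
      rw [hC, div_mul_eq_mul_div, le_div_iff₀ (pow_pos hm 2)]
      linarith
    have hs : ∀ (g : Fin 2 → ℝ) (c : ℝ), (∀ i, |g i| ≤ c * ‖J t‖) →
        |∑ i, w i * g i| ≤ W * (c * ‖J t‖) := by
      intro g c hg
      rw [Fin.sum_univ_two, hWdef, add_mul]
      refine (abs_add_le _ _).trans ?_
      rw [abs_mul, abs_mul]
      exact add_le_add (mul_le_mul_of_nonneg_left (hg 0) (abs_nonneg _))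
        (mul_le_mul_of_nonneg_left (hg 1) (abs_nonneg _))
    have hWJ : 0 ≤ W * ‖J t‖ := mul_nonneg hW hN
    have hWC : 0 ≤ W * (C * ‖J t‖) := mul_nonneg hW (mul_nonneg hC0 hN)
    refine norm_prod_le_iff.2 ⟨(pi_norm_le_iff_of_nonneg (by nlinarith)).2 fun k => ?_,
      (pi_norm_le_iff_of_nonneg (by nlinarith)).2 fun j =>
        (pi_norm_le_iff_of_nonneg (by nlinarith)).2 fun k => ?_⟩
    · have := hs (fun i => pd i (fun y => v.1 y k) z) 1 fun i => by simpa using b1 i k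
      exact this.trans (by nlinarith)
    · have := hs (fun i => pd i (pd j (fun y => v.1 y k)) z) C fun i => b2 i j k
      exact this.trans (by nlinarith)
  have hJ0 : J 0 = 0 := by
    refine Prod.ext (funext fun k => ?_) (funext fun j => funext fun k => ?_)
    · simpa [J] using h0 k
    · simpa [J] using h1 j k
  have hz := eq_zero_of_abs_deriv_le_mul_abs_self_of_eq_zero_right
    (fun t ht => (hJ t ht).continuousAt.continuousWithinAt)
    (fun t ht => (hJ t ⟨ht.1, ht.2.le⟩).hasDerivWithinAt) hJ0 bound 1 (by simp)
  have := congrFun (congrArg Prod.fst hz) k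
  simpa [J, hw] using this

/-- The one-jet of a Killing field at `basePoint`. -/
noncomputable def jet (A : Coeff) : killing A →ₗ[ℝ] (Fin 2 → ℝ) × (Fin 2 → Fin 2 → ℝ) where
  toFun v := (fun k => v.1.1 basePoint k, fun j k => pd j (fun y => v.1.1 y k) basePoint)
  map_add' u v := by
    refine Prod.ext rfl (funext fun j => funext fun k => ?_)
    exact pd_add j (component_smooth u.1.2 k) (component_smooth v.1.2 k) basePoint_mem
  map_smul' c v := by
    refine Prod.ext rfl (funext fun j => funext fun k => ?_)
    exact pd_const_mul j c (component_smooth v.1.2 k) basePoint_mem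

theorem jet_injective (A : Coeff) : Function.Injective (jet A) := by
  rw [← LinearMap.ker_eq_bot, LinearMap.ker_eq_bot']
  intro v hv
  exact Subtype.ext (killing_eq_zero_of_jet v.2 (fun k => congrFun (congrArg Prod.fst hv) k)
    fun i k => congrFun (congrFun (congrArg Prod.snd hv) i) k)

instance (A : Coeff) : FiniteDimensional ℝ (killing A) :=
  FiniteDimensional.of_injective (jet A) (jet_injective A)

theorem finrank_killing_le (A : Coeff) : Module.finrank ℝ (killing A) ≤ 6 := by
  have := LinearMap.finrank_le_finrank_of_injective (jet_injective A)
  simpa [Module.finrank_pi_fintype] using this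

/-! ### Linear equivalence -/

/-- The shear `(x¹, x²) ↦ (x¹, b x¹ + a x²)` carries the connection of `A` to that of `B`,
written out in coefficients. -/
structure IsShear (a b : ℝ) (A B : Coeff) : Prop where
  e000 : A 0 0 0 = B 0 0 0 + b * (B 0 1 0 + B 1 0 0) + b ^ 2 * B 1 1 0
  e010 : A 0 1 0 = a * (B 0 1 0 + b * B 1 1 0)
  e100 : A 1 0 0 = a * (B 1 0 0 + b * B 1 1 0)
  e110 : A 1 1 0 = a ^ 2 * B 1 1 0
  e001 : b * A 0 0 0 + a * A 0 0 1 = B 0 0 1 + b * (B 0 1 1 + B 1 0 1) + b ^ 2 * B 1 1 1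
  e011 : b * A 0 1 0 + a * A 0 1 1 = a * (B 0 1 1 + b * B 1 1 1)
  e101 : b * A 1 0 0 + a * A 1 0 1 = a * (B 1 0 1 + b * B 1 1 1)
  e111 : b * A 1 1 0 + a * A 1 1 1 = a ^ 2 * B 1 1 1

theorem linEquiv_iff {A B : Coeff} : LinEquiv A B ↔ ∃ a b : ℝ, a ≠ 0 ∧ IsShear a b A B := by
  constructor
  · rintro ⟨a, b, ha, M, rfl, h⟩
    refine ⟨a, b, ha, ?_⟩
    simp only [Fin.sum_univ_two] at h
    constructor
    · have := h 0 0 0; simp at this; linear_combination this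
    · have := h 0 1 0; simp at this; linear_combination this
    · have := h 1 0 0; simp at this; linear_combination this
    · have := h 1 1 0; simp at this; linear_combination this
    · have := h 0 0 1; simp at this; linear_combination this
    · have := h 0 1 1; simp at this; linear_combination this
    · have := h 1 0 1; simp at this; linear_combination this
    · have := h 1 1 1; simp at this; linear_combination this
  · rintro ⟨a, b, ha, h⟩
    refine ⟨a, b, ha, _, rfl, fun i j k => ?_⟩
    simp only [Fin.sum_univ_two]
    fin_cases k <;> fin_cases i <;> fin_cases j <;> simp
    · linear_combination h.e000
    · linear_combination h.e010
    · linear_combination h.e100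
    · linear_combination h.e110
    · linear_combination h.e001
    · linear_combination h.e011
    · linear_combination h.e101
    · linear_combination h.e111

theorem IsShear.symm {a b : ℝ} (ha : a ≠ 0) {A B : Coeff} (h : IsShear a b A B) :
    IsShear a⁻¹ (-(b / a)) B A := by
  obtain ⟨h1, h2, h3, h4, h5, h6, h7, h8⟩ := h
  have h5' : A 0 0 1 = (B 0 0 1 + b * (B 0 1 1 + B 1 0 1) + b ^ 2 * B 1 1 1 - b * A 0 0 0) / a := by
    rw [eq_div_iff ha]; linear_combination h5
  have h6' : A 0 1 1 = B 0 1 1 + b * B 1 1 1 - b * (B 0 1 0 + b * B 1 1 0) :=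
    mul_left_cancel₀ ha (by linear_combination h6 - b * h2)
  have h7' : A 1 0 1 = B 1 0 1 + b * B 1 1 1 - b * (B 1 0 0 + b * B 1 1 0) :=
    mul_left_cancel₀ ha (by linear_combination h7 - b * h3)
  have h8' : A 1 1 1 = a * (B 1 1 1 - b * B 1 1 0) :=
    mul_left_cancel₀ ha (by linear_combination h8 - b * h4)
  constructor
  · rw [h1, h2, h3, h4]; field_simp; ring
  · rw [h2, h4]; field_simp; ring
  · rw [h3, h4]; field_simp; ring
  · rw [h4]; field_simp
  · rw [h5', h6', h7', h8', h1]; field_simp; ring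
  · rw [h6', h8']; field_simp; ring
  · rw [h7', h8']; field_simp; ring
  · rw [h8']; field_simp; ring

theorem IsShear.trans {a b a' b' : ℝ} {A B C : Coeff} (h : IsShear a b A B)
    (h' : IsShear a' b' B C) : IsShear (a' * a) (b' + a' * b) A C := by
  obtain ⟨h1, h2, h3, h4, h5, h6, h7, h8⟩ := h
  obtain ⟨g1, g2, g3, g4, g5, g6, g7, g8⟩ := h'
  constructor
  · rw [h1, g1, g2, g3, g4]; ring
  · rw [h2, g2, g4]; ring
  · rw [h3, g3, g4]; ring
  · rw [h4, g4]; ring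
  · linear_combination b' * h1 + a' * h5 + g5 + b * g6 + b * g7 + b ^ 2 * g8
  · linear_combination b' * h2 + a' * h6 + a * g6 + a * b * g8
  · linear_combination b' * h3 + a' * h7 + a * g7 + a * b * g8
  · linear_combination b' * h4 + a' * h8 + a ^ 2 * g8

theorem LinEquiv.trans {A B C : Coeff} (h : LinEquiv A B) (h' : LinEquiv B C) : LinEquiv A C := by
  obtain ⟨a, b, ha, h⟩ := linEquiv_iff.1 h
  obtain ⟨a', b', ha', h'⟩ := linEquiv_iff.1 h'
  exact linEquiv_iff.2 ⟨_, _, mul_ne_zero ha' ha, h.trans h'⟩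

/-- The shear `(x¹, x²) ↦ (x¹, b x¹ + a x²)`. -/
noncomputable def shear (a b : ℝ) : Plane →L[ℝ] Plane :=
  ContinuousLinearMap.pi ![ContinuousLinearMap.proj 0,
    b • ContinuousLinearMap.proj 0 + a • ContinuousLinearMap.proj 1]

theorem shear_zero (a b : ℝ) (x : Plane) : shear a b x 0 = x 0 := by simp [shear]

theorem shear_one (a b : ℝ) (x : Plane) : shear a b x 1 = b * x 0 + a * x 1 := by simp [shear]

theorem shear_mem {a b : ℝ} {x : Plane} (hx : x ∈ halfPlane) : shear a b x ∈ halfPlane := by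
  change 0 < shear a b x 0
  rw [shear_zero]; exact hx

theorem shear_symm {a b : ℝ} (ha : a ≠ 0) (x : Plane) :
    shear a⁻¹ (-(b / a)) (shear a b x) = x := by
  ext k; fin_cases k
  · simp [shear_zero]
  · simp [shear_one, shear_zero]; field_simp; ring

theorem smooth_comp_shear {f : Plane → ℝ} (hf : ContDiffOn ℝ ∞ f halfPlane) (a b : ℝ) :
    ContDiffOn ℝ ∞ (fun x => f (shear a b x)) halfPlane :=
  hf.comp (shear a b).contDiff.contDiffOn fun _ hx => shear_mem hx

theorem pd_comp_shear {f : Plane → ℝ} (hf : ContDiffOn ℝ ∞ f halfPlane) (a b : ℝ) (i : Fin 2)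
    {x : Plane} (hx : x ∈ halfPlane) : pd i (fun y => f (shear a b y)) x =
      (![pd 0 f (shear a b x) + b * pd 1 f (shear a b x), a * pd 1 f (shear a b x)] :
        Fin 2 → ℝ) i := by
  have h1 := (differentiableAt_of_mem hf (shear_mem (a := a) (b := b) hx)).hasFDerivAt.comp x
    (shear a b).hasFDerivAt
  have h2 : pd i (fun y => f (shear a b y)) x =
      fderiv ℝ f (shear a b x) (shear a b (Pi.single i 1)) := by
    rw [pd, show (fun y => f (shear a b y)) = f ∘ shear a b from rfl, h1.fderiv]; rfl
  have h3 : shear a b (Pi.single i 1) = ∑ k, shear a b (Pi.single i 1) k • Pi.single k 1 :=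
    pi_eq_sum_univ' _
  rw [h2, h3, Fin.sum_univ_two, map_add, map_smul, map_smul, shear_zero, shear_one]
  fin_cases i <;> simp [pd]

theorem pd_zero_comp_shear {f : Plane → ℝ} (hf : ContDiffOn ℝ ∞ f halfPlane) (a b : ℝ)
    {x : Plane} (hx : x ∈ halfPlane) : pd 0 (fun y => f (shear a b y)) x =
      pd 0 f (shear a b x) + b * pd 1 f (shear a b x) := pd_comp_shear hf a b 0 hx

theorem pd_one_comp_shear {f : Plane → ℝ} (hf : ContDiffOn ℝ ∞ f halfPlane) (a b : ℝ)
    {x : Plane} (hx : x ∈ halfPlane) : pd 1 (fun y => f (shear a b y)) x =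
      a * pd 1 f (shear a b x) := pd_comp_shear hf a b 1 hx

/-- The pull-back of a vector field under a shear. -/
noncomputable def pullback (a b : ℝ) (v : VectorFields) : VectorFields :=
  ofComponents (fun x => v.1 (shear a b x) 0)
    (fun x => a⁻¹ * (v.1 (shear a b x) 1 - b * v.1 (shear a b x) 0))
    (smooth_comp_shear (component_smooth v.2 0) a b)
    ((smooth_const _).mul ((smooth_comp_shear (component_smooth v.2 1) a b).sub
      ((smooth_const b).mul (smooth_comp_shear (component_smooth v.2 0) a b))))

section pullback

variable {a b : ℝ} (v : VectorFields) {x : Plane}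

theorem pullback_zero (hx : x ∈ halfPlane) : (pullback a b v).1 x 0 = v.1 (shear a b x) 0 :=
  ofComponents_apply 0 hx

theorem pullback_one (hx : x ∈ halfPlane) : (pullback a b v).1 x 1 =
    a⁻¹ * (v.1 (shear a b x) 1 - b * v.1 (shear a b x) 0) :=
  ofComponents_apply 1 hx

theorem pd_pullback_zero (i : Fin 2) (hx : x ∈ halfPlane) :
    pd i (fun y => (pullback a b v).1 y 0) x = pd i (fun y => v.1 (shear a b y) 0) x :=
  pd_ofComponents i 0 hx

theorem pd_pullback_one (i : Fin 2) (hx : x ∈ halfPlane) :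
    pd i (fun y => (pullback a b v).1 y 1) x = a⁻¹ * (pd i (fun y => v.1 (shear a b y) 1) x -
      b * pd i (fun y => v.1 (shear a b y) 0) x) := by
  have h0 := smooth_comp_shear (component_smooth v.2 0) a b
  have h1 := smooth_comp_shear (component_smooth v.2 1) a b
  rw [pullback, pd_ofComponents i 1 hx]
  simp only [Matrix.cons_val_one, Matrix.cons_val_zero]
  rw [pd_const_mul i _ (h1.sub ((smooth_const b).mul h0)) hx,
    pd_sub i h1 ((smooth_const b).mul h0) hx, pd_const_mul i b h0 hx]

theorem pd_pd_pullback_zero (i j : Fin 2) (hx : x ∈ halfPlane) :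
    pd i (pd j (fun y => (pullback a b v).1 y 0)) x =
      pd i (pd j (fun y => v.1 (shear a b y) 0)) x :=
  pd_pd_ofComponents i j 0 hx

theorem pd_pd_pullback_one (i j : Fin 2) (hx : x ∈ halfPlane) :
    pd i (pd j (fun y => (pullback a b v).1 y 1)) x =
      a⁻¹ * (pd i (pd j (fun y => v.1 (shear a b y) 1)) x -
      b * pd i (pd j (fun y => v.1 (shear a b y) 0)) x) := by
  have h0 := pd_smooth j (smooth_comp_shear (component_smooth v.2 0) a b)
  have h1 := pd_smooth j (smooth_comp_shear (component_smooth v.2 1) a b)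
  rw [pd_congr i (fun y hy => pd_pullback_one v j hy) hx,
    pd_const_mul i _ (h1.sub ((smooth_const b).mul h0)) hx,
    pd_sub i h1 ((smooth_const b).mul h0) hx, pd_const_mul i b h0 hx]

end pullback

theorem pd_zero_pd_zero_comp_shear {f : Plane → ℝ}
    (hf : ContDiffOn ℝ ∞ f halfPlane) (a b : ℝ) {x : Plane} (hx : x ∈ halfPlane) :
    pd 0 (pd 0 (fun y => f (shear a b y))) x =
    pd 0 (pd 0 f) (shear a b x) + b * pd 1 (pd 0 f) (shear a b x)
      + b * (pd 0 (pd 1 f) (shear a b x) + b * pd 1 (pd 1 f) (shear a b x)) := by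
  have h0 := pd_smooth 0 hf
  have h1 := pd_smooth 1 hf
  rw [pd_congr 0 (fun y hy => pd_zero_comp_shear hf a b hy) hx,
    pd_add 0 (smooth_comp_shear h0 a b) ((smooth_const b).mul (smooth_comp_shear h1 a b)) hx,
    pd_const_mul 0 b (smooth_comp_shear h1 a b) hx, pd_zero_comp_shear h0 a b hx,
    pd_zero_comp_shear h1 a b hx]

theorem pd_one_pd_zero_comp_shear {f : Plane → ℝ}
    (hf : ContDiffOn ℝ ∞ f halfPlane) (a b : ℝ) {x : Plane} (hx : x ∈ halfPlane) :
    pd 1 (pd 0 (fun y => f (shear a b y))) x =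
    a * pd 1 (pd 0 f) (shear a b x) + b * (a * pd 1 (pd 1 f) (shear a b x)) := by
  have h0 := pd_smooth 0 hf
  have h1 := pd_smooth 1 hf
  rw [pd_congr 1 (fun y hy => pd_zero_comp_shear hf a b hy) hx,
    pd_add 1 (smooth_comp_shear h0 a b) ((smooth_const b).mul (smooth_comp_shear h1 a b)) hx,
    pd_const_mul 1 b (smooth_comp_shear h1 a b) hx, pd_one_comp_shear h0 a b hx,
    pd_one_comp_shear h1 a b hx]

theorem pd_zero_pd_one_comp_shear {f : Plane → ℝ}
    (hf : ContDiffOn ℝ ∞ f halfPlane) (a b : ℝ) {x : Plane} (hx : x ∈ halfPlane) :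
    pd 0 (pd 1 (fun y => f (shear a b y))) x =
    a * (pd 0 (pd 1 f) (shear a b x) + b * pd 1 (pd 1 f) (shear a b x)) := by
  have h1 := pd_smooth 1 hf
  rw [pd_congr 0 (fun y hy => pd_one_comp_shear hf a b hy) hx,
    pd_const_mul 0 a (smooth_comp_shear h1 a b) hx, pd_zero_comp_shear h1 a b hx]

theorem pd_one_pd_one_comp_shear {f : Plane → ℝ}
    (hf : ContDiffOn ℝ ∞ f halfPlane) (a b : ℝ) {x : Plane} (hx : x ∈ halfPlane) :
    pd 1 (pd 1 (fun y => f (shear a b y))) x =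
    a * (a * pd 1 (pd 1 f) (shear a b x)) := by
  have h1 := pd_smooth 1 hf
  rw [pd_congr 1 (fun y hy => pd_one_comp_shear hf a b hy) hx,
    pd_const_mul 1 a (smooth_comp_shear h1 a b) hx, pd_one_comp_shear h1 a b hx]

theorem pullback_mem_killing {a b : ℝ} (ha : a ≠ 0) {A B : Coeff} (h : IsShear a b A B)
    {v : VectorFields} (hv : v ∈ killing B) : pullback a b v ∈ killing A := by
  obtain ⟨h1, h2, h3, h4, h5, h6, h7, h8⟩ := h
  rw [mem_killing_iff] at hv ⊢
  have h5' : A 0 0 1 = (B 0 0 1 + b * (B 0 1 1 + B 1 0 1) + b ^ 2 * B 1 1 1 - b * A 0 0 0) / a := by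
    rw [eq_div_iff ha]; linear_combination h5
  have h6' : A 0 1 1 = B 0 1 1 + b * B 1 1 1 - b * (B 0 1 0 + b * B 1 1 0) :=
    mul_left_cancel₀ ha (by linear_combination h6 - b * h2)
  have h7' : A 1 0 1 = B 1 0 1 + b * B 1 1 1 - b * (B 1 0 0 + b * B 1 1 0) :=
    mul_left_cancel₀ ha (by linear_combination h7 - b * h3)
  have h8' : A 1 1 1 = a * (B 1 1 1 - b * B 1 1 0) :=
    mul_left_cancel₀ ha (by linear_combination h8 - b * h4)
  intro i j k x hx
  have hV0 := component_smooth v.2 0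
  have hV1 := component_smooth v.2 1
  have hz : shear a b x ∈ halfPlane := shear_mem hx
  have H := fun i j k => hv i j k _ hz
  simp only [Fin.sum_univ_two, shear_zero] at H
  have H000 := H 0 0 0
  have H010 := H 0 1 0
  have H100 := H 1 0 0
  have H110 := H 1 1 0
  have H001 := H 0 0 1
  have H011 := H 0 1 1
  have H101 := H 1 0 1
  have H111 := H 1 1 1
  simp only [Fin.sum_univ_two]
  fin_cases k <;> fin_cases i <;> fin_cases j <;>
    simp only [Fin.zero_eta, Fin.mk_one, pullback_zero v hx, pd_pullback_zero v _ hx,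
      pd_pullback_one v _ hx, pd_pd_pullback_zero v _ _ hx, pd_pd_pullback_one v _ _ hx,
      pd_zero_comp_shear hV0 a b hx, pd_zero_comp_shear hV1 a b hx,
      pd_one_comp_shear hV0 a b hx, pd_one_comp_shear hV1 a b hx,
      pd_zero_pd_zero_comp_shear hV0 a b hx, pd_zero_pd_zero_comp_shear hV1 a b hx,
      pd_one_pd_zero_comp_shear hV0 a b hx, pd_one_pd_zero_comp_shear hV1 a b hx,
      pd_zero_pd_one_comp_shear hV0 a b hx, pd_zero_pd_one_comp_shear hV1 a b hx,
      pd_one_pd_one_comp_shear hV0 a b hx, pd_one_pd_one_comp_shear hV1 a b hx,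
      h1, h2, h3, h4, h5', h6', h7', h8']
  · field_simp
    linear_combination H000 + b * H010 + b * H100 + b ^ 2 * H110
  · field_simp
    linear_combination H010 + b * H110
  · field_simp
    linear_combination H100 + b * H110
  · field_simp
    linear_combination H110
  · field_simp
    linear_combination (H001 + b * H011 + b * H101 + b ^ 2 * H111)
      - b * (H000 + b * H010 + b * H100 + b ^ 2 * H110)
  · field_simp
    linear_combination (H011 + b * H111) - b * (H010 + b * H110)
  · field_simp
    linear_combination (H101 + b * H111) - b * (H100 + b * H110)
  · field_simp
    linear_combination H111 - b * H110

theorem pullback_lie {a b : ℝ} (ha : a ≠ 0) (u v : VectorFields) :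
    pullback a b ⁅u, v⁆ = ⁅pullback a b u, pullback a b v⁆ := by
  refine vectorField_ext fun x hx k => ?_
  have hU := component_smooth u.2
  have hV := component_smooth v.2
  have hz : shear a b x ∈ halfPlane := shear_mem hx
  rw [lie_apply _ _ _ hx]
  fin_cases k <;>
    simp only [Fin.zero_eta, Fin.mk_one, pullback_zero _ hx, pullback_one _ hx,
      pd_pullback_zero _ _ hx, pd_pullback_one _ _ hx, lie_apply _ _ _ hz,
      pd_zero_comp_shear (hU _) a b hx, pd_zero_comp_shear (hV _) a b hx,
      pd_one_comp_shear (hU _) a b hx, pd_one_comp_shear (hV _) a b hx]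
  · field_simp; ring
  · field_simp; ring

theorem pullback_add (a b : ℝ) (u v : VectorFields) :
    pullback a b (u + v) = pullback a b u + pullback a b v := by
  refine vectorField_ext fun x hx k => ?_
  have e : ∀ (u v : VectorFields) (z : Plane) (k : Fin 2), (u + v).1 z k = u.1 z k + v.1 z k :=
    fun _ _ _ _ => rfl
  fin_cases k
  · simp only [Fin.zero_eta, e, pullback_zero _ hx]
  · simp only [Fin.mk_one, e, pullback_one _ hx]; ring

theorem pullback_smul (a b c : ℝ) (v : VectorFields) :
    pullback a b (c • v) = c • pullback a b v := by
  refine vectorField_ext fun x hx k => ?_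
  have e : ∀ (v : VectorFields) (z : Plane) (k : Fin 2), (c • v).1 z k = c * v.1 z k :=
    fun _ _ _ => rfl
  fin_cases k
  · simp only [Fin.zero_eta, e, pullback_zero _ hx]
  · simp only [Fin.mk_one, e, pullback_one _ hx]; ring

theorem pullback_pullback_symm {a b : ℝ} (ha : a ≠ 0) (v : VectorFields) :
    pullback a b (pullback a⁻¹ (-(b / a)) v) = v := by
  refine vectorField_ext fun x hx k => ?_
  have hz : shear a b x ∈ halfPlane := shear_mem hx
  fin_cases k <;>
    simp only [Fin.zero_eta, Fin.mk_one, pullback_zero _ hx, pullback_one _ hx,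
      pullback_zero _ hz, pullback_one _ hz, shear_symm ha]
  field_simp; ring

/-- Pulling back Killing fields along a shear that carries `A` to `B`. -/
noncomputable def killingPullback {a b : ℝ} (ha : a ≠ 0) {A B : Coeff} (h : IsShear a b A B) :
    killing B →ₗ⁅ℝ⁆ killing A where
  toFun v := ⟨pullback a b v.1, pullback_mem_killing ha h v.2⟩
  map_add' u v := Subtype.ext (pullback_add a b u.1 v.1)
  map_smul' c v := Subtype.ext (pullback_smul a b c v.1)
  map_lie' {u v} := Subtype.ext (pullback_lie ha u.1 v.1)

theorem LinEquiv.nonempty_lieEquiv {A B : Coeff} (h : LinEquiv A B) :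
    Nonempty (killing A ≃ₗ⁅ℝ⁆ killing B) := by
  obtain ⟨a, b, ha, h⟩ := linEquiv_iff.1 h
  have hs := h.symm ha
  have ha' := inv_ne_zero ha
  refine ⟨LieEquiv.ofBijective (killingPullback ha' hs) ⟨fun u v huv => ?_, fun v => ?_⟩⟩
  · have e : pullback a⁻¹ (-(b / a)) u.1 = pullback a⁻¹ (-(b / a)) v.1 := congrArg Subtype.val huv
    have := congrArg (pullback a b) e
    rw [pullback_pullback_symm ha, pullback_pullback_symm ha] at this
    exact Subtype.ext this
  · refine ⟨killingPullback ha h v, Subtype.ext ?_⟩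
    have := pullback_pullback_symm ha' (b := -(b / a)) v.1
    rwa [inv_inv, show -(-(b / a) / a⁻¹) = b by field_simp] at this

/-! ### Recognising the abstract Lie algebras -/

section abstract

variable {L : Type*} [LieRing L] [LieAlgebra ℝ L]

/-- If `⁅y, x⁆ = y` in a finite-dimensional Lie algebra then `ad y` is nilpotent: the nonzero powers
of `ad y` are eigenvectors of the commutator with `ad x` for distinct eigenvalues. -/
theorem isNilpotent_ad_of_lie_eq [FiniteDimensional ℝ L] {x y : L} (h : ⁅y, x⁆ = y) :
    IsNilpotent (LieAlgebra.ad ℝ L y : Module.End ℝ L) := by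
  set f : Module.End ℝ L := LieAlgebra.ad ℝ L y with hf
  set g : Module.End ℝ L := LieAlgebra.ad ℝ L x with hg
  have h1 : f * g = g * f + f := by
    ext v
    have := leibniz_lie y x v
    rw [h] at this
    simpa [hf, hg, add_comm] using this
  have h2 : ∀ n : ℕ, f ^ n * g = g * f ^ n + (n : ℝ) • f ^ n := by
    intro n
    induction n with
    | zero => simp
    | succ n ih =>
      rw [pow_succ, mul_assoc, h1, mul_add, ← mul_assoc, ih, add_mul, mul_assoc, smul_mul_assoc,
        ← pow_succ]
      push_cast
      module
  let T : Module.End ℝ (Module.End ℝ L) := LinearMap.mulRight ℝ g - LinearMap.mulLeft ℝ g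
  by_contra hn
  have h3 : ∀ n : ℕ, T.HasEigenvalue (n : ℝ) := fun n =>
    Module.End.hasEigenvalue_of_hasEigenvector (x := f ^ n)
      ⟨Module.End.mem_eigenspace_iff.2 (by simp [T, h2]), fun h0 => hn ⟨n, h0⟩⟩
  have h4 : Set.Finite (spectrum ℝ T) := Module.End.finite_spectrum T
  exact (Set.infinite_range_of_injective Nat.cast_injective)
    (h4.subset (Set.range_subset_iff.2 fun n => (h3 n).mem_spectrum))

/-- A subspace that contains every `v` with `⁅y, v⁆` in it is everything, if `ad y` is nilpotent. -/
theorem mem_of_lie_mem_imp [FiniteDimensional ℝ L] {x y : L} (h : ⁅y, x⁆ = y)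
    {S : Submodule ℝ L} (hS : ∀ v, ⁅y, v⁆ ∈ S → v ∈ S) (v : L) : v ∈ S := by
  obtain ⟨n, hn⟩ := isNilpotent_ad_of_lie_eq h
  have key : ∀ n : ℕ, ∀ v, ((LieAlgebra.ad ℝ L y : Module.End ℝ L) ^ n) v ∈ S → v ∈ S := by
    intro n
    induction n with
    | zero => intro v hv; simpa using hv
    | succ n ih =>
      intro v hv
      rw [pow_succ] at hv
      exact hS v (ih _ hv)
  exact key n v (by simp [hn])

theorem nonempty_lieEquiv_KB {e₁ e₂ : L} (h : ⁅e₁, e₂⁆ = e₁)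
    (hli : ∀ s t : ℝ, s • e₁ + t • e₂ = 0 → s = 0 ∧ t = 0)
    (hsp : ∀ v : L, ∃ s t : ℝ, v = s • e₁ + t • e₂) : Nonempty (L ≃ₗ⁅ℝ⁆ KB) := by
  have h' : ⁅e₂, e₁⁆ = -e₁ := by rw [← lie_skew, h]
  let f : KB →ₗ[ℝ] L :=
    { toFun := fun x => x 0 • e₁ + x 1 • e₂
      map_add' := fun x y => by
        change (x 0 + y 0) • e₁ + (x 1 + y 1) • e₂ = _
        module
      map_smul' := fun c x => by
        change (c * x 0) • e₁ + (c * x 1) • e₂ = c • (_ : L)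
        module }
  let F : KB →ₗ⁅ℝ⁆ L :=
    { f with
      map_lie' := fun {x y} => by
        change (x 0 * y 1 - x 1 * y 0) • e₁ + (0 : ℝ) • e₂ =
          ⁅x 0 • e₁ + x 1 • e₂, y 0 • e₁ + y 1 • e₂⁆
        simp only [lie_add, add_lie, lie_smul, smul_lie, lie_self, h, h']
        module }
  refine ⟨(LieEquiv.ofBijective F ⟨?_, fun v => ?_⟩).symm⟩
  · refine (injective_iff_map_eq_zero (F : KB →ₗ[ℝ] L)).2 fun x hx => ?_
    obtain ⟨h0, h1⟩ := hli _ _ hx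
    exact funext fun i => by fin_cases i <;> assumption
  · obtain ⟨s, t, rfl⟩ := hsp v
    exact ⟨(![s, t] : Fin 2 → ℝ), rfl⟩

theorem nonempty_lieEquiv_SO21 {e₁ e₂ e₃ : L} (h₁₂ : ⁅e₁, e₂⁆ = e₁) (h₂₃ : ⁅e₂, e₃⁆ = e₃)
    (h₃₁ : ⁅e₃, e₁⁆ = (2 : ℝ) • e₂)
    (hli : ∀ r s t : ℝ, r • e₁ + s • e₂ + t • e₃ = 0 → r = 0 ∧ s = 0 ∧ t = 0)
    (hsp : ∀ v : L, ∃ r s t : ℝ, v = r • e₁ + s • e₂ + t • e₃) : Nonempty (L ≃ₗ⁅ℝ⁆ SO21) := by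
  have h₂₁ : ⁅e₂, e₁⁆ = -e₁ := by rw [← lie_skew, h₁₂]
  have h₃₂ : ⁅e₃, e₂⁆ = -e₃ := by rw [← lie_skew, h₂₃]
  have h₁₃ : ⁅e₁, e₃⁆ = -((2 : ℝ) • e₂) := by rw [← lie_skew, h₃₁]
  let f : SO21 →ₗ[ℝ] L :=
    { toFun := fun x => x 0 • e₁ + x 1 • e₂ + x 2 • e₃
      map_add' := fun x y => by
        change (x 0 + y 0) • e₁ + (x 1 + y 1) • e₂ + (x 2 + y 2) • e₃ = _
        module
      map_smul' := fun c x => by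
        change (c * x 0) • e₁ + (c * x 1) • e₂ + (c * x 2) • e₃ = c • (_ : L)
        module }
  let F : SO21 →ₗ⁅ℝ⁆ L :=
    { f with
      map_lie' := fun {x y} => by
        change (x 0 * y 1 - x 1 * y 0) • e₁ + (2 * (x 2 * y 0 - x 0 * y 2)) • e₂ +
            (x 1 * y 2 - x 2 * y 1) • e₃ =
          ⁅x 0 • e₁ + x 1 • e₂ + x 2 • e₃, y 0 • e₁ + y 1 • e₂ + y 2 • e₃⁆
        simp only [lie_add, add_lie, lie_smul, smul_lie, lie_self, h₁₂, h₂₃, h₃₁, h₂₁, h₃₂, h₁₃]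
        module }
  refine ⟨(LieEquiv.ofBijective F ⟨?_, fun v => ?_⟩).symm⟩
  · refine (injective_iff_map_eq_zero (F : SO21 →ₗ[ℝ] L)).2 fun x hx => ?_
    obtain ⟨h0, h1, h2⟩ := hli _ _ _ hx
    exact funext fun i => by fin_cases i <;> assumption
  · obtain ⟨r, s, t, rfl⟩ := hsp v
    exact ⟨(![r, s, t] : Fin 3 → ℝ), rfl⟩

theorem nonempty_lieEquiv_A49 {e₁ e₂ e₃ e₄ : L} (h₂₃ : ⁅e₂, e₃⁆ = e₁) (h₁₄ : ⁅e₁, e₄⁆ = e₁)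
    (h₂₄ : ⁅e₂, e₄⁆ = e₂) (h₁₂ : ⁅e₁, e₂⁆ = 0) (h₁₃ : ⁅e₁, e₃⁆ = 0) (h₃₄ : ⁅e₃, e₄⁆ = 0)
    (hli : ∀ r s t u : ℝ, r • e₁ + s • e₂ + t • e₃ + u • e₄ = 0 →
      r = 0 ∧ s = 0 ∧ t = 0 ∧ u = 0)
    (hsp : ∀ v : L, ∃ r s t u : ℝ, v = r • e₁ + s • e₂ + t • e₃ + u • e₄) :
    Nonempty (L ≃ₗ⁅ℝ⁆ A49) := by
  have h₃₂ : ⁅e₃, e₂⁆ = -e₁ := by rw [← lie_skew, h₂₃]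
  have h₄₁ : ⁅e₄, e₁⁆ = -e₁ := by rw [← lie_skew, h₁₄]
  have h₄₂ : ⁅e₄, e₂⁆ = -e₂ := by rw [← lie_skew, h₂₄]
  have h₂₁ : ⁅e₂, e₁⁆ = 0 := by rw [← lie_skew, h₁₂, neg_zero]
  have h₃₁ : ⁅e₃, e₁⁆ = 0 := by rw [← lie_skew, h₁₃, neg_zero]
  have h₄₃ : ⁅e₄, e₃⁆ = 0 := by rw [← lie_skew, h₃₄, neg_zero]
  let f : A49 →ₗ[ℝ] L :=
    { toFun := fun x => x 0 • e₁ + x 1 • e₂ + x 2 • e₃ + x 3 • e₄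
      map_add' := fun x y => by
        change (x 0 + y 0) • e₁ + (x 1 + y 1) • e₂ + (x 2 + y 2) • e₃ + (x 3 + y 3) • e₄ = _
        module
      map_smul' := fun c x => by
        change (c * x 0) • e₁ + (c * x 1) • e₂ + (c * x 2) • e₃ + (c * x 3) • e₄ = c • (_ : L)
        module }
  let F : A49 →ₗ⁅ℝ⁆ L :=
    { f with
      map_lie' := fun {x y} => by
        change ((x 1 * y 2 - x 2 * y 1) + (x 0 * y 3 - x 3 * y 0)) • e₁ +
            (x 1 * y 3 - x 3 * y 1) • e₂ + (0 : ℝ) • e₃ + (0 : ℝ) • e₄ =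
          ⁅x 0 • e₁ + x 1 • e₂ + x 2 • e₃ + x 3 • e₄, y 0 • e₁ + y 1 • e₂ + y 2 • e₃ + y 3 • e₄⁆
        simp only [lie_add, add_lie, lie_smul, smul_lie, lie_self, h₂₃, h₁₄, h₂₄, h₁₂, h₁₃, h₃₄,
          h₃₂, h₄₁, h₄₂, h₂₁, h₃₁, h₄₃]
        module }
  refine ⟨(LieEquiv.ofBijective F ⟨?_, fun v => ?_⟩).symm⟩
  · refine (injective_iff_map_eq_zero (F : A49 →ₗ[ℝ] L)).2 fun x hx => ?_
    obtain ⟨h0, h1, h2, h3⟩ := hli _ _ _ _ hx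
    exact funext fun i => by fin_cases i <;> assumption
  · obtain ⟨r, s, t, u, rfl⟩ := hsp v
    exact ⟨(![r, s, t, u] : Fin 4 → ℝ), rfl⟩

theorem nonempty_lieEquiv_KB_prod_KB {e₁ e₂ e₃ e₄ : L} (h₁₂ : ⁅e₁, e₂⁆ = e₁)
    (h₃₄ : ⁅e₃, e₄⁆ = e₃) (h₁₃ : ⁅e₁, e₃⁆ = 0) (h₁₄ : ⁅e₁, e₄⁆ = 0) (h₂₃ : ⁅e₂, e₃⁆ = 0)
    (h₂₄ : ⁅e₂, e₄⁆ = 0)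
    (hli : ∀ r s t u : ℝ, r • e₁ + s • e₂ + t • e₃ + u • e₄ = 0 →
      r = 0 ∧ s = 0 ∧ t = 0 ∧ u = 0)
    (hsp : ∀ v : L, ∃ r s t u : ℝ, v = r • e₁ + s • e₂ + t • e₃ + u • e₄) :
    Nonempty (L ≃ₗ⁅ℝ⁆ KB × KB) := by
  have h₂₁ : ⁅e₂, e₁⁆ = -e₁ := by rw [← lie_skew, h₁₂]
  have h₄₃ : ⁅e₄, e₃⁆ = -e₃ := by rw [← lie_skew, h₃₄]
  have h₃₁ : ⁅e₃, e₁⁆ = 0 := by rw [← lie_skew, h₁₃, neg_zero]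
  have h₄₁ : ⁅e₄, e₁⁆ = 0 := by rw [← lie_skew, h₁₄, neg_zero]
  have h₃₂ : ⁅e₃, e₂⁆ = 0 := by rw [← lie_skew, h₂₃, neg_zero]
  have h₄₂ : ⁅e₄, e₂⁆ = 0 := by rw [← lie_skew, h₂₄, neg_zero]
  let f : KB × KB →ₗ[ℝ] L :=
    { toFun := fun x => x.1 0 • e₁ + x.1 1 • e₂ + x.2 0 • e₃ + x.2 1 • e₄
      map_add' := fun x y => by
        change (x.1 0 + y.1 0) • e₁ + (x.1 1 + y.1 1) • e₂ + (x.2 0 + y.2 0) • e₃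
          + (x.2 1 + y.2 1) • e₄ = _
        module
      map_smul' := fun c x => by
        change (c * x.1 0) • e₁ + (c * x.1 1) • e₂ + (c * x.2 0) • e₃ + (c * x.2 1) • e₄
          = c • (_ : L)
        module }
  let F : KB × KB →ₗ⁅ℝ⁆ L :=
    { f with
      map_lie' := fun {x y} => by
        change (x.1 0 * y.1 1 - x.1 1 * y.1 0) • e₁ + (0 : ℝ) • e₂ +
            (x.2 0 * y.2 1 - x.2 1 * y.2 0) • e₃ + (0 : ℝ) • e₄ =
          ⁅x.1 0 • e₁ + x.1 1 • e₂ + x.2 0 • e₃ + x.2 1 • e₄,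
            y.1 0 • e₁ + y.1 1 • e₂ + y.2 0 • e₃ + y.2 1 • e₄⁆
        simp only [lie_add, add_lie, lie_smul, smul_lie, lie_self, h₁₂, h₃₄, h₁₃, h₁₄, h₂₃, h₂₄,
          h₂₁, h₄₃, h₃₁, h₄₁, h₃₂, h₄₂]
        module }
  refine ⟨(LieEquiv.ofBijective F ⟨?_, fun v => ?_⟩).symm⟩
  · refine (injective_iff_map_eq_zero (F : KB × KB →ₗ[ℝ] L)).2 fun x hx => ?_
    obtain ⟨h0, h1, h2, h3⟩ := hli _ _ _ _ hx
    exact Prod.ext (funext fun i => by fin_cases i <;> assumption)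
      (funext fun i => by fin_cases i <;> assumption)
  · obtain ⟨r, s, t, u, rfl⟩ := hsp v
    exact ⟨((![r, s] : Fin 2 → ℝ), (![t, u] : Fin 2 → ℝ)), rfl⟩

end abstract

/-! ### The models with `A₂₂ = 0` and `A₁₂¹ = A₂₁¹ = 0` -/

/-- The coefficients with `A₂₂ = 0` and `A₁₂¹ = A₂₁¹ = 0`, so that `∇_{∂₂} ∂₂ = 0` and both
`∇_{∂₁} ∂₂` and `∇_{∂₂} ∂₁` are multiples of `∂₂`. Shears preserve this condition. -/
structure IsDiagonal (A : Coeff) : Prop where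
  e010 : A 0 1 0 = 0
  e100 : A 1 0 0 = 0
  e110 : A 1 1 0 = 0
  e111 : A 1 1 1 = 0

/-- The diagonal models that are flat and torsion free. -/
structure IsFlatDiagonal (A : Coeff) : Prop extends IsDiagonal A where
  torsion : A 0 1 1 = A 1 0 1
  curvature : A 0 1 1 * (A 0 1 1 - 1 - A 0 0 0) = 0

theorem pd_fst_mul (i : Fin 2) {f : Plane → ℝ} (hf : ContDiffOn ℝ ∞ f halfPlane) {x : Plane}
    (hx : x ∈ halfPlane) :
    pd i (fun y => y 0 * f y) x = (if i = 0 then f x else 0) + x 0 * pd i f x := by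
  rw [pd_mul i (smooth_coord 0) hf hx, pd_coord]
  fin_cases i <;> simp

/-- The first component of a Killing field of a diagonal model that is not both flat and torsion
free is a multiple of `x¹`. With torsion this is immediate. Otherwise it is the compatibility of
the Killing equations for `∂₂∂₁∂₁ v`. -/
theorem IsDiagonal.fst_component {A : Coeff} (h : IsDiagonal A) (hA : ¬ IsFlatDiagonal A)
    {v : VectorFields} (hv : v ∈ killing A) {x : Plane} (hx : x ∈ halfPlane) :
    pd 1 (fun y => v.1 y 0) x = 0 ∧ x 0 * pd 0 (fun y => v.1 y 0) x = v.1 x 0 := by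
  have hf := component_smooth v.2 0
  have hg := component_smooth v.2 1
  rw [mem_killing_iff] at hv
  simp only [Fin.sum_univ_two] at hv
  set f : Plane → ℝ := fun y => v.1 y 0 with hfdef
  set g : Plane → ℝ := fun y => v.1 y 1
  have hvf : ∀ y, v.1 y 0 = f y := fun _ => rfl
  simp only [hvf] at hv ⊢
  have hne : ∀ y ∈ halfPlane, y 0 ≠ 0 := fun y hy => (show 0 < y 0 from hy).ne'
  obtain ⟨h1, h2, h3, h4⟩ := h
  have cf : ∀ y ∈ halfPlane, pd 1 (pd 0 f) y = pd 0 (pd 1 f) y := fun y hy => pd_comm 1 0 hf hy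
  have cg : ∀ y ∈ halfPlane, pd 1 (pd 0 g) y = pd 0 (pd 1 g) y := fun y hy => pd_comm 1 0 hg hy
  have f11 : ∀ y ∈ halfPlane, pd 1 (pd 1 f) y = 0 := fun y hy => by
    have := hv 1 1 0 y hy
    simp only [h1, h2, h3, h4] at this
    have h0 : y 0 ^ 2 * pd 1 (pd 1 f) y = 0 := by rw [this]; ring
    exact (mul_eq_zero.1 h0).resolve_left (pow_ne_zero 2 (hne y hy))
  have f01 : ∀ y ∈ halfPlane, y 0 * pd 0 (pd 1 f) y = (A 0 1 1 - A 0 0 0) * pd 1 f y :=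
    fun y hy => by
    have := hv 0 1 0 y hy
    simp only [h1, h3] at this
    exact mul_left_cancel₀ (hne y hy) (by linear_combination this)
  have f10 : ∀ y ∈ halfPlane, y 0 * pd 0 (pd 1 f) y = (A 1 0 1 - A 0 0 0) * pd 1 f y :=
    fun y hy => by
    have := hv 1 0 0 y hy
    simp only [h2, h3] at this
    exact mul_left_cancel₀ (hne y hy) (by linear_combination this - y 0 ^ 2 * cf y hy)
  have f00 : ∀ y ∈ halfPlane, y 0 * (y 0 * pd 0 (pd 0 f) y) =
      A 0 0 0 * f y - A 0 0 0 * (y 0 * pd 0 f y) + A 0 0 1 * (y 0 * pd 1 f y) := fun y hy => by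
    have := hv 0 0 0 y hy
    simp only [h1, h2] at this
    linear_combination this
  have g01 : ∀ y ∈ halfPlane, y 0 * (y 0 * pd 0 (pd 1 g) y) =
      A 0 1 1 * f y - A 0 1 1 * (y 0 * pd 0 f y) - A 0 0 1 * (y 0 * pd 1 f y) := fun y hy => by
    have := hv 0 1 1 y hy
    simp only [h1, h4] at this
    linear_combination this
  have g10 : ∀ y ∈ halfPlane, y 0 * (y 0 * pd 0 (pd 1 g) y) =
      A 1 0 1 * f y - A 1 0 1 * (y 0 * pd 0 f y) - A 0 0 1 * (y 0 * pd 1 f y) := fun y hy => by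
    have := hv 1 0 1 y hy
    simp only [h2, h4] at this
    linear_combination this - y 0 ^ 2 * cg y hy
  have g00 : ∀ y ∈ halfPlane, y 0 * (y 0 * pd 0 (pd 0 g) y) =
      A 0 0 1 * f y + ((A 0 0 0 - A 0 1 1 - A 1 0 1) * (y 0 * pd 0 g y)
        + A 0 0 1 * (y 0 * pd 1 g y) - 2 * A 0 0 1 * (y 0 * pd 0 f y)) := fun y hy => by
    have := hv 0 0 1 y hy
    linear_combination this
  have g11 : ∀ y ∈ halfPlane, y 0 * pd 1 (pd 1 g) y = -(A 0 1 1 + A 1 0 1) * pd 1 f y :=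
    fun y hy => by
    have := hv 1 1 1 y hy
    simp only [h3, h4] at this
    exact mul_left_cancel₀ (hne y hy) (by linear_combination this)
  by_cases hrs : A 0 1 1 = A 1 0 1
  · have hκ : A 0 1 1 * (A 0 1 1 - 1 - A 0 0 0) ≠ 0 := fun h0 =>
      hA ⟨⟨h1, h2, h3, h4⟩, hrs, h0⟩
    have sf0 := pd_smooth 0 hf
    have sf1 := pd_smooth 1 hf
    have sg0 := pd_smooth 0 hg
    have sg1 := pd_smooth 1 hg
    have sx := smooth_coord 0
    have c3 : ∀ {φ : Plane → ℝ}, ContDiffOn ℝ ∞ φ halfPlane → ∀ y ∈ halfPlane,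
        pd 1 (pd 0 (pd 0 φ)) y = pd 0 (pd 0 (pd 1 φ)) y := fun {φ} hφ y hy => by
      rw [pd_comm 1 0 (pd_smooth 0 hφ) hy, pd_congr 0 (fun z hz => pd_comm 1 0 hφ hz) hy]
    have hf1 : ∀ y ∈ halfPlane, pd 1 f y = 0 := by
      intro y hy
      have d0 := pd_congr 0 f01 hy
      rw [pd_fst_mul 0 (pd_smooth 0 sf1) hy, pd_const_mul 0 _ sf1 hy, if_pos rfl] at d0
      have d1 := pd_congr 1 f00 hy
      rw [pd_fst_mul 1 (sx.mul (pd_smooth 0 sf0)) hy, pd_fst_mul 1 (pd_smooth 0 sf0) hy, c3 hf y hy,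
        pd_add 1 (((smooth_const _).mul hf).sub ((smooth_const _).mul (sx.mul sf0)))
          ((smooth_const _).mul (sx.mul sf1)) hy,
        pd_sub 1 ((smooth_const _).mul hf) ((smooth_const _).mul (sx.mul sf0)) hy,
        pd_const_mul 1 _ hf hy, pd_const_mul 1 _ (sx.mul sf0) hy,
        pd_const_mul 1 _ (sx.mul sf1) hy, pd_fst_mul 1 sf0 hy, pd_fst_mul 1 sf1 hy,
        f11 y hy, cf y hy] at d1
      simp only [show (1 : Fin 2) ≠ 0 from by decide, if_false] at d1
      refine (mul_eq_zero.1 (?_ : A 0 1 1 * (A 0 1 1 - 1 - A 0 0 0) * pd 1 f y = 0)).resolve_left hκ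
      linear_combination d1 - y 0 * d0 - (A 0 1 1 - 1) * f01 y hy
    refine ⟨hf1 x hx, ?_⟩
    have f01' : pd 0 (pd 1 f) x = 0 := by
      rw [pd_congr 0 (g := fun _ => 0) hf1 hx, pd_const]
    have g11' : pd 1 (pd 1 g) x = 0 := by
      have := g11 x hx
      rw [hf1 x hx, mul_zero] at this
      exact (mul_eq_zero.1 this).resolve_left (hne x hx)
    have d0 := pd_congr 0 g01 hx
    rw [pd_fst_mul 0 (sx.mul (pd_smooth 0 sg1)) hx, pd_fst_mul 0 (pd_smooth 0 sg1) hx,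
      pd_sub 0 (((smooth_const _).mul hf).sub ((smooth_const _).mul (sx.mul sf0)))
        ((smooth_const _).mul (sx.mul sf1)) hx,
      pd_sub 0 ((smooth_const _).mul hf) ((smooth_const _).mul (sx.mul sf0)) hx,
      pd_const_mul 0 _ hf hx, pd_const_mul 0 _ (sx.mul sf0) hx,
      pd_const_mul 0 _ (sx.mul sf1) hx, pd_fst_mul 0 sf0 hx, pd_fst_mul 0 sf1 hx,
      f01', hf1 x hx] at d0
    simp only [if_true] at d0
    have d1 := pd_congr 1 g00 hx
    rw [pd_fst_mul 1 (sx.mul (pd_smooth 0 sg0)) hx, pd_fst_mul 1 (pd_smooth 0 sg0) hx, c3 hg x hx,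
      pd_add 1 ((smooth_const _).mul hf) ((((smooth_const _).mul (sx.mul sg0)).add
        ((smooth_const _).mul (sx.mul sg1))).sub ((smooth_const _).mul (sx.mul sf0))) hx,
      pd_sub 1 (((smooth_const _).mul (sx.mul sg0)).add ((smooth_const _).mul (sx.mul sg1)))
        ((smooth_const _).mul (sx.mul sf0)) hx,
      pd_add 1 ((smooth_const _).mul (sx.mul sg0)) ((smooth_const _).mul (sx.mul sg1)) hx,
      pd_const_mul 1 _ hf hx, pd_const_mul 1 _ (sx.mul sg0) hx,
      pd_const_mul 1 _ (sx.mul sg1) hx, pd_const_mul 1 _ (sx.mul sf0) hx,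
      pd_fst_mul 1 sg0 hx, pd_fst_mul 1 sg1 hx, pd_fst_mul 1 sf0 hx, cg x hx, cf x hx, g11', f01',
      hf1 x hx] at d1
    simp only [show (1 : Fin 2) ≠ 0 from by decide, if_false] at d1
    have e1 := g01 x hx
    have e2 := f00 x hx
    rw [hf1 x hx] at e1 e2
    refine sub_eq_zero.1 ((mul_eq_zero.1 (?_ :
      A 0 1 1 * (A 0 1 1 - 1 - A 0 0 0) * (x 0 * pd 0 f x - f x) = 0)).resolve_left hκ)
    rw [← hrs] at d1
    linear_combination (x 0 / 2) * d0 - (x 0 / 2) * d1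
      - (A 0 0 0 - 2 * A 0 1 1 + 2) / 2 * e1 - A 0 1 1 / 2 * e2
  · have hrs' := sub_ne_zero.2 hrs
    have e1 : pd 1 f x = 0 := (mul_eq_zero.1 (by
      linear_combination f10 x hx - f01 x hx :
        (A 0 1 1 - A 1 0 1) * pd 1 f x = 0)).resolve_left hrs'
    refine ⟨e1, sub_eq_zero.1 ((mul_eq_zero.1 (?_ :
      (A 0 1 1 - A 1 0 1) * (x 0 * pd 0 f x - f x) = 0)).resolve_left hrs')⟩
    linear_combination g01 x hx - g10 x hx

/-- The Killing equations for the explicit fields of a diagonal model. -/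
theorem IsDiagonal.field_mem_killing {A : Coeff} (hA : IsDiagonal A) {α γ : ℝ}
    {φ φ₁ φ₂ : ℝ → ℝ} (h : HasTwoDerivs φ φ₁ φ₂)
    (H : ∀ t, 0 < t → t * φ₂ t = (A 0 0 0 - A 0 1 1 - A 1 0 1) * φ₁ t + A 0 0 1 * (γ - α)) :
    field α 0 γ φ h.smooth ∈ killing A := by
  obtain ⟨h1, h2, h3, h4⟩ := hA
  rw [mem_killing_iff]
  intro i j k x hx
  have H' := H (x 0) hx
  fin_cases k
  · simp [Fin.sum_univ_two, pd_pd_field_zero _ _ hx, pd_field_zero _ hx, pd_field_one h _ hx,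
      field_zero hx]
    fin_cases i <;> fin_cases j <;> simp [h1, h2, h3]
    ring
  · simp [Fin.sum_univ_two, pd_pd_field_one h _ _ hx, pd_field_zero _ hx, pd_field_one h _ hx,
      field_zero hx]
    fin_cases i <;> fin_cases j <;> simp [h1, h2, h3, h4]
    · linear_combination x 0 * H'
    · ring
    · ring

/-- The part of the one-jet at `basePoint` that determines a Killing field of a diagonal model that
is not both flat and torsion free: `v¹`, `∂₂v²`, `v²` and `∂₁v²`. -/
noncomputable def reducedJet (A : Coeff) : killing A →ₗ[ℝ] (Fin 4 → ℝ) where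
  toFun v := ![(jet A v).1 0, (jet A v).2 1 1, (jet A v).1 1, (jet A v).2 0 1]
  map_add' u v := by ext i; fin_cases i <;> simp
  map_smul' c v := by ext i; fin_cases i <;> simp

theorem IsDiagonal.reducedJet_injective {A : Coeff} (h : IsDiagonal A) (hA : ¬ IsFlatDiagonal A) :
    Function.Injective (reducedJet A) := by
  rw [← LinearMap.ker_eq_bot, LinearMap.ker_eq_bot']
  intro v hv
  obtain ⟨h1, h2⟩ := h.fst_component hA v.2 basePoint_mem
  have h3 : v.1.1 basePoint 0 = 0 := congrFun hv 0
  have h4 : pd 1 (fun y => v.1.1 y 1) basePoint = 0 := congrFun hv 1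
  have h5 : v.1.1 basePoint 1 = 0 := congrFun hv 2
  have h6 : pd 0 (fun y => v.1.1 y 1) basePoint = 0 := congrFun hv 3
  rw [h3, basePoint_zero, one_mul] at h2
  refine Subtype.ext (killing_eq_zero_of_jet v.2 (fun k => ?_) fun i k => ?_)
  · fin_cases k <;> assumption
  · fin_cases i <;> fin_cases k <;> assumption

theorem reducedJet_field {A : Coeff} {α γ : ℝ} {φ φ₁ φ₂ : ℝ → ℝ} (h : HasTwoDerivs φ φ₁ φ₂)
    (hm : field α 0 γ φ h.smooth ∈ killing A) :
    reducedJet A ⟨field α 0 γ φ h.smooth, hm⟩ = ![α, γ, φ 1, φ₁ 1] := by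
  have hp := basePoint_mem
  simp [reducedJet, jet, field_zero hp, field_one hp, pd_field_one h _ hp]

theorem field_lie_field {α γ α' γ' : ℝ} {φ φ₁ φ₂ ψ ψ₁ ψ₂ χ χ₁ χ₂ : ℝ → ℝ}
    (hφ : HasTwoDerivs φ φ₁ φ₂) (hψ : HasTwoDerivs ψ ψ₁ ψ₂) (hχ : HasTwoDerivs χ χ₁ χ₂)
    (h : ∀ t, 0 < t → χ t = α * t * ψ₁ t - α' * t * φ₁ t + γ' * φ t - γ * ψ t) :
    ⁅field α 0 γ φ hφ.smooth, field α' 0 γ' ψ hψ.smooth⁆ = field 0 0 0 χ hχ.smooth := by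
  refine vectorField_ext fun x hx k => ?_
  rw [lie_apply _ _ _ hx]
  fin_cases k
  · simp [field_zero hx, pd_field_zero _ hx]; ring
  · simp [field_zero hx, field_one hx, pd_field_one hφ _ hx, pd_field_one hψ _ hx, h (x 0) hx]
    ring

theorem field_zero_eq (h : ContDiffOn ℝ ∞ (fun _ : ℝ => (0 : ℝ)) (Set.Ioi 0)) :
    field 0 0 0 (fun _ => 0) h = 0 := by
  refine vectorField_ext fun x hx k => ?_
  have e : (0 : VectorFields).1 x k = 0 := rfl
  rw [e]
  fin_cases k
  · simp [field_zero hx]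
  · simp [field_one hx]

theorem field_lie_field_eq_zero {α γ α' γ' : ℝ} {φ φ₁ φ₂ ψ ψ₁ ψ₂ : ℝ → ℝ}
    (hφ : HasTwoDerivs φ φ₁ φ₂) (hψ : HasTwoDerivs ψ ψ₁ ψ₂)
    (h : ∀ t, 0 < t → 0 = α * t * ψ₁ t - α' * t * φ₁ t + γ' * φ t - γ * ψ t) :
    ⁅field α 0 γ φ hφ.smooth, field α' 0 γ' ψ hψ.smooth⁆ = 0 := by
  rw [field_lie_field hφ hψ (hasTwoDerivs_const 0) h, field_zero_eq]

/-- The Killing algebra spanned by `x¹ ∂₁`, `x² ∂₂`, `∂₂` and `(x¹)^θ ∂₂`. -/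
theorem IsDiagonal.nonempty_lieEquiv_KB_prod_KB_of_zero {A : Coeff} (h : IsDiagonal A)
    (hA : ¬ IsFlatDiagonal A) (hq : A 0 0 1 = 0) (hθ : 1 + A 0 0 0 - A 0 1 1 - A 1 0 1 ≠ 0) :
    Nonempty (killing A ≃ₗ⁅ℝ⁆ KB × KB) := by
  set θ := 1 + A 0 0 0 - A 0 1 1 - A 1 0 1 with hθdef
  have k0 := hasTwoDerivs_const 0
  have k1 := hasTwoDerivs_const 1
  have kθ := hasTwoDerivs_rpow θ
  have m1 : field 0 0 0 (fun t => t ^ θ) kθ.smooth ∈ killing A := by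
    refine h.field_mem_killing kθ fun t ht => ?_
    have : t ^ (θ - 1) = t ^ (θ - 1 - 1) * t := by
      conv_lhs => rw [show θ - 1 = (θ - 1 - 1) + 1 by ring, Real.rpow_add_one ht.ne']
    rw [hq, this, hθdef]; ring
  have m2 : field (-1 / θ) 0 0 (fun _ => 0) k0.smooth ∈ killing A :=
    h.field_mem_killing k0 fun t _ => by rw [hq]; ring
  have m3 : field 0 0 0 (fun _ => 1) k1.smooth ∈ killing A :=
    h.field_mem_killing k1 fun t _ => by rw [hq]; ring
  have m4 : field (1 / θ) 0 1 (fun _ => 0) k0.smooth ∈ killing A :=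
    h.field_mem_killing k0 fun t _ => by rw [hq]; ring
  have J1 := reducedJet_field kθ m1
  have J2 := reducedJet_field k0 m2
  have J3 := reducedJet_field k1 m3
  have J4 := reducedJet_field k0 m4
  have inj := h.reducedJet_injective hA
  have hpow : ∀ t : ℝ, 0 < t → t ^ θ = t * t ^ (θ - 1) := fun t ht => by
    conv_lhs => rw [show θ = (θ - 1) + 1 by ring, Real.rpow_add_one ht.ne', mul_comm]
  refine nonempty_lieEquiv_KB_prod_KB (e₁ := ⟨_, m1⟩) (e₂ := ⟨_, m2⟩) (e₃ := ⟨_, m3⟩)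
    (e₄ := ⟨_, m4⟩) ?_ ?_ ?_ ?_ ?_ ?_ ?_ ?_
  · refine Subtype.ext (field_lie_field kθ k0 kθ fun t ht => ?_)
    rw [hpow t ht]; field_simp; ring
  · refine Subtype.ext (field_lie_field k1 k0 k1 fun t _ => ?_)
    ring
  · exact Subtype.ext (field_lie_field_eq_zero kθ k1 fun t _ => by ring)
  · refine Subtype.ext (field_lie_field_eq_zero kθ k0 fun t ht => ?_)
    rw [hpow t ht]; field_simp; ring
  · exact Subtype.ext (field_lie_field_eq_zero k0 k1 fun t _ => by ring)
  · exact Subtype.ext (field_lie_field_eq_zero k0 k0 fun t _ => by ring)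
  · intro r s t u h0
    have h1 := congrArg (reducedJet A) h0
    simp only [map_add, map_smul, J1, J2, J3, J4, map_zero] at h1
    have e0 := congrFun h1 0
    have e1 := congrFun h1 1
    have e2 := congrFun h1 2
    have e3 := congrFun h1 3
    simp at e0 e1 e2 e3
    have hr : r = 0 := e3.resolve_right hθ
    subst hr e1
    refine ⟨rfl, ?_, by linarith, rfl⟩
    field_simp at e0
    linarith
  · intro v
    refine ⟨reducedJet A v 3 / θ, reducedJet A v 1 - θ * reducedJet A v 0,
      reducedJet A v 2 - reducedJet A v 3 / θ, reducedJet A v 1, inj ?_⟩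
    simp only [map_add, map_smul, J1, J2, J3, J4]
    ext i
    fin_cases i
    · simp; field_simp; ring
    · simp
    · simp
    · simp; field_simp

/-- The Killing algebra spanned by `x¹ ∂₁ + x² ∂₂`, `x² ∂₂ + x¹ log x¹ ∂₂`, `∂₂` and `x¹ ∂₂`. -/
theorem IsDiagonal.nonempty_lieEquiv_KB_prod_KB_of_one {A : Coeff} (h : IsDiagonal A)
    (hA : ¬ IsFlatDiagonal A) (hq : A 0 0 1 = 1) (ha : A 0 0 0 = A 0 1 1 + A 1 0 1) :
    Nonempty (killing A ≃ₗ⁅ℝ⁆ KB × KB) := by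
  have k1 := hasTwoDerivs_const 1
  have kt := hasTwoDerivs_id
  have kl := hasTwoDerivs_mul_log
  have km := hasTwoDerivs_id.const_mul (-1)
  have m1 : field 0 0 0 _ kt.smooth ∈ killing A :=
    h.field_mem_killing kt fun t _ => by rw [hq, ha]; ring
  have m2 : field (-1) 0 0 _ kl.smooth ∈ killing A :=
    h.field_mem_killing kl fun t ht => by rw [hq, ha]; field_simp; ring
  have m3 : field 0 0 0 (fun _ => 1) k1.smooth ∈ killing A :=
    h.field_mem_killing k1 fun t _ => by rw [hq]; ring
  have m4 : field 1 0 1 _ km.smooth ∈ killing A :=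
    h.field_mem_killing km fun t _ => by rw [hq, ha]; ring
  have J1 := reducedJet_field kt m1
  have J2 := reducedJet_field kl m2
  have J3 := reducedJet_field k1 m3
  have J4 := reducedJet_field km m4
  have inj := h.reducedJet_injective hA
  refine nonempty_lieEquiv_KB_prod_KB (e₁ := ⟨_, m1⟩) (e₂ := ⟨_, m2⟩) (e₃ := ⟨_, m3⟩)
    (e₄ := ⟨_, m4⟩) ?_ ?_ ?_ ?_ ?_ ?_ ?_ ?_
  · exact Subtype.ext (field_lie_field kt kl kt fun t _ => by ring)
  · exact Subtype.ext (field_lie_field k1 km k1 fun t _ => by ring)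
  · exact Subtype.ext (field_lie_field_eq_zero kt k1 fun t _ => by ring)
  · exact Subtype.ext (field_lie_field_eq_zero kt km fun t _ => by ring)
  · exact Subtype.ext (field_lie_field_eq_zero kl k1 fun t _ => by ring)
  · exact Subtype.ext (field_lie_field_eq_zero kl km fun t _ => by ring)
  · intro r s t u h0
    have h1 := congrArg (reducedJet A) h0
    simp only [map_add, map_smul, J1, J2, J3, J4, map_zero] at h1
    have e0 := congrFun h1 0
    have e1 := congrFun h1 1
    have e2 := congrFun h1 2
    have e3 := congrFun h1 3
    simp at e0 e1 e2 e3
    exact ⟨by linarith, by linarith, by linarith, by linarith⟩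
  · intro v
    refine ⟨reducedJet A v 3 - (reducedJet A v 1 - reducedJet A v 0) + reducedJet A v 1,
      reducedJet A v 1 - reducedJet A v 0,
      reducedJet A v 2 - (reducedJet A v 3 - (reducedJet A v 1 - reducedJet A v 0)),
      reducedJet A v 1, inj ?_⟩
    simp only [map_add, map_smul, J1, J2, J3, J4]
    ext i
    fin_cases i <;> simp <;> ring

/-- The Killing algebra spanned by `x¹ ∂₁`, `x² ∂₂`, `∂₂` and `log x¹ ∂₂`. -/
theorem IsDiagonal.nonempty_lieEquiv_A49 {A : Coeff} (h : IsDiagonal A)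
    (hA : ¬ IsFlatDiagonal A) (hq : A 0 0 1 = 0) (ha : A 0 0 0 = A 0 1 1 + A 1 0 1 - 1) :
    Nonempty (killing A ≃ₗ⁅ℝ⁆ A49) := by
  have k0 := hasTwoDerivs_const 0
  have k1 := hasTwoDerivs_const 1
  have kl := hasTwoDerivs_log
  have m1 : field 0 0 0 (fun _ => 1) k1.smooth ∈ killing A :=
    h.field_mem_killing k1 fun t _ => by rw [hq]; ring
  have m2 : field 0 0 0 _ kl.smooth ∈ killing A :=
    h.field_mem_killing kl fun t ht => by rw [hq, ha]; field_simp; ring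
  have m3 : field (-1) 0 0 _ k0.smooth ∈ killing A :=
    h.field_mem_killing k0 fun t _ => by rw [hq]; ring
  have m4 : field 0 0 1 _ k0.smooth ∈ killing A :=
    h.field_mem_killing k0 fun t _ => by rw [hq]; ring
  have J1 := reducedJet_field k1 m1
  have J2 := reducedJet_field kl m2
  have J3 := reducedJet_field k0 m3
  have J4 := reducedJet_field k0 m4
  have inj := h.reducedJet_injective hA
  refine TypeB.nonempty_lieEquiv_A49 (e₁ := ⟨_, m1⟩) (e₂ := ⟨_, m2⟩) (e₃ := ⟨_, m3⟩)
    (e₄ := ⟨_, m4⟩) ?_ ?_ ?_ ?_ ?_ ?_ ?_ ?_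
  · exact Subtype.ext (field_lie_field kl k0 k1 fun t ht => by field_simp; ring)
  · exact Subtype.ext (field_lie_field k1 k0 k1 fun t _ => by ring)
  · exact Subtype.ext (field_lie_field kl k0 kl fun t _ => by ring)
  · exact Subtype.ext (field_lie_field_eq_zero k1 kl fun t _ => by ring)
  · exact Subtype.ext (field_lie_field_eq_zero k1 k0 fun t _ => by ring)
  · exact Subtype.ext (field_lie_field_eq_zero k0 k0 fun t _ => by ring)
  · intro r s t u h0
    have h1 := congrArg (reducedJet A) h0
    simp only [map_add, map_smul, J1, J2, J3, J4, map_zero] at h1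
    have e0 := congrFun h1 0
    have e1 := congrFun h1 1
    have e2 := congrFun h1 2
    have e3 := congrFun h1 3
    simp at e0 e1 e2 e3
    exact ⟨e2, e3, e0, e1⟩
  · intro v
    refine ⟨reducedJet A v 2, reducedJet A v 3, -reducedJet A v 0, reducedJet A v 1, inj ?_⟩
    simp only [map_add, map_smul, J1, J2, J3, J4]
    ext i
    fin_cases i <;> simp

theorem ModelKBKB.nonempty_lieEquiv {B : Coeff} (hB : ModelKBKB B) :
    Nonempty (killing B ≃ₗ⁅ℝ⁆ KB × KB) := by
  cases hB with
  | n06 ε hε =>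
    refine IsDiagonal.nonempty_lieEquiv_KB_prod_KB_of_zero (by constructor <;> simp [N06])
      (fun h => ?_) (by simp [N06]) (by simp [N06])
    have := h.torsion
    simp [N06] at this
    exact hε (by linarith)
  | n26 c ε hc hε =>
    refine IsDiagonal.nonempty_lieEquiv_KB_prod_KB_of_zero (by constructor <;> simp [N26])
      (fun h => ?_) (by simp [N26]) (by simp [N26]; ring_nf; simpa using hc)
    have := h.torsion
    simp [N26] at this
    exact hε (by linarith)
  | n36 ε hε =>
    refine IsDiagonal.nonempty_lieEquiv_KB_prod_KB_of_one (by constructor <;> simp [N36])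
      (fun h => ?_) (by simp [N36]) (by simp [N36]; ring)
    have := h.torsion
    simp [N36] at this
    exact hε (by linarith)
  | n46 ε hε =>
    refine IsDiagonal.nonempty_lieEquiv_KB_prod_KB_of_one (by constructor <;> simp [N46])
      (fun h => ?_) (by simp [N46]) (by simp [N46])
    have := h.torsion
    simp [N46] at this
    exact hε (by linarith)
  | n66 c ε hc hc' hε =>
    refine IsDiagonal.nonempty_lieEquiv_KB_prod_KB_of_zero (by constructor <;> simp [N66])
      (fun h => ?_) (by simp [N66]) (fun h => hc' (by simp [N66] at h; linarith))
    have := h.torsion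
    simp [N66] at this
    exact hε (by linarith)
  | n14 κ T₂ hκ hκ' =>
    refine IsDiagonal.nonempty_lieEquiv_KB_prod_KB_of_one (by constructor <;> simp [N14])
      (fun h => ?_) (by simp [N14]) (by simp [N14]; ring)
    have h1 := h.torsion
    have h2 := h.curvature
    simp [N14] at h1 h2
    have hT : T₂ = 0 := by linarith
    subst hT
    rcases h2 with h2 | h2
    · exact hκ (by linarith)
    · exact hκ' (by linarith)
  | n24 κ θ T₂ hθ hκ =>
    refine IsDiagonal.nonempty_lieEquiv_KB_prod_KB_of_zero (by constructor <;> simp [N24])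
      (fun h => ?_) (by simp [N24]) (by simp [N24]; ring_nf; exact hθ)
    have h1 := h.torsion
    have h2 := h.curvature
    simp only [N24, Matrix.cons_val_zero, Matrix.cons_val_one] at h1 h2
    have hT : T₂ = 0 := by linarith
    subst hT
    exact hκ (by linarith)

theorem ModelA49.nonempty_lieEquiv {B : Coeff} (hB : ModelA49 B) :
    Nonempty (killing B ≃ₗ⁅ℝ⁆ A49) := by
  cases hB with
  | n56 ε hε =>
    refine IsDiagonal.nonempty_lieEquiv_A49 (by constructor <;> simp [N56])
      (fun h => ?_) (by simp [N56]) (by simp [N56])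
    have := h.torsion
    simp [N56] at this
    exact hε (by linarith)
  | n34 c T₂ hc =>
    refine IsDiagonal.nonempty_lieEquiv_A49 (by constructor <;> simp [N34])
      (fun h => ?_) (by simp [N34]) (by simp [N34]; ring)
    have h1 := h.torsion
    have h2 := h.curvature
    simp only [N34, Matrix.cons_val_zero, Matrix.cons_val_one] at h1 h2
    have hT : T₂ = 0 := by linarith
    subst hT
    refine hc (mul_self_eq_zero.1 ?_)
    linarith

/-! ### Flat models -/

/-- The function `u` is affine for the connection of `A`: its second covariant derivative
vanishes. -/
structure IsAffine (A : Coeff) (u : Plane → ℝ) : Prop where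
  smooth : ContDiffOn ℝ ∞ u halfPlane
  hess : ∀ i j, ∀ x ∈ halfPlane, pd i (pd j u) x = ∑ k, christoffel A i j k x * pd k u x

/-- The derivative of the function `u` along the vector field `v`. -/
noncomputable def derivAlong (v : VectorFields) (u : Plane → ℝ) : Plane → ℝ :=
  fun x => v.1 x 0 * pd 0 u x + v.1 x 1 * pd 1 u x

/-- On an affine function, the Lie derivative of the connection along `v` is the covariant Hessian
of the derivative along `v`. So `v` is Killing as soon as it maps affine coordinates to affine
functions. -/
theorem killingExpr_eq_hess {A : Coeff} {u : Plane → ℝ} (hu : IsAffine A u) (v : VectorFields)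
    (i j : Fin 2) {x : Plane} (hx : x ∈ halfPlane) :
    pd i (pd j (derivAlong v u)) x - ∑ k, christoffel A i j k x * pd k (derivAlong v u) x =
      ∑ k, killingExpr (christoffel A) v.1 i j k x * pd k u x := by
  have hV := component_smooth v.2
  have hΓ := christoffel_smooth A
  have hU := fun k => pd_smooth k hu.smooth
  have e1 : ∀ j, ∀ y ∈ halfPlane, pd j (derivAlong v u) y =
      pd j (fun y => v.1 y 0) y * pd 0 u y + v.1 y 0 * pd j (pd 0 u) y
        + (pd j (fun y => v.1 y 1) y * pd 1 u y + v.1 y 1 * pd j (pd 1 u) y) := by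
    intro j y hy
    unfold derivAlong
    rw [pd_add j ((hV 0).mul (hU 0)) ((hV 1).mul (hU 1)) hy, pd_mul j (hV 0) (hU 0) hy,
      pd_mul j (hV 1) (hU 1) hy]
  have e3 : ∀ i j k, pd i (pd j (pd k u)) x =
      pd k (christoffel A i j 0) x * pd 0 u x + christoffel A i j 0 x * pd k (pd 0 u) x
      + (pd k (christoffel A i j 1) x * pd 1 u x + christoffel A i j 1 x * pd k (pd 1 u) x) := by
    intro i j k
    rw [pd_congr i (fun y hy => pd_comm j k hu.smooth hy) hx, pd_comm i k (hU j) hx,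
      pd_congr k (fun y hy => hu.hess i j y hy) hx]
    simp only [Fin.sum_univ_two]
    rw [pd_add k ((hΓ i j 0).mul (hU 0)) ((hΓ i j 1).mul (hU 1)) hx,
      pd_mul k (hΓ i j 0) (hU 0) hx, pd_mul k (hΓ i j 1) (hU 1) hx]
  rw [pd_congr i (fun y hy => e1 j y hy) hx]
  have s1 := fun k => (pd_smooth j (hV k)).mul (hU k)
  have s2 := fun k => (hV k).mul (pd_smooth j (hU k))
  rw [pd_add i ((s1 0).add (s2 0)) ((s1 1).add (s2 1)) hx, pd_add i (s1 0) (s2 0) hx,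
    pd_add i (s1 1) (s2 1) hx, pd_mul i (pd_smooth j (hV 0)) (hU 0) hx,
    pd_mul i (pd_smooth j (hV 1)) (hU 1) hx, pd_mul i (hV 0) (pd_smooth j (hU 0)) hx,
    pd_mul i (hV 1) (pd_smooth j (hU 1)) hx, e3 i j 0, e3 i j 1]
  have c : ∀ k, pd j (pd k u) x = pd k (pd j u) x := fun k => pd_comm j k hu.smooth hx
  have h2 : ∀ i j, pd i (pd j u) x =
      christoffel A i j 0 x * pd 0 u x + christoffel A i j 1 x * pd 1 u x := fun i j => by
    rw [hu.hess i j x hx, Fin.sum_univ_two]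
  simp only [Fin.sum_univ_two, e1 _ x hx, killingExpr]
  have R := ((h2 0 1).symm.trans (pd_comm 0 1 hu.smooth hx)).trans (h2 1 0)
  rw [c 0, c 1]
  simp only [h2]
  linear_combination (v.1 x 0 * christoffel A i j 1 x - v.1 x 1 * christoffel A i j 0 x) * R

/-- A flat chart: two affine functions with independent differentials on the half plane. -/
structure FlatChart (A : Coeff) where
  /-- The first affine coordinate. -/
  u : Plane → ℝ
  /-- The second affine coordinate. -/
  w : Plane → ℝ
  affine_u : IsAffine A u
  affine_w : IsAffine A w
  jac : ∀ x ∈ halfPlane, pd 0 u x * pd 1 w x - pd 1 u x * pd 0 w x ≠ 0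

namespace FlatChart

variable {A : Coeff} (C : FlatChart A)

/-- The Jacobian determinant of a flat chart. -/
noncomputable def det (x : Plane) : ℝ := pd 0 C.u x * pd 1 C.w x - pd 1 C.u x * pd 0 C.w x

theorem smooth_det_inv : ContDiffOn ℝ ∞ (fun x => (C.det x)⁻¹) halfPlane := by
  have hu := C.affine_u.smooth
  have hw := C.affine_w.smooth
  refine ContDiffOn.inv ?_ C.jac
  exact ((pd_smooth 0 hu).mul (pd_smooth 1 hw)).sub ((pd_smooth 1 hu).mul (pd_smooth 0 hw))

/-- The affine combination `r u + s w + t` of the affine coordinates. -/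
noncomputable def comb (r : Fin 3 → ℝ) : Plane → ℝ := fun x => r 0 * C.u x + r 1 * C.w x + r 2

theorem smooth_comb (r : Fin 3 → ℝ) : ContDiffOn ℝ ∞ (C.comb r) halfPlane :=
  (((smooth_const _).mul C.affine_u.smooth).add ((smooth_const _).mul C.affine_w.smooth)).add
    (smooth_const _)

theorem pd_comb (r : Fin 3 → ℝ) (i : Fin 2) {x : Plane} (hx : x ∈ halfPlane) :
    pd i (C.comb r) x = r 0 * pd i C.u x + r 1 * pd i C.w x := by
  have hu := C.affine_u.smooth
  have hw := C.affine_w.smooth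
  unfold comb
  rw [pd_add i (((smooth_const _).mul hu).add ((smooth_const _).mul hw)) (smooth_const _) hx,
    pd_add i ((smooth_const _).mul hu) ((smooth_const _).mul hw) hx, pd_const_mul i _ hu hx,
    pd_const_mul i _ hw hx, pd_const, add_zero]

theorem isAffine_comb (r : Fin 3 → ℝ) : IsAffine A (C.comb r) := by
  refine ⟨C.smooth_comb r, fun i j x hx => ?_⟩
  have hu := pd_smooth j C.affine_u.smooth
  have hw := pd_smooth j C.affine_w.smooth
  rw [pd_congr i (fun y hy => C.pd_comb r j hy) hx,
    pd_add i ((smooth_const _).mul hu) ((smooth_const _).mul hw) hx, pd_const_mul i _ hu hx,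
    pd_const_mul i _ hw hx, C.affine_u.hess i j x hx, C.affine_w.hess i j x hx]
  simp only [Fin.sum_univ_two, C.pd_comb r _ hx]
  ring

/-- The vector field `v` with `v(u) = U` and `v(w) = W`, by Cramer's rule. -/
noncomputable def cramer (U W : Plane → ℝ) (hU : ContDiffOn ℝ ∞ U halfPlane)
    (hW : ContDiffOn ℝ ∞ W halfPlane) : VectorFields :=
  ofComponents (fun x => (U x * pd 1 C.w x - W x * pd 1 C.u x) * (C.det x)⁻¹)
    (fun x => (W x * pd 0 C.u x - U x * pd 0 C.w x) * (C.det x)⁻¹)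
    (((hU.mul (pd_smooth 1 C.affine_w.smooth)).sub
      (hW.mul (pd_smooth 1 C.affine_u.smooth))).mul C.smooth_det_inv)
    (((hW.mul (pd_smooth 0 C.affine_u.smooth)).sub
      (hU.mul (pd_smooth 0 C.affine_w.smooth))).mul C.smooth_det_inv)

section cramer

variable {U W : Plane → ℝ} {hU : ContDiffOn ℝ ∞ U halfPlane} {hW : ContDiffOn ℝ ∞ W halfPlane}
  {x : Plane}

theorem derivAlong_cramer_u (hx : x ∈ halfPlane) : derivAlong (C.cramer U W hU hW) C.u x = U x := by
  have h : C.det x ≠ 0 := C.jac x hx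
  have e0 : (C.cramer U W hU hW).1 x 0 = _ := ofComponents_apply 0 hx
  have e1 : (C.cramer U W hU hW).1 x 1 = _ := ofComponents_apply 1 hx
  simp only [Matrix.cons_val_zero, Matrix.cons_val_one] at e0 e1
  rw [derivAlong, e0, e1]
  field_simp
  rw [det]; ring

theorem derivAlong_cramer_w (hx : x ∈ halfPlane) : derivAlong (C.cramer U W hU hW) C.w x = W x := by
  have h : C.det x ≠ 0 := C.jac x hx
  have e0 : (C.cramer U W hU hW).1 x 0 = _ := ofComponents_apply 0 hx
  have e1 : (C.cramer U W hU hW).1 x 1 = _ := ofComponents_apply 1 hx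
  simp only [Matrix.cons_val_zero, Matrix.cons_val_one] at e0 e1
  rw [derivAlong, e0, e1]
  field_simp
  rw [det]; ring

end cramer

theorem ext_derivAlong {v v' : VectorFields}
    (hu : ∀ x ∈ halfPlane, derivAlong v C.u x = derivAlong v' C.u x)
    (hw : ∀ x ∈ halfPlane, derivAlong v C.w x = derivAlong v' C.w x) : v = v' := by
  refine vectorField_ext fun x hx k => ?_
  have h := C.jac x hx
  have h1 := hu x hx
  have h2 := hw x hx
  simp only [derivAlong] at h1 h2
  fin_cases k
  · change v.1 x 0 = v'.1 x 0
    exact mul_right_cancel₀ h (by linear_combination pd 1 C.w x * h1 - pd 1 C.u x * h2)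
  · change v.1 x 1 = v'.1 x 1
    exact mul_right_cancel₀ h (by linear_combination pd 0 C.u x * h2 - pd 0 C.w x * h1)

theorem mem_killing {v : VectorFields} {r s : Fin 3 → ℝ}
    (hu : ∀ x ∈ halfPlane, derivAlong v C.u x = C.comb r x)
    (hw : ∀ x ∈ halfPlane, derivAlong v C.w x = C.comb s x) : v ∈ killing A := by
  intro i j k x hx
  have key : ∀ {f : Plane → ℝ} {r : Fin 3 → ℝ}, IsAffine A f →
      (∀ x ∈ halfPlane, derivAlong v f x = C.comb r x) →
      ∑ k, killingExpr (christoffel A) v.1 i j k x * pd k f x = 0 := by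
    intro f r hf h
    have h1 : ∀ k, ∀ y ∈ halfPlane, pd k (derivAlong v f) y = pd k (C.comb r) y :=
      fun k y hy => pd_congr k h hy
    rw [← killingExpr_eq_hess hf v i j hx, pd_congr i (h1 j) hx,
      (C.isAffine_comb r).hess i j x hx]
    simp [Fin.sum_univ_two, h1 _ x hx]
  have h := C.jac x hx
  have h1 := key C.affine_u hu
  have h2 := key C.affine_w hw
  simp only [Fin.sum_univ_two] at h1 h2
  fin_cases k
  · exact (mul_eq_zero.1 (by linear_combination pd 1 C.w x * h1 - pd 1 C.u x * h2 :
      killingExpr (christoffel A) v.1 i j 0 x *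
        (pd 0 C.u x * pd 1 C.w x - pd 1 C.u x * pd 0 C.w x) = 0)).resolve_right h
  · exact (mul_eq_zero.1 (by linear_combination pd 0 C.u x * h2 - pd 0 C.w x * h1 :
      killingExpr (christoffel A) v.1 i j 1 x *
        (pd 0 C.u x * pd 1 C.w x - pd 1 C.u x * pd 0 C.w x) = 0)).resolve_right h

theorem derivAlong_lie {f : Plane → ℝ} (hf : ContDiffOn ℝ ∞ f halfPlane) (v v' : VectorFields)
    {x : Plane} (hx : x ∈ halfPlane) : derivAlong ⁅v, v'⁆ f x =
      derivAlong v (derivAlong v' f) x - derivAlong v' (derivAlong v f) x := by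
  have h0 := pd_smooth 0 hf
  have h1 := pd_smooth 1 hf
  have hV := component_smooth v.2
  have hV' := component_smooth v'.2
  have e : ∀ (v : VectorFields) (j : Fin 2), pd j (derivAlong v f) x =
      pd j (fun y => v.1 y 0) x * pd 0 f x + v.1 x 0 * pd j (pd 0 f) x
        + (pd j (fun y => v.1 y 1) x * pd 1 f x + v.1 x 1 * pd j (pd 1 f) x) := by
    intro v j
    have hV := component_smooth v.2
    unfold derivAlong
    rw [pd_add j ((hV 0).mul h0) ((hV 1).mul h1) hx, pd_mul j (hV 0) h0 hx,
      pd_mul j (hV 1) h1 hx]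
  rw [derivAlong, derivAlong, derivAlong, e, e, e, e, lie_apply _ _ _ hx, lie_apply _ _ _ hx,
    pd_comm 1 0 hf hx]
  ring

end FlatChart

section

attribute [local instance] LieRing.ofAssociativeRing

namespace FlatChart

variable {A : Coeff} (C : FlatChart A)

/-- The row `i` of `-X`, for an affine matrix `X`. -/
def negRow (X : affineMatrices) (i : Fin 3) : Fin 3 → ℝ := fun j => -X.1 i j

theorem negRow_add (X Y : affineMatrices) (i j : Fin 3) :
    negRow (X + Y) i j = negRow X i j + negRow Y i j := neg_add _ _

theorem negRow_smul (c : ℝ) (X : affineMatrices) (i j : Fin 3) :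
    negRow (c • X) i j = c * negRow X i j := (mul_neg c (X.1 i j)).symm

theorem negRow_lie (X Y : affineMatrices) (i j : Fin 3) :
    negRow ⁅X, Y⁆ i j = (negRow Y i 0 * negRow X 0 j - negRow X i 0 * negRow Y 0 j)
      + (negRow Y i 1 * negRow X 1 j - negRow X i 1 * negRow Y 1 j) := by
  have hX : X.1 2 j = 0 := X.2 j
  have hY : Y.1 2 j = 0 := Y.2 j
  have e : negRow ⁅X, Y⁆ i j = -((X.1 * Y.1 - Y.1 * X.1 : Matrix (Fin 3) (Fin 3) ℝ) i j) := rfl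
  rw [e]
  simp only [negRow, Matrix.sub_apply, Matrix.mul_apply, Fin.sum_univ_three, hX, hY]
  ring

/-- The vector field whose flow moves the affine coordinates by `-X`, for an affine matrix `X`. The
sign makes the assignment a homomorphism. -/
noncomputable def affineField (X : affineMatrices) : VectorFields :=
  C.cramer (C.comb (negRow X 0)) (C.comb (negRow X 1)) (C.smooth_comb _) (C.smooth_comb _)

theorem derivAlong_affineField_u (X : affineMatrices) {x : Plane} (hx : x ∈ halfPlane) :
    derivAlong (C.affineField X) C.u x = C.comb (negRow X 0) x :=
  C.derivAlong_cramer_u hx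

theorem derivAlong_affineField_w (X : affineMatrices) {x : Plane} (hx : x ∈ halfPlane) :
    derivAlong (C.affineField X) C.w x = C.comb (negRow X 1) x :=
  C.derivAlong_cramer_w hx

theorem derivAlong_affineField_comb (X : affineMatrices) (r : Fin 3 → ℝ) {x : Plane}
    (hx : x ∈ halfPlane) : derivAlong (C.affineField X) (C.comb r) x =
      r 0 * C.comb (negRow X 0) x + r 1 * C.comb (negRow X 1) x := by
  rw [← C.derivAlong_affineField_u X hx, ← C.derivAlong_affineField_w X hx]
  simp only [derivAlong, C.pd_comb r _ hx]
  ring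

theorem affineField_mem_killing (X : affineMatrices) : C.affineField X ∈ killing A :=
  C.mem_killing (fun _ hx => C.derivAlong_affineField_u X hx)
    fun _ hx => C.derivAlong_affineField_w X hx

theorem affineField_lie (X Y : affineMatrices) :
    C.affineField ⁅X, Y⁆ = ⁅C.affineField X, C.affineField Y⁆ := by
  have key : ∀ {f : Plane → ℝ} (i : Fin 3), ContDiffOn ℝ ∞ f halfPlane →
      (∀ Z : affineMatrices, ∀ x ∈ halfPlane,
        derivAlong (C.affineField Z) f x = C.comb (negRow Z i) x) →
      ∀ x ∈ halfPlane, derivAlong (C.affineField ⁅X, Y⁆) f x =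
        derivAlong ⁅C.affineField X, C.affineField Y⁆ f x := by
    intro f i hf h x hx
    have c : ∀ Z W : affineMatrices, derivAlong (C.affineField Z)
        (derivAlong (C.affineField W) f) x =
        derivAlong (C.affineField Z) (C.comb (negRow W i)) x := by
      intro Z W
      have e := fun k => pd_congr k (h W) hx
      rw [derivAlong, derivAlong, e, e]
    rw [h _ x hx, derivAlong_lie hf _ _ hx, c, c, C.derivAlong_affineField_comb X _ hx,
      C.derivAlong_affineField_comb Y _ hx]
    simp only [comb, negRow_lie]
    ring
  exact C.ext_derivAlong (key 0 C.affine_u.smooth fun Z x hx => C.derivAlong_affineField_u Z hx)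
    (key 1 C.affine_w.smooth fun Z x hx => C.derivAlong_affineField_w Z hx)

theorem derivAlong_add (u v : VectorFields) (f : Plane → ℝ) (x : Plane) :
    derivAlong (u + v) f x = derivAlong u f x + derivAlong v f x := by
  have e : ∀ k, (u + v).1 x k = u.1 x k + v.1 x k := fun _ => rfl
  simp only [derivAlong, e]; ring

theorem derivAlong_smul (c : ℝ) (v : VectorFields) (f : Plane → ℝ) (x : Plane) :
    derivAlong (c • v) f x = c * derivAlong v f x := by
  have e : ∀ k, (c • v).1 x k = c * v.1 x k := fun _ => rfl
  simp only [derivAlong, e]; ring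

theorem affineField_add (X Y : affineMatrices) :
    C.affineField (X + Y) = C.affineField X + C.affineField Y := by
  refine C.ext_derivAlong (fun x hx => ?_) fun x hx => ?_
  · simp only [derivAlong_add, C.derivAlong_affineField_u _ hx, comb, negRow_add]; ring
  · simp only [derivAlong_add, C.derivAlong_affineField_w _ hx, comb, negRow_add]; ring

theorem affineField_smul (c : ℝ) (X : affineMatrices) :
    C.affineField (c • X) = c • C.affineField X := by
  refine C.ext_derivAlong (fun x hx => ?_) fun x hx => ?_
  · simp only [derivAlong_smul, C.derivAlong_affineField_u _ hx, comb, negRow_smul]; ring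
  · simp only [derivAlong_smul, C.derivAlong_affineField_w _ hx, comb, negRow_smul]; ring

/-- The Lie algebra homomorphism from the affine Lie algebra defined by a flat chart. -/
noncomputable def affineHom : A6 →ₗ⁅ℝ⁆ killing A where
  toFun X := ⟨C.affineField X, C.affineField_mem_killing X⟩
  map_add' X Y := Subtype.ext (C.affineField_add X Y)
  map_smul' c X := Subtype.ext (C.affineField_smul c X)
  map_lie' {X Y} := Subtype.ext (C.affineField_lie X Y)

theorem comb_eq_zero {r : Fin 3 → ℝ} (h : ∀ x ∈ halfPlane, C.comb r x = 0) : r = 0 := by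
  have hp := basePoint_mem
  have h1 : ∀ k, r 0 * pd k C.u basePoint + r 1 * pd k C.w basePoint = 0 := fun k => by
    rw [← C.pd_comb r k hp, pd_congr k (g := fun _ => 0) h hp, pd_const]
  have hj := C.jac _ hp
  have r0 : r 0 = 0 := (mul_eq_zero.1 (by
    linear_combination pd 1 C.w basePoint * h1 0 - pd 0 C.w basePoint * h1 1 :
    r 0 * (pd 0 C.u basePoint * pd 1 C.w basePoint - pd 1 C.u basePoint * pd 0 C.w basePoint)
      = 0)).resolve_right hj
  have r1 : r 1 = 0 := (mul_eq_zero.1 (by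
    linear_combination pd 0 C.u basePoint * h1 1 - pd 1 C.u basePoint * h1 0 :
    r 1 * (pd 0 C.u basePoint * pd 1 C.w basePoint - pd 1 C.u basePoint * pd 0 C.w basePoint)
      = 0)).resolve_right hj
  have h2 := h _ hp
  rw [comb, r0, r1] at h2
  funext i
  fin_cases i
  · exact r0
  · exact r1
  · simpa using h2

theorem affineHom_injective : Function.Injective C.affineHom := by
  refine (injective_iff_map_eq_zero (C.affineHom : A6 →ₗ[ℝ] killing A)).2 fun X hX => ?_
  have h0 : C.affineField X = 0 := congrArg Subtype.val hX
  have z : ∀ f x, derivAlong 0 f x = 0 := fun f x => by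
    have e : ∀ k, (0 : VectorFields).1 x k = 0 := fun _ => rfl
    simp [derivAlong, e]
  have hu := C.comb_eq_zero (r := negRow X 0) fun x hx => by
    rw [← C.derivAlong_affineField_u X hx, h0, z]
  have hw := C.comb_eq_zero (r := negRow X 1) fun x hx => by
    rw [← C.derivAlong_affineField_w X hx, h0, z]
  refine Subtype.ext (Matrix.ext fun i j => ?_)
  fin_cases i
  · exact neg_eq_zero.1 (congrFun hu j)
  · exact neg_eq_zero.1 (congrFun hw j)
  · exact X.2 j

end FlatChart

instance : FiniteDimensional ℝ A6 :=
  inferInstanceAs (FiniteDimensional ℝ affineMatrices.toSubmodule)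

theorem le_finrank_A6 : 6 ≤ Module.finrank ℝ A6 := by
  let f : (Fin 2 → Fin 3 → ℝ) →ₗ[ℝ] A6 :=
    { toFun := fun x => (⟨Matrix.of ![x 0, x 1, 0], fun j => rfl⟩ : affineMatrices)
      map_add' := fun x y => Subtype.ext (Matrix.ext fun i j => by
        fin_cases i
        · rfl
        · rfl
        · exact (add_zero (0 : ℝ)).symm)
      map_smul' := fun c x => Subtype.ext (Matrix.ext fun i j => by
        fin_cases i
        · rfl
        · rfl
        · exact (mul_zero c).symm) }
  have hf : Function.Injective f := by
    intro x y hxy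
    have h : Matrix.of ![x 0, x 1, 0] = Matrix.of ![y 0, y 1, 0] := congrArg Subtype.val hxy
    funext i j
    fin_cases i
    · exact congrFun (congrFun h 0) j
    · exact congrFun (congrFun h 1) j
  have := LinearMap.finrank_le_finrank_of_injective hf
  simpa [Module.finrank_pi_fintype] using this

end

theorem FlatChart.nonempty_lieEquiv {A : Coeff} (C : FlatChart A) :
    Nonempty (killing A ≃ₗ⁅ℝ⁆ A6) := by
  have hinj : Function.Injective (C.affineHom : A6 →ₗ[ℝ] killing A) := C.affineHom_injective
  have h1 := LinearMap.finrank_le_finrank_of_injective hinj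
  have h2 := finrank_killing_le A
  have h3 := le_finrank_A6
  have hsurj := (LinearMap.injective_iff_surjective_of_finrank_eq_finrank
    (f := (C.affineHom : A6 →ₗ[ℝ] killing A)) (by omega)).1 hinj
  exact ⟨(LieEquiv.ofBijective C.affineHom ⟨hinj, hsurj⟩).symm⟩

/-- The function `φ(x¹) x² + ψ(x¹) + c (x²)²`. The affine coordinates of the flat models are of
this shape. -/
def quadratic (φ ψ : ℝ → ℝ) (c : ℝ) : Plane → ℝ :=
  fun x => φ (x 0) * x 1 + ψ (x 0) + c * (x 1 * x 1)

section quadratic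

variable {φ φ₁ φ₂ ψ ψ₁ ψ₂ : ℝ → ℝ}

theorem smooth_quadratic (c : ℝ) (hφ : ContDiffOn ℝ ∞ φ (Set.Ioi 0))
    (hψ : ContDiffOn ℝ ∞ ψ (Set.Ioi 0)) :
    ContDiffOn ℝ ∞ (quadratic φ ψ c) halfPlane :=
  (((smooth_comp_fst hφ).mul (smooth_coord 1)).add (smooth_comp_fst hψ)).add
    ((smooth_const c).mul ((smooth_coord 1).mul (smooth_coord 1)))

theorem pd_quadratic (hφ : HasTwoDerivs φ φ₁ φ₂) (hψ : HasTwoDerivs ψ ψ₁ ψ₂) (c : ℝ)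
    (i : Fin 2) {x : Plane} (hx : x ∈ halfPlane) :
    pd i (quadratic φ ψ c) x =
      if i = 0 then φ₁ (x 0) * x 1 + ψ₁ (x 0) else φ (x 0) + 2 * c * x 1 := by
  have s0 := smooth_comp_fst hφ.smooth
  have s1 := smooth_comp_fst hψ.smooth
  have sy := smooth_coord 1
  unfold quadratic
  rw [pd_add i ((s0.mul sy).add s1) ((smooth_const c).mul (sy.mul sy)) hx,
    pd_add i (s0.mul sy) s1 hx, pd_mul i s0 sy hx, pd_const_mul i c (sy.mul sy) hx,
    pd_mul i sy sy hx, pd_comp_fst i (hφ.first _ hx), pd_comp_fst i (hψ.first _ hx), pd_coord]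
  fin_cases i
  · simp
  · simp; ring

theorem pd_pd_quadratic (hφ : HasTwoDerivs φ φ₁ φ₂) (hψ : HasTwoDerivs ψ ψ₁ ψ₂) (c : ℝ)
    (i j : Fin 2) {x : Plane} (hx : x ∈ halfPlane) :
    pd i (pd j (quadratic φ ψ c)) x =
      if i = j then (if i = 0 then φ₂ (x 0) * x 1 + ψ₂ (x 0) else 2 * c) else φ₁ (x 0) := by
  have sy := smooth_coord 1
  rw [pd_congr i (fun y hy => pd_quadratic hφ hψ c j hy) hx]
  fin_cases j
  · have h0 := pd_comp_fst i (hφ.second _ hx)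
    have h1 := pd_comp_fst i (hψ.second _ hx)
    have s0 : DifferentiableAt ℝ (fun y : Plane => φ₁ (y 0)) x :=
      ((hφ.second _ hx).differentiableAt).comp x (differentiableAt_apply 0 x)
    have s1 : DifferentiableAt ℝ (fun y : Plane => ψ₁ (y 0)) x :=
      ((hψ.second _ hx).differentiableAt).comp x (differentiableAt_apply 0 x)
    have sy' : DifferentiableAt ℝ (fun y : Plane => y 1) x := differentiableAt_apply 1 x
    have hc := pd_coord i 1 x
    simp only [pd] at h0 h1 hc ⊢
    simp only [Fin.zero_eta, if_true]
    rw [fderiv_fun_add (s0.fun_mul sy') s1, fderiv_fun_mul s0 sy']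
    simp only [add_apply, smul_apply, smul_eq_mul, h0, h1, hc]
    fin_cases i
    · simp; ring
    · simp
  · simp only [Fin.mk_one, show (1 : Fin 2) ≠ 0 from by decide, if_false]
    rw [pd_add i (smooth_comp_fst hφ.smooth) ((smooth_const _).mul sy) hx,
      pd_const_mul i _ sy hx, pd_coord, pd_comp_fst i (hφ.first _ hx)]
    fin_cases i <;> simp

theorem isAffine_quadratic {A : Coeff} (hφ : HasTwoDerivs φ φ₁ φ₂) (hψ : HasTwoDerivs ψ ψ₁ ψ₂)
    (c : ℝ)
    (h00 : ∀ t y : ℝ, 0 < t → t * (φ₂ t * y + ψ₂ t) =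
      A 0 0 0 * (φ₁ t * y + ψ₁ t) + A 0 0 1 * (φ t + 2 * c * y))
    (h01 : ∀ t y : ℝ, 0 < t → t * φ₁ t =
      A 0 1 0 * (φ₁ t * y + ψ₁ t) + A 0 1 1 * (φ t + 2 * c * y))
    (h10 : ∀ t y : ℝ, 0 < t → t * φ₁ t =
      A 1 0 0 * (φ₁ t * y + ψ₁ t) + A 1 0 1 * (φ t + 2 * c * y))
    (h11 : ∀ t y : ℝ, 0 < t → t * (2 * c) =
      A 1 1 0 * (φ₁ t * y + ψ₁ t) + A 1 1 1 * (φ t + 2 * c * y)) :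
    IsAffine A (quadratic φ ψ c) := by
  refine ⟨smooth_quadratic c hφ.smooth hψ.smooth, fun i j x hx => ?_⟩
  have hx0 : x 0 ≠ 0 := (show 0 < x 0 from hx).ne'
  rw [pd_pd_quadratic hφ hψ c i j hx, Fin.sum_univ_two, pd_quadratic hφ hψ c 0 hx,
    pd_quadratic hφ hψ c 1 hx]
  simp only [christoffel]
  refine mul_left_cancel₀ hx0 ?_
  have e : ∀ a b p q : ℝ, x 0 * ((x 0)⁻¹ * a * p + (x 0)⁻¹ * b * q) = a * p + b * q := by
    intro a b p q; field_simp
  rw [e]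
  fin_cases i <;> fin_cases j
  · exact h00 _ _ hx
  · exact h01 _ _ hx
  · exact h10 _ _ hx
  · exact h11 _ _ hx

end quadratic

theorem hasTwoDerivs_inv :
    HasTwoDerivs (fun t => t⁻¹) (fun t => -(t ^ 2)⁻¹) (fun t => 2 * (t ^ 3)⁻¹) := by
  refine ⟨contDiffOn_id.inv fun t ht => (show 0 < t from ht).ne',
    fun t ht => hasDerivAt_inv ht.ne', fun t ht => ?_⟩
  have ht' := ht.ne'
  refine (((hasDerivAt_pow 2 t).inv (pow_ne_zero 2 ht')).neg).congr_deriv ?_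
  field_simp
  simp [mul_comm]

/-- A flat chart with affine coordinates `ψ(x¹) + c (x²)²` and `φ(x¹) x² + χ(x¹)`. -/
theorem nonempty_lieEquiv_A6_of_isAffine {A : Coeff} {φ φ₁ φ₂ χ χ₁ χ₂ ψ ψ₁ ψ₂ : ℝ → ℝ} {c : ℝ}
    (hφ : HasTwoDerivs φ φ₁ φ₂) (hχ : HasTwoDerivs χ χ₁ χ₂) (hψ : HasTwoDerivs ψ ψ₁ ψ₂)
    (hu : IsAffine A (quadratic (fun _ => 0) ψ c)) (hw : IsAffine A (quadratic φ χ 0))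
    (hj : ∀ t y : ℝ, 0 < t → ψ₁ t * φ t - 2 * c * y * (φ₁ t * y + χ₁ t) ≠ 0) :
    Nonempty (killing A ≃ₗ⁅ℝ⁆ A6) := by
  refine FlatChart.nonempty_lieEquiv ⟨_, _, hu, hw, fun x hx => ?_⟩
  have k0 := hasTwoDerivs_const 0
  rw [pd_quadratic k0 hψ c 0 hx, pd_quadratic k0 hψ c 1 hx, pd_quadratic hφ hχ 0 0 hx,
    pd_quadratic hφ hχ 0 1 hx]
  simpa using hj (x 0) (x 1) hx

theorem ModelA6.nonempty_lieEquiv {B : Coeff} (hB : ModelA6 B) :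
    Nonempty (killing B ≃ₗ⁅ℝ⁆ A6) := by
  have k0 := hasTwoDerivs_const 0
  have k1 := hasTwoDerivs_const 1
  cases hB with
  | n06 =>
    refine nonempty_lieEquiv_A6_of_isAffine k1 k0 hasTwoDerivs_id
      (isAffine_quadratic k0 hasTwoDerivs_id 0 ?_ ?_ ?_ ?_)
      (isAffine_quadratic k1 k0 0 ?_ ?_ ?_ ?_) ?_ <;> intro t y ht <;> simp [N06]
  | n16 s hs =>
    refine nonempty_lieEquiv_A6_of_isAffine k1 k0 (hasTwoDerivs_sq 1)
      (isAffine_quadratic k0 (hasTwoDerivs_sq 1) s ?_ ?_ ?_ ?_)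
      (isAffine_quadratic k1 k0 0 ?_ ?_ ?_ ?_) ?_ <;> intro t y ht <;> simp [N16]
    · ring
    · ring
    · exact ht.ne'
  | n26 c hc =>
    have kc := hasTwoDerivs_rpow c
    have e1 : ∀ t : ℝ, 0 < t → t ^ c = t * t ^ (c - 1) := fun t ht => by
      conv_lhs => rw [show c = (c - 1) + 1 by ring, Real.rpow_add_one ht.ne', mul_comm]
    have e2 : ∀ t : ℝ, 0 < t → t ^ (c - 1) = t * t ^ (c - 1 - 1) := fun t ht => by
      conv_lhs => rw [show c - 1 = (c - 1 - 1) + 1 by ring, Real.rpow_add_one ht.ne', mul_comm]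
    refine nonempty_lieEquiv_A6_of_isAffine kc k0 kc
      (isAffine_quadratic k0 kc 0 ?_ ?_ ?_ ?_)
      (isAffine_quadratic kc k0 0 ?_ ?_ ?_ ?_) ?_ <;> intro t y ht <;> simp [N26]
    · rw [e2 t ht]; ring
    · rw [e2 t ht]; ring
    · rw [e1 t ht]; ring
    · rw [e1 t ht]; ring
    · exact ⟨⟨hc, (Real.rpow_pos_of_pos ht _).ne'⟩, (Real.rpow_pos_of_pos ht _).ne'⟩
  | n36 =>
    have ki := hasTwoDerivs_inv
    have kl := hasTwoDerivs_log
    refine nonempty_lieEquiv_A6_of_isAffine ki kl ki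
      (isAffine_quadratic k0 ki 0 ?_ ?_ ?_ ?_)
      (isAffine_quadratic ki kl 0 ?_ ?_ ?_ ?_) ?_ <;> intro t y ht <;>
      have ht' := ht.ne' <;> simp [N36]
    · field_simp
    · field_simp; ring
    · field_simp
    · field_simp
    · exact ht'
  | n46 =>
    have kl := hasTwoDerivs_mul_log
    refine nonempty_lieEquiv_A6_of_isAffine k1 kl hasTwoDerivs_id
      (isAffine_quadratic k0 hasTwoDerivs_id 0 ?_ ?_ ?_ ?_)
      (isAffine_quadratic k1 kl 0 ?_ ?_ ?_ ?_) ?_ <;> intro t y ht <;>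
      have ht' := ht.ne' <;> simp [N46]
    field_simp
  | n56 =>
    have kl := hasTwoDerivs_log
    refine nonempty_lieEquiv_A6_of_isAffine k1 k0 kl
      (isAffine_quadratic k0 kl 0 ?_ ?_ ?_ ?_)
      (isAffine_quadratic k1 k0 0 ?_ ?_ ?_ ?_) ?_ <;> intro t y ht <;>
      have ht' := ht.ne' <;> simp [N56]
    · field_simp
    · exact ht'
  | n66 c hc hc' =>
    have kc := hasTwoDerivs_rpow (c + 1)
    have e2 : ∀ t : ℝ, 0 < t → t ^ (c + 1 - 1) = t * t ^ (c + 1 - 1 - 1) := fun t ht => by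
      conv_lhs => rw [show c + 1 - 1 = (c + 1 - 1 - 1) + 1 by ring, Real.rpow_add_one ht.ne',
        mul_comm]
    have hc1 : c + 1 ≠ 0 := fun h => hc' (by linarith)
    refine nonempty_lieEquiv_A6_of_isAffine k1 k0 kc
      (isAffine_quadratic k0 kc 0 ?_ ?_ ?_ ?_)
      (isAffine_quadratic k1 k0 0 ?_ ?_ ?_ ?_) ?_ <;> intro t y ht <;>
      try (simp [N66]; done)
    · rw [e2 t ht]; simp [N66]; ring
    · simp only [mul_one, mul_zero, zero_mul, sub_zero]
      exact mul_ne_zero hc1 (Real.rpow_pos_of_pos ht _).ne'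

/-! ### Normal forms of diagonal models -/

/-- The general diagonal coefficients. -/
def diagonal (a q r s : ℝ) : Coeff := ![![![a, q], ![0, r]], ![![0, s], ![0, 0]]]

theorem IsDiagonal.linEquiv_diagonal {A : Coeff} (h : IsDiagonal A) {α β q : ℝ} (hα : α ≠ 0)
    (hq : β * A 0 0 0 + α * A 0 0 1 = q + β * (A 0 1 1 + A 1 0 1)) :
    LinEquiv A (diagonal (A 0 0 0) q (A 0 1 1) (A 1 0 1)) := by
  obtain ⟨h1, h2, h3, h4⟩ := h
  refine linEquiv_iff.2 ⟨α, β, hα, ?_⟩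
  constructor <;> simp [diagonal, h1, h2, h3, h4]
  linear_combination hq

/-- The coefficient `A₁₁²` of a diagonal model can be removed by a shear, unless
`A₁₁¹ = A₁₂² + A₂₁²`, when it can only be rescaled. -/
theorem IsDiagonal.exists_linEquiv {A : Coeff} (h : IsDiagonal A) :
    LinEquiv A (diagonal (A 0 0 0) 0 (A 0 1 1) (A 1 0 1)) ∨
      A 0 0 0 = A 0 1 1 + A 1 0 1 ∧
        LinEquiv A (diagonal (A 0 0 0) 1 (A 0 1 1) (A 1 0 1)) := by
  by_cases ha : A 0 0 0 = A 0 1 1 + A 1 0 1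
  · by_cases hq : A 0 0 1 = 0
    · exact Or.inl (h.linEquiv_diagonal (α := 1) (β := 0) one_ne_zero (by rw [hq]; ring))
    · refine Or.inr ⟨ha, h.linEquiv_diagonal (α := (A 0 0 1)⁻¹) (β := 0) (inv_ne_zero hq) ?_⟩
      field_simp
      ring
  · have ha' : A 0 0 0 - (A 0 1 1 + A 1 0 1) ≠ 0 := sub_ne_zero.2 ha
    refine Or.inl (h.linEquiv_diagonal (α := 1)
      (β := -(A 0 0 1 / (A 0 0 0 - (A 0 1 1 + A 1 0 1)))) one_ne_zero ?_)
    field_simp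
    ring

theorem coeff_ext {A B : Coeff} (h000 : A 0 0 0 = B 0 0 0) (h001 : A 0 0 1 = B 0 0 1)
    (h010 : A 0 1 0 = B 0 1 0) (h011 : A 0 1 1 = B 0 1 1) (h100 : A 1 0 0 = B 1 0 0)
    (h101 : A 1 0 1 = B 1 0 1) (h110 : A 1 1 0 = B 1 1 0) (h111 : A 1 1 1 = B 1 1 1) : A = B := by
  ext i j k
  fin_cases i <;> fin_cases j <;> fin_cases k <;> assumption

theorem IsFlatDiagonal.exists_model {A : Coeff} (h : IsFlatDiagonal A) :
    ∃ B, ModelA6 B ∧ LinEquiv A B := by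
  have hr := h.torsion
  have hc := h.curvature
  rcases h.toIsDiagonal.exists_linEquiv with e | ⟨ha, e⟩
  · generalize A 0 0 0 = a, A 0 1 1 = r, A 1 0 1 = s at *
    subst hr
    rcases mul_eq_zero.1 hc with h0 | h0
    · subst h0
      by_cases ha : a = 0
      · refine ⟨_, ModelA6.n06, ?_⟩
        convert! e using 1
        refine coeff_ext ?_ ?_ ?_ ?_ ?_ ?_ ?_ ?_ <;> simp [N06, diagonal, ha]
      by_cases ha' : a = -1
      · refine ⟨_, ModelA6.n56, ?_⟩
        convert! e using 1
        refine coeff_ext ?_ ?_ ?_ ?_ ?_ ?_ ?_ ?_ <;> simp [N56, diagonal, ha']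
      refine ⟨_, ModelA6.n66 a ha ha', ?_⟩
      convert! e using 1
      refine coeff_ext ?_ ?_ ?_ ?_ ?_ ?_ ?_ ?_ <;> simp [N66, diagonal]
    · by_cases hr : r = 0
      · refine ⟨_, ModelA6.n56, ?_⟩
        convert! e using 1
        refine coeff_ext ?_ ?_ ?_ ?_ ?_ ?_ ?_ ?_ <;> simp [N56, diagonal, hr]
        linarith
      · refine ⟨_, ModelA6.n26 r hr, ?_⟩
        convert! e using 1
        refine coeff_ext ?_ ?_ ?_ ?_ ?_ ?_ ?_ ?_ <;> simp [N26, diagonal]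
        linarith
  · generalize A 0 0 0 = a, A 0 1 1 = r, A 1 0 1 = s at *
    subst hr ha
    rcases mul_eq_zero.1 hc with h0 | h0
    · refine ⟨_, ModelA6.n46, ?_⟩
      convert! e using 1
      refine coeff_ext ?_ ?_ ?_ ?_ ?_ ?_ ?_ ?_ <;> simp [N46, diagonal, h0]
    · have hr : r = -1 := by linarith
      refine ⟨_, ModelA6.n36, ?_⟩
      convert! e using 1
      refine coeff_ext ?_ ?_ ?_ ?_ ?_ ?_ ?_ ?_ <;> simp [N36, diagonal, hr]
      norm_num

theorem IsDiagonal.exists_model {A : Coeff} (h : IsDiagonal A) (hA : ¬ IsFlatDiagonal A) :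
    (∃ B, ModelKBKB B ∧ LinEquiv A B) ∨ ∃ B, ModelA49 B ∧ LinEquiv A B := by
  have hA' : A 0 1 1 = A 1 0 1 → A 0 1 1 * (A 0 1 1 - 1 - A 0 0 0) ≠ 0 := fun h1 h2 =>
    hA ⟨h, h1, h2⟩
  rcases h.exists_linEquiv with e | ⟨ha, e⟩
  · generalize A 0 0 0 = a, A 0 1 1 = r, A 1 0 1 = s at *
    -- `r = κ + T²` and `s = κ - T²`
    obtain ⟨κ, T, rfl, rfl⟩ : ∃ κ T, r = T + κ ∧ s = -T + κ :=
      ⟨(r + s) / 2, (r - s) / 2, by ring, by ring⟩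
    have hT : T = 0 → κ * (κ - 1 - a) ≠ 0 := fun hT => by
      have := hA' (by rw [hT]; ring)
      rwa [hT, zero_add] at this
    by_cases hκ : κ = 0
    · subst hκ
      have hT' : T ≠ 0 := fun h => hT h (zero_mul _)
      by_cases ha' : a = -1
      · refine Or.inr ⟨_, ModelA49.n56 T hT', ?_⟩
        convert! e using 1
        refine coeff_ext ?_ ?_ ?_ ?_ ?_ ?_ ?_ ?_ <;> simp [N56, diagonal, ha']
      by_cases ha : a = 0
      · refine Or.inl ⟨_, ModelKBKB.n06 T hT', ?_⟩
        convert! e using 1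
        refine coeff_ext ?_ ?_ ?_ ?_ ?_ ?_ ?_ ?_ <;> simp [N06, diagonal, ha]
      refine Or.inl ⟨_, ModelKBKB.n66 a T ha ha' hT', ?_⟩
      convert! e using 1
      refine coeff_ext ?_ ?_ ?_ ?_ ?_ ?_ ?_ ?_ <;> simp [N66, diagonal]
    by_cases hθ : a = 2 * κ - 1
    · refine Or.inr ⟨_, ModelA49.n34 κ T hκ, ?_⟩
      convert! e using 1
      refine coeff_ext ?_ ?_ ?_ ?_ ?_ ?_ ?_ ?_ <;> simp [N34, diagonal, hθ]
    by_cases hc : a = κ - 1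
    · have hT' : T ≠ 0 := fun h => hT h (by rw [hc]; ring)
      refine Or.inl ⟨_, ModelKBKB.n26 κ T hκ hT', ?_⟩
      convert! e using 1
      refine coeff_ext ?_ ?_ ?_ ?_ ?_ ?_ ?_ ?_ <;> simp [N26, diagonal, hc] <;> ring
    refine Or.inl ⟨_, ModelKBKB.n24 κ (a + 1 - 2 * κ) T (fun h => hθ (by linarith))
      (mul_ne_zero hκ fun h => hc (by linarith)), ?_⟩
    convert! e using 1
    refine coeff_ext ?_ ?_ ?_ ?_ ?_ ?_ ?_ ?_ <;> simp [N24, diagonal]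
    ring
  · generalize A 0 0 0 = a, A 0 1 1 = r, A 1 0 1 = s at *
    obtain ⟨κ, T, rfl, rfl⟩ : ∃ κ T, r = T + κ ∧ s = -T + κ :=
      ⟨(r + s) / 2, (r - s) / 2, by ring, by ring⟩
    have ha' : a = 2 * κ := by rw [ha]; ring
    have hT : T = 0 → κ * (κ + 1) ≠ 0 := fun hT h0 => by
      refine hA' (by rw [hT]; ring) ?_
      rw [hT, ha', zero_add]; linear_combination -h0
    refine Or.inl ?_
    by_cases hκ : κ = 0
    · subst hκ
      refine ⟨_, ModelKBKB.n46 T (fun h => hT h (zero_mul _)), ?_⟩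
      convert! e using 1
      refine coeff_ext ?_ ?_ ?_ ?_ ?_ ?_ ?_ ?_ <;> simp [N46, diagonal, ha']
    by_cases hκ' : κ = -1
    · refine ⟨_, ModelKBKB.n36 T (fun h => hT h (by rw [hκ']; ring)), ?_⟩
      convert! e using 1
      refine coeff_ext ?_ ?_ ?_ ?_ ?_ ?_ ?_ ?_ <;> simp [N36, diagonal, ha', hκ'] <;> ring
    refine ⟨_, ModelKBKB.n14 κ T hκ hκ', ?_⟩
    convert! e using 1
    refine coeff_ext ?_ ?_ ?_ ?_ ?_ ?_ ?_ ?_ <;> simp [N14, diagonal, ha']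

theorem LinEquiv.isTorsionFree {A B : Coeff} (h : LinEquiv A B) (hB : IsTorsionFree B) :
    IsTorsionFree A := by
  obtain ⟨a, b, ha, h⟩ := linEquiv_iff.1 h
  have e0 : A 0 1 0 = A 1 0 0 := by rw [h.e010, h.e100, hB 0]
  intro k
  fin_cases k
  · exact e0
  · refine mul_left_cancel₀ ha ?_
    have e1 := hB 1
    change a * A 0 1 1 = a * A 1 0 1
    linear_combination h.e011 - h.e101 - b * e0 + a * e1

theorem ModelA6.isTorsionFree {B : Coeff} (hB : ModelA6 B) : IsTorsionFree B := by
  intro k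
  cases hB <;> fin_cases k <;> simp [N06, N16, N26, N36, N46, N56, N66]

/-! ### Killing fields that commute with `∂₂` -/

/-- The coefficients linearly equivalent to `𝒩₁⁶(±; 0)`, written out. -/
structure IsRound (A : Coeff) : Prop where
  e110 : A 1 1 0 ≠ 0
  e010 : A 0 1 0 = -A 1 1 1
  e100 : A 1 0 0 = -A 1 1 1
  e011 : A 1 1 0 * A 0 1 1 = -A 1 1 1 ^ 2
  e101 : A 1 1 0 * A 1 0 1 = -A 1 1 1 ^ 2
  e000 : A 1 1 0 * A 0 0 0 = A 1 1 0 + A 1 1 1 ^ 2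
  e001 : A 1 1 0 ^ 2 * A 0 0 1 = A 1 1 1 * (A 1 1 0 + A 1 1 1 ^ 2)

/-- A nonzero real is `s α²` with `s = ±1` and `α ≠ 0`. -/
theorem exists_sign_mul_sq {c : ℝ} (hc : c ≠ 0) :
    ∃ s α : ℝ, (s = 1 ∨ s = -1) ∧ α ≠ 0 ∧ c = α ^ 2 * s := by
  rcases hc.lt_or_gt with h | h
  · refine ⟨-1, √(-c), Or.inr rfl, (Real.sqrt_pos.2 (by linarith)).ne', ?_⟩
    rw [Real.sq_sqrt (by linarith)]; ring
  · exact ⟨1, √c, Or.inl rfl, (Real.sqrt_pos.2 h).ne', by rw [Real.sq_sqrt h.le]; ring⟩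

theorem IsRound.exists_model {A : Coeff} (h : IsRound A) : ∃ B, ModelA6 B ∧ LinEquiv A B := by
  obtain ⟨h0, h1, h2, h3, h4, h5, h6⟩ := h
  obtain ⟨s, α, hs, hα, hc⟩ := exists_sign_mul_sq h0
  refine ⟨_, ModelA6.n16 s hs, linEquiv_iff.2 ⟨α, -(α * A 1 1 1 / A 1 1 0), hα, ?_⟩⟩
  have hs2 : s ^ 2 = 1 := by rcases hs with rfl | rfl <;> norm_num
  have hs0 : s ≠ 0 := by rintro rfl; norm_num at hs2
  have g3 : A 0 1 1 = -A 1 1 1 ^ 2 / A 1 1 0 := by rw [eq_div_iff h0]; linarith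
  have g4 : A 1 0 1 = -A 1 1 1 ^ 2 / A 1 1 0 := by rw [eq_div_iff h0]; linarith
  have g5 : A 0 0 0 = (A 1 1 0 + A 1 1 1 ^ 2) / A 1 1 0 := by rw [eq_div_iff h0]; linarith
  have g6 : A 0 0 1 = A 1 1 1 * (A 1 1 0 + A 1 1 1 ^ 2) / A 1 1 0 ^ 2 := by
    rw [eq_div_iff (pow_ne_zero 2 h0)]; linarith
  constructor <;> simp only [h1, h2, g3, g4, g5, g6, hc] <;> simp [N16] <;> field_simp <;> ring

/-- A Killing field of the form `f(x¹) ∂₁ + g(x¹) ∂₂` that is not a multiple of `∂₂` exists only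
if the model is diagonal or equivalent to `𝒩₁⁶(±; 0)`. -/
theorem isDiagonal_or_isRound {A : Coeff} {v : VectorFields} (hv : v ∈ killing A)
    (hy : ∀ k, ∀ x ∈ halfPlane, pd 1 (fun y => v.1 y k) x = 0)
    (hne : ∀ r : ℝ, v ≠ r • translation) : IsDiagonal A ∨ IsRound A := by
  have hf := component_smooth v.2 0
  have hg := component_smooth v.2 1
  have hv' := mem_killing_iff.1 hv
  simp only [Fin.sum_univ_two] at hv'
  have jetv : v.1 basePoint 0 = 0 → pd 0 (fun y => v.1 y 0) basePoint = 0 →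
      pd 0 (fun y => v.1 y 1) basePoint ≠ 0 := by
    intro h0 h1 h2
    have hp := basePoint_mem
    let r := v.1 basePoint 1
    refine hne r (congrArg Subtype.val (jet_injective A (a₁ := ⟨v, hv⟩)
      (a₂ := r • translationK A)
      (Prod.ext (funext fun k => ?_) (funext fun j => funext fun k => ?_))))
    · rw [map_smul]
      change v.1 basePoint k = r * translation.1 basePoint k
      rw [translation_apply k hp]
      fin_cases k
      · simpa using h0
      · simp [r]
    · rw [map_smul]
      change pd j (fun y => v.1 y k) basePoint = r * pd j (fun y => translation.1 y k) basePoint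
      rw [pd_congr j (fun y hy => translation_apply k hy) hp, pd_const, mul_zero]
      fin_cases j
      · fin_cases k
        · exact h1
        · exact h2
      · exact hy k _ hp
  set f : Plane → ℝ := fun y => v.1 y 0
  set g : Plane → ℝ := fun y => v.1 y 1
  have hy1 : ∀ k, ∀ i, ∀ x ∈ halfPlane, pd i (pd 1 (fun y => v.1 y k)) x = 0 := fun k i x hx => by
    rw [pd_congr i (g := fun _ => 0) (hy k) hx, pd_const]
  have f1 : ∀ x ∈ halfPlane, pd 1 f x = 0 := hy 0
  have g1 : ∀ x ∈ halfPlane, pd 1 g x = 0 := hy 1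
  have f01 : ∀ i, ∀ x ∈ halfPlane, pd i (pd 1 f) x = 0 := hy1 0
  have g01 : ∀ i, ∀ x ∈ halfPlane, pd i (pd 1 g) x = 0 := hy1 1
  have f10 : ∀ x ∈ halfPlane, pd 1 (pd 0 f) x = 0 := fun x hx => by
    rw [pd_comm 1 0 hf hx]; exact f01 0 x hx
  have g10 : ∀ x ∈ halfPlane, pd 1 (pd 0 g) x = 0 := fun x hx => by
    rw [pd_comm 1 0 hg hx]; exact g01 0 x hx
  have E : ∀ x ∈ halfPlane,
      A 1 1 0 * (f x + x 0 * pd 0 f x) = 0 ∧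
      A 1 1 1 * f x + A 1 1 0 * (x 0 * pd 0 g x) = 0 ∧
      A 0 1 0 * f x = A 1 1 0 * (x 0 * pd 0 g x) ∧
      A 1 0 0 * f x = A 1 1 0 * (x 0 * pd 0 g x) ∧
      A 0 1 1 * f x + A 0 1 0 * (x 0 * pd 0 g x) =
        A 0 1 1 * (x 0 * pd 0 f x) + A 1 1 1 * (x 0 * pd 0 g x) ∧
      A 1 0 1 * f x + A 1 0 0 * (x 0 * pd 0 g x) =
        A 1 0 1 * (x 0 * pd 0 f x) + A 1 1 1 * (x 0 * pd 0 g x) ∧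
      x 0 ^ 2 * pd 0 (pd 0 f) x = A 0 0 0 * f x - A 0 0 0 * (x 0 * pd 0 f x)
        - (A 0 1 0 + A 1 0 0) * (x 0 * pd 0 g x) ∧
      x 0 ^ 2 * pd 0 (pd 0 g) x = A 0 0 1 * f x - 2 * A 0 0 1 * (x 0 * pd 0 f x)
        + (A 0 0 0 - A 0 1 1 - A 1 0 1) * (x 0 * pd 0 g x) := by
    intro x hx
    have F1 := f1 x hx
    have G1 := g1 x hx
    refine ⟨?_, ?_, ?_, ?_, ?_, ?_, ?_, ?_⟩
    · have e := hv' 1 1 0 x hx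
      linear_combination -e + x 0 ^ 2 * f01 1 x hx
        + x 0 * (A 1 0 0 + A 0 1 0 - A 1 1 1) * F1 + 2 * x 0 * A 1 1 0 * G1
    · have e := hv' 1 1 1 x hx
      linear_combination -e + x 0 ^ 2 * g01 1 x hx
        + x 0 * (A 1 0 1 + A 0 1 1) * F1 + x 0 * A 1 1 1 * G1
    · have e := hv' 0 1 0 x hx
      linear_combination -e + x 0 ^ 2 * f01 0 x hx
        + x 0 * (A 0 0 0 - A 0 1 1) * F1 + x 0 * A 0 1 0 * G1
    · have e := hv' 1 0 0 x hx
      linear_combination -e + x 0 ^ 2 * f10 x hx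
        + x 0 * (A 0 0 0 - A 1 0 1) * F1 + x 0 * A 1 0 0 * G1
    · have e := hv' 0 1 1 x hx
      linear_combination -e + x 0 ^ 2 * g01 0 x hx + x 0 * A 0 0 1 * F1
    · have e := hv' 1 0 1 x hx
      linear_combination -e + x 0 ^ 2 * g10 x hx + x 0 * A 0 0 1 * F1
    · have e := hv' 0 0 0 x hx
      linear_combination e + x 0 * A 0 0 1 * F1
    · have e := hv' 0 0 1 x hx
      linear_combination e + x 0 * A 0 0 1 * G1
  by_cases hc : A 1 1 0 = 0
  · left
    simp only [hc, zero_mul, add_zero] at E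
    by_cases hf0 : ∃ x ∈ halfPlane, f x ≠ 0
    · obtain ⟨x, hx, hfx⟩ := hf0
      obtain ⟨-, e1, e2, e3, -⟩ := E x hx
      exact ⟨(mul_eq_zero.1 e2).resolve_right hfx, (mul_eq_zero.1 e3).resolve_right hfx, hc,
        (mul_eq_zero.1 e1).resolve_right hfx⟩
    · push Not at hf0
      have hD : ∀ x ∈ halfPlane, pd 0 f x = 0 := fun x hx => by
        rw [pd_congr 0 (g := fun _ => 0) hf0 hx, pd_const]
      have hDD : pd 0 (pd 0 f) basePoint = 0 := by
        rw [pd_congr 0 (g := fun _ => 0) hD basePoint_mem, pd_const]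
      have hG := jetv (hf0 _ basePoint_mem) (hD _ basePoint_mem)
      obtain ⟨-, -, -, -, e4, e5, e6, -⟩ := E _ basePoint_mem
      simp only [hf0 _ basePoint_mem, hD _ basePoint_mem, hDD, basePoint_zero] at e4 e5 e6
      have k1 : A 0 1 0 = A 1 1 1 := mul_right_cancel₀ hG (by linear_combination e4)
      have k2 : A 1 0 0 = A 1 1 1 := mul_right_cancel₀ hG (by linear_combination e5)
      have k3 : A 0 1 0 + A 1 0 0 = 0 := mul_right_cancel₀ hG (by linear_combination e6)
      exact ⟨by linarith, by linarith, hc, by linarith⟩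
  · right
    -- each identity follows from the equations at a point where `f` does not vanish
    obtain ⟨x, hx, hfx⟩ : ∃ x ∈ halfPlane, f x ≠ 0 := by
      by_contra! hf0
      have hD : pd 0 f basePoint = 0 := by
        rw [pd_congr 0 (g := fun _ => 0) hf0 basePoint_mem, pd_const]
      have e := (E _ basePoint_mem).2.1
      rw [hf0 _ basePoint_mem, basePoint_zero, mul_zero, zero_add, one_mul] at e
      exact jetv (hf0 _ basePoint_mem) hD ((mul_eq_zero.1 e).resolve_left hc)
    have hDf := pd_smooth 0 hf
    have hDg := pd_smooth 0 hg
    have hE0 : ∀ y ∈ halfPlane, f y + y 0 * pd 0 f y = 0 := fun y hy =>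
      (mul_eq_zero.1 (E y hy).1).resolve_left hc
    have hx0 : ContDiffOn ℝ ∞ (fun y : Plane => y 0) halfPlane := smooth_coord 0
    -- the derivatives of the first two equations
    have d1 : pd 0 f x + (pd 0 f x + x 0 * pd 0 (pd 0 f) x) = 0 := by
      have := pd_congr 0 (g := fun _ => 0) hE0 hx
      rw [pd_add 0 hf (hx0.mul hDf) hx, pd_fst_mul 0 hDf hx, pd_const] at this
      simpa using this
    have d2 : A 1 1 1 * pd 0 f x + A 1 1 0 * (pd 0 g x + x 0 * pd 0 (pd 0 g) x) = 0 := by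
      have := pd_congr 0 (g := fun _ => 0) (fun y hy => (E y hy).2.1) hx
      rw [pd_add 0 (contDiffOn_const.mul hf) (contDiffOn_const.mul (hx0.mul hDg)) hx,
        pd_const_mul _ _ hf hx, pd_const_mul _ _ (hx0.mul hDg) hx, pd_fst_mul 0 hDg hx,
        pd_const] at this
      simpa using this
    have e0 := hE0 x hx
    obtain ⟨-, e1, e2, e3, e4, e5, e6, e7⟩ := E x hx
    generalize pd 0 (pd 0 f) x = fxx, pd 0 (pd 0 g) x = gxx, pd 0 f x = fx, pd 0 g x = gx,
      f x = f at *
    have k1 : A 0 1 0 = -A 1 1 1 := mul_right_cancel₀ hfx (by linear_combination e2 + e1)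
    have k2 : A 1 0 0 = -A 1 1 1 := mul_right_cancel₀ hfx (by linear_combination e3 + e1)
    have hxx : x 0 ^ 2 * fxx = 2 * f := by linear_combination x 0 * d1 - 2 * e0
    have hgg : A 1 1 0 * (x 0 ^ 2 * gxx) = 2 * A 1 1 1 * f := by
      linear_combination x 0 * d2 - e1 - A 1 1 1 * e0
    rw [k1] at e4 e6
    rw [k2] at e5 e6
    have k3 : A 1 1 0 * A 0 1 1 = -A 1 1 1 ^ 2 := mul_right_cancel₀ hfx (by
      linear_combination (A 1 1 0 * e4 + A 1 1 0 * A 0 1 1 * e0 + 2 * A 1 1 1 * e1) / 2)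
    have k4 : A 1 1 0 * A 1 0 1 = -A 1 1 1 ^ 2 := mul_right_cancel₀ hfx (by
      linear_combination (A 1 1 0 * e5 + A 1 1 0 * A 1 0 1 * e0 + 2 * A 1 1 1 * e1) / 2)
    have k5 : A 1 1 0 * A 0 0 0 = A 1 1 0 + A 1 1 1 ^ 2 := mul_right_cancel₀ hfx (by
      linear_combination (-A 1 1 0 * e6 + A 1 1 0 * hxx + A 1 1 0 * A 0 0 0 * e0
        - 2 * A 1 1 1 * e1) / 2)
    refine ⟨hc, k1, k2, k3, k4, k5, mul_right_cancel₀ hfx ?_⟩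
    linear_combination (-A 1 1 0 ^ 2 * e7 + A 1 1 0 * hgg + 2 * A 1 1 0 ^ 2 * A 0 0 1 * e0
      + A 1 1 1 * f * k5 - A 1 1 1 * f * k3 - A 1 1 1 * f * k4
      - A 1 1 0 * (A 0 0 0 - A 0 1 1 - A 1 0 1) * e1) / 3

/-! ### Killing fields `Z` with `[∂₂, Z] = X` and `[X, Z] = Z` -/

/-- A Killing field that is mapped to a known field by `ad ∂₂`, and to a combination of itself and
`∂₂` by `ad X`, has its two-jet at `basePoint` determined by its value there. -/
theorem jet_of_lie {u v : VectorFields} {m e : ℝ} (hY : ⁅translation, v⁆ = u)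
    (hX : ⁅dilation, v⁆ = m • v + e • translation) (k : Fin 2) :
    pd 1 (fun y => v.1 y k) basePoint = u.1 basePoint k ∧
    pd 0 (fun y => v.1 y k) basePoint = (m + 1) * v.1 basePoint k + (if k = 0 then 0 else e) ∧
    (∀ i, pd i (pd 1 (fun y => v.1 y k)) basePoint = pd i (fun y => u.1 y k) basePoint) ∧
    pd 1 (pd 0 (fun y => v.1 y k)) basePoint = pd 0 (fun y => u.1 y k) basePoint ∧
    pd 0 (pd 0 (fun y => v.1 y k)) basePoint = m * pd 0 (fun y => v.1 y k) basePoint := by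
  have hV := component_smooth v.2 k
  have hU := component_smooth u.2 k
  have h1 : ∀ x ∈ halfPlane, pd 1 (fun y => v.1 y k) x = u.1 x k := fun x hx => by
    rw [← translation_lie_apply v k hx, hY]
  have h2 : ∀ x ∈ halfPlane, x 0 * pd 0 (fun y => v.1 y k) x + x 1 * u.1 x k =
      (m + 1) * v.1 x k + (if k = 0 then 0 else e) := fun x hx => by
    have h3 := dilation_lie_apply v k hx
    have h4 : (m • v + e • translation : VectorFields).1 x k =
      m * v.1 x k + e * translation.1 x k := rfl
    rw [hX, h4, h1 x hx, translation_apply k hx] at h3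
    have h5 : e * (if k = 0 then 0 else 1) = if k = 0 then 0 else e := by split_ifs <;> simp
    rw [h5] at h3
    linarith
  have h3 : ∀ i, pd i (pd 1 (fun y => v.1 y k)) basePoint = pd i (fun y => u.1 y k) basePoint :=
    fun i => pd_congr i h1 basePoint_mem
  refine ⟨h1 _ basePoint_mem, ?_, h3, ?_, ?_⟩
  · simpa using h2 _ basePoint_mem
  · rw [pd_comm 1 0 hV basePoint_mem, h3]
  · have h4 := pd_congr 0 h2 basePoint_mem
    have hDV := pd_smooth 0 hV
    rw [pd_add 0 ((smooth_coord 0).mul hDV) ((smooth_coord 1).mul hU) basePoint_mem,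
      pd_add 0 (contDiffOn_const.mul hV) contDiffOn_const basePoint_mem,
      pd_fst_mul 0 hDV basePoint_mem, pd_mul 0 (smooth_coord 1) hU basePoint_mem, pd_coord,
      pd_const_mul 0 _ hV basePoint_mem, pd_const] at h4
    simp at h4
    linarith

/-- The affine Killing equations at `basePoint` for a field `Z` with `[∂₂, Z] = X` and
`[X, Z] = Z`, whose value at `basePoint` is `(p, q)`. -/
structure IsSpecial (A : Coeff) (p q : ℝ) : Prop where
  e000 : 2 * p = -(A 0 0 0 * p) + A 0 0 1 - 2 * q * (A 0 1 0 + A 1 0 0)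
  e001 : 2 * q = -(3 * A 0 0 1 * p) + 2 * q * (A 0 0 0 - A 0 1 1 - A 1 0 1)
  e010 : 1 = A 0 1 0 * p + A 0 1 1 - A 0 0 0 - 2 * q * A 1 1 0
  e100 : 1 = A 1 0 0 * p + A 1 0 1 - A 0 0 0 - 2 * q * A 1 1 0
  e011 : 0 = -(A 0 1 1 * p) + 2 * q * (A 0 1 0 - A 1 1 1) - A 0 0 1
  e101 : 0 = -(A 1 0 1 * p) + 2 * q * (A 1 0 0 - A 1 1 1) - A 0 0 1
  e110 : 0 = 3 * A 1 1 0 * p + A 1 1 1 - A 1 0 0 - A 0 1 0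
  e111 : 1 = A 1 1 1 * p + 2 * q * A 1 1 0 - A 1 0 1 - A 0 1 1

theorem exists_isSpecial {A : Coeff} {Z : VectorFields} (hZ : Z ∈ killing A)
    (hY : ⁅translation, Z⁆ = dilation) (hX : ⁅dilation, Z⁆ = Z) : ∃ p q, IsSpecial A p q := by
  have hX' : ⁅dilation, Z⁆ = (1 : ℝ) • Z + (0 : ℝ) • translation := by rw [hX]; module
  have hd : ∀ i k, pd i (fun y => dilation.1 y k) basePoint = if k = i then 1 else 0 :=
    fun i k => by rw [pd_congr i (fun y hy => dilation_apply k hy) basePoint_mem, pd_coord]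
  obtain ⟨a1, a2, a3, a4, a5⟩ := jet_of_lie hY hX' 0
  obtain ⟨b1, b2, b3, b4, b5⟩ := jet_of_lie hY hX' 1
  rw [a2] at a5
  rw [b2] at b5
  simp only [hd, dilation_apply _ basePoint_mem] at a1 a3 a4 b1 b3 b4
  have E := fun i j k => mem_killing_iff.1 hZ i j k _ basePoint_mem
  simp only [Fin.sum_univ_two] at E
  have e000 := E 0 0 0
  have e001 := E 0 0 1
  have e010 := E 0 1 0
  have e100 := E 1 0 0
  have e011 := E 0 1 1
  have e101 := E 1 0 1
  have e110 := E 1 1 0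
  have e111 := E 1 1 1
  simp [a1, a2, a3, a4, a5, b1, b2, b3, b4, b5] at e000 e001 e010 e100 e011 e101 e110 e111
  exact ⟨Z.1 basePoint 0, Z.1 basePoint 1,
    ⟨by linear_combination e000, by linear_combination e001, by linear_combination e010,
      by linear_combination e100, by linear_combination e011, by linear_combination e101,
      by linear_combination e110, by linear_combination e111⟩⟩

/-- The coefficients obtained from `A` by the shear `(x¹, x²) ↦ (x¹, b x¹ + x²)`. -/
def shearCoeff (b : ℝ) (A : Coeff) : Coeff :=
  ![![![A 0 0 0 - b * (A 0 1 0 + A 1 0 0) + b ^ 2 * A 1 1 0,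
      A 0 0 1 + b * (A 0 0 0 - A 0 1 1 - A 1 0 1) + b ^ 2 * (A 1 1 1 - A 0 1 0 - A 1 0 0)
        + b ^ 3 * A 1 1 0],
    ![A 0 1 0 - b * A 1 1 0, A 0 1 1 + b * (A 0 1 0 - A 1 1 1) - b ^ 2 * A 1 1 0]],
    ![![A 1 0 0 - b * A 1 1 0, A 1 0 1 + b * (A 1 0 0 - A 1 1 1) - b ^ 2 * A 1 1 0],
      ![A 1 1 0, A 1 1 1 + b * A 1 1 0]]]

theorem linEquiv_shearCoeff (b : ℝ) (A : Coeff) : LinEquiv A (shearCoeff b A) := by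
  refine linEquiv_iff.2 ⟨1, b, one_ne_zero, ?_⟩
  constructor <;> simp [shearCoeff] <;> ring

/-- The shear with `b = p` makes `Z` vertical at `basePoint`. -/
theorem IsSpecial.shearCoeff {A : Coeff} {p q : ℝ} (h : IsSpecial A p q) :
    IsSpecial (shearCoeff p A) 0 (q + p ^ 2 / 2) := by
  obtain ⟨h1, h2, h3, h4, h5, h6, h7, h8⟩ := h
  -- the Killing equations are tensorial
  constructor <;> simp [TypeB.shearCoeff]
  · linear_combination h1 - p * (h3 + h4) + p ^ 2 * h7
  · linear_combination h2 + p * h1 - p * (h5 + p * h3 + h6 + p * h4) + p ^ 2 * (h8 + p * h7)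
  · linear_combination h3 - p * h7
  · linear_combination h4 - p * h7
  · linear_combination h5 + p * h3 - p * (h8 + p * h7)
  · linear_combination h6 + p * h4 - p * (h8 + p * h7)
  · linear_combination h7
  · linear_combination h8 + p * h7

/-- For `p = 0` the equations leave `A₁₂¹`, `A₂₁¹` and `A₂₂¹` free if `q = 0`, and determine all
coefficients if `q ≠ 0`. -/
theorem IsSpecial.solve {A : Coeff} {q : ℝ} (h : IsSpecial A 0 q) :
    A 1 1 1 = A 0 1 0 + A 1 0 0 ∧ A 0 0 1 = 0 ∧ A 0 1 1 = q * A 1 1 0 - 1 / 2 ∧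
    A 1 0 1 = q * A 1 1 0 - 1 / 2 ∧ A 0 0 0 = -3 / 2 - q * A 1 1 0 ∧
    (q ≠ 0 → A 0 1 0 = 0 ∧ A 1 0 0 = 0 ∧ q * A 1 1 0 = -1 / 2) := by
  obtain ⟨h1, h2, h3, h4, h5, h6, h7, h8⟩ := h
  have k1 : A 1 1 1 = A 0 1 0 + A 1 0 0 := by linear_combination -h7
  have k2 : A 0 0 1 = 0 := by linear_combination (h5 + h6 - h1 - 4 * q * k1) / 3
  have k3 : A 0 1 1 = q * A 1 1 0 - 1 / 2 := by linear_combination (h8 - h3 + h4) / 2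
  have k4 : A 1 0 1 = q * A 1 1 0 - 1 / 2 := by linear_combination (h8 + h3 - h4) / 2
  have k5 : A 0 0 0 = -3 / 2 - q * A 1 1 0 := by linear_combination h3 + k3
  refine ⟨k1, k2, k3, k4, k5, fun hq => ?_⟩
  have k6 : A 1 1 1 = 0 := mul_left_cancel₀ hq (by linear_combination (h1 + k2) / 2 + q * k1)
  refine ⟨mul_left_cancel₀ hq ?_, mul_left_cancel₀ hq ?_, mul_left_cancel₀ hq ?_⟩
  · linear_combination (-h5 + k2) / 2 + q * k6
  · linear_combination (-h6 + k2) / 2 + q * k6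
  · linear_combination (h2 + 2 * q * k5 - 2 * q * k3 - 2 * q * k4) / 6

/-- After the shear that gives `p = 0`, only the scaling of `x²` is left to normalize. -/
theorem IsSpecial.exists_model_of_zero {A : Coeff} {q : ℝ} (h : IsSpecial A 0 q) :
    IsDiagonal A ∨ ∃ B, ModelSO21 B ∧ LinEquiv A B := by
  obtain ⟨k1, k2, k3, k4, k5, k6⟩ := h.solve
  by_cases hq : q = 0
  · simp only [hq, zero_mul, zero_sub, sub_zero] at k3 k4 k5
    by_cases hm : A 1 1 1 = 0
    · have hw : A 1 0 0 = -A 0 1 0 := by linarith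
      by_cases hc : A 1 1 0 = 0
      · by_cases hu : A 0 1 0 = 0
        · exact Or.inl ⟨hu, by rw [hw, hu, neg_zero], hc, hm⟩
        · refine Or.inr ⟨_, ModelSO21.n26 _ hu, linEquiv_iff.2 ⟨1, 0, one_ne_zero, ?_⟩⟩
          constructor <;> simp [N26, hm, hc, hw, k2, k3, k4, k5] <;> norm_num
      · obtain ⟨s, α, hs, hα, hc'⟩ := exists_sign_mul_sq (mul_ne_zero two_ne_zero hc)
        refine Or.inr ⟨_, ModelSO21.n13 s (A 0 1 0 / α) hs, linEquiv_iff.2 ⟨α, 0, hα, ?_⟩⟩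
        constructor <;> simp [N13, hm, hw, k2, k3, k4, k5] <;> field_simp
        linarith
    · refine Or.inr ⟨_, ModelSO21.n23 (A 1 1 0 / (A 1 1 1 / 2) ^ 2)
        ((A 0 1 0 - A 1 0 0) / A 1 1 1), linEquiv_iff.2 ⟨A 1 1 1 / 2, 0, by simpa using hm, ?_⟩⟩
      constructor <;> simp [N23, k2, k3, k4, k5] <;> field_simp <;> linarith
  · obtain ⟨hu, hw, hc⟩ := k6 hq
    have hc0 : A 1 1 0 ≠ 0 := fun h => by rw [h] at hc; norm_num at hc
    rw [hc] at k3 k4 k5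
    rw [hu, hw, add_zero] at k1
    obtain ⟨s, α, rfl | rfl, hα, hs⟩ := exists_sign_mul_sq hc0
    · refine Or.inr ⟨_, ModelSO21.n43, linEquiv_iff.2 ⟨α, 0, hα, ?_⟩⟩
      constructor <;> simp [N43, hu, hw, k1, k2, k3, k4, k5, hs] <;> norm_num
    · refine Or.inr ⟨_, ModelSO21.n33, linEquiv_iff.2 ⟨α, 0, hα, ?_⟩⟩
      constructor <;> simp [N33, hu, hw, k1, k2, k3, k4, k5, hs] <;> norm_num

theorem IsSpecial.exists_model {A : Coeff} {p q : ℝ} (h : IsSpecial A p q) :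
    IsDiagonal A ∨ ∃ B, ModelSO21 B ∧ LinEquiv A B := by
  rcases h.shearCoeff.exists_model_of_zero with ⟨h1, h2, h3, h4⟩ | ⟨B, hB, hAB⟩
  · simp [TypeB.shearCoeff] at h1 h2 h3 h4
    rw [h3] at h1 h2 h4
    exact Or.inl ⟨by linarith, by linarith, h3, by linarith⟩
  · exact Or.inr ⟨B, hB, (linEquiv_shearCoeff p A).trans hAB⟩

theorem ModelSO21.isSpecial {B : Coeff} (hB : ModelSO21 B) : ∃ q, IsSpecial B 0 q := by
  cases hB with
  | n26 ε hε => refine ⟨0, ?_⟩; constructor <;> simp [N26]; norm_num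
  | n13 s T₁ hs => refine ⟨0, ?_⟩; constructor <;> simp [N13] <;> norm_num
  | n23 c T₁ => refine ⟨0, ?_⟩; constructor <;> simp [N23] <;> linarith
  | n33 => refine ⟨1 / 2, ?_⟩; constructor <;> simp [N33]
  | n43 => refine ⟨-1 / 2, ?_⟩; constructor <;> simp [N43] <;> norm_num

theorem ModelSO21.not_isDiagonal {B : Coeff} (hB : ModelSO21 B) : ¬ IsDiagonal B := by
  rintro ⟨h1, h2, h3, h4⟩
  cases hB with
  | n26 ε hε => exact hε h1
  | n13 s T₁ hs =>
    rcases hs with rfl | rfl <;> simp [N13] at h3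
  | n23 c T₁ => simp [N23] at h4
  | n33 => simp [N33] at h3
  | n43 => simp [N43] at h3

theorem IsSpecial.not_isRound {A : Coeff} {q : ℝ} (h : IsSpecial A 0 q) : ¬ IsRound A := by
  rintro ⟨h0, h1, h2, h3, -, h5, -⟩
  obtain ⟨k1, -, k3, -, k5, -⟩ := h.solve
  have hm : A 1 1 1 = 0 := by linarith
  rw [hm] at h3 h5
  have g3 : A 0 1 1 = 0 := mul_left_cancel₀ h0 (by linarith)
  have g5 : A 0 0 0 = 1 := mul_left_cancel₀ h0 (by linarith)
  linarith

/-- For `p = 0` the field is `x¹ x² ∂₁ + ((x²)² / 2 + q (x¹)²) ∂₂`. -/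
theorem IsSpecial.field_mem {A : Coeff} {q : ℝ} (h : IsSpecial A 0 q) :
    field 0 1 0 (fun t => q * t ^ 2) (hasTwoDerivs_sq q).smooth ∈ killing A := by
  rw [mem_killing_iff]
  obtain ⟨h1, h2, h3, h4, h5, h6, h7, h8⟩ := h
  intro i j k x hx
  have h := hasTwoDerivs_sq q
  fin_cases k
  · simp only [Fin.sum_univ_two, Fin.zero_eta, pd_pd_field_zero _ _ hx, pd_field_zero _ hx,
      pd_field_one h _ hx, field_zero hx]
    fin_cases i <;> fin_cases j <;> simp
    · linear_combination x 0 ^ 2 * h1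
    · linear_combination x 0 ^ 2 * h3
    · linear_combination x 0 ^ 2 * h4
    · linear_combination x 0 ^ 2 * h7
  · simp only [Fin.sum_univ_two, Fin.mk_one, pd_pd_field_one h _ _ hx, pd_field_zero _ hx,
      pd_field_one h _ hx, field_zero hx]
    fin_cases i <;> fin_cases j <;> simp
    · linear_combination x 0 ^ 2 * h2
    · linear_combination x 0 ^ 2 * h5
    · linear_combination x 0 ^ 2 * h6
    · linear_combination x 0 ^ 2 * h8

theorem translation_lie_field (q : ℝ) :
    ⁅translation, field 0 1 0 (fun t => q * t ^ 2) (hasTwoDerivs_sq q).smooth⁆ = dilation := by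
  refine vectorField_ext fun x hx k => ?_
  rw [translation_lie_apply _ _ hx, dilation_apply _ hx]
  fin_cases k
  · simp [pd_field_zero _ hx]
  · simp [pd_field_one (hasTwoDerivs_sq q) _ hx]

theorem dilation_lie_field (q : ℝ) :
    ⁅dilation, field 0 1 0 (fun t => q * t ^ 2) (hasTwoDerivs_sq q).smooth⁆ =
      field 0 1 0 (fun t => q * t ^ 2) (hasTwoDerivs_sq q).smooth := by
  refine vectorField_ext fun x hx k => ?_
  rw [dilation_lie_apply _ _ hx]
  fin_cases k
  · simp [pd_field_zero _ hx, field_zero hx]; ring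
  · simp [pd_field_one (hasTwoDerivs_sq q) _ hx, field_one hx]; ring

/-- No Killing field `W` continues the string `∂₂, X, Z` of `ad ∂₂`. The relation `[∂₂, W] = Z`
forces `[X, W] = 2 W + d ∂₂` when only multiples of `∂₂` commute with `∂₂`. -/
theorem IsSpecial.lie_ne {A : Coeff} {q d : ℝ} (h : IsSpecial A 0 q) {W : VectorFields}
    (hW : W ∈ killing A)
    (hY : ⁅translation, W⁆ = field 0 1 0 (fun t => q * t ^ 2) (hasTwoDerivs_sq q).smooth) :
    ⁅dilation, W⁆ ≠ (2 : ℝ) • W + d • translation := by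
  intro hX
  obtain ⟨k1, k2, k3, k4, k5, k6⟩ := h.solve
  have hp := basePoint_mem
  have hq := hasTwoDerivs_sq q
  obtain ⟨a1, a2, a3, a4, a5⟩ := jet_of_lie hY hX 0
  obtain ⟨b1, b2, b3, b4, b5⟩ := jet_of_lie hY hX 1
  rw [a2] at a5
  rw [b2] at b5
  simp only [pd_field_zero _ hp, field_zero hp] at a1 a3 a4
  simp only [pd_field_one hq _ hp, field_one hp] at b1 b3 b4
  have E := fun i j k => mem_killing_iff.1 hW i j k _ basePoint_mem
  simp only [Fin.sum_univ_two] at E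
  have e000 := E 0 0 0
  have e011 := E 0 1 1
  have e101 := E 1 0 1
  have e110 := E 1 1 0
  simp [a1, a2, a3, a5, b1, b2, b3, b4] at e000 e011 e101 e110
  generalize W.1 basePoint 0 = r, W.1 basePoint 1 = w at *
  by_cases hq0 : q = 0
  · subst hq0
    rw [k3, k1] at e011
    rw [k4, k1] at e101
    rw [k5] at e000
    have hr : r = 0 := by linear_combination (e000 - e011 - e101) / 5
    rw [hr] at e110
    linarith
  · obtain ⟨hu, hw, hc⟩ := k6 hq0
    rw [hu, hw, add_zero] at k1
    have hc0 : A 1 1 0 ≠ 0 := fun h => by rw [h] at hc; norm_num at hc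
    have hr : r = 0 := mul_left_cancel₀ hc0 (by linear_combination -e110 / 4 + hc / 2)
    simp only [hu, k1, hr] at e011
    exact hq0 (by linarith)

/-! ### The case `𝔰𝔬(2,1)` -/

section abstract

variable {L : Type*} [LieRing L] [LieAlgebra ℝ L] [FiniteDimensional ℝ L] {x y : L}

/-- If the centralizer of `y` is the line through `y`, then `ad y` acts as a single nilpotent block,
so outside the span of `y` and `x` there is a vector that continues the string `y, x`. -/
theorem exists_lie_eq (hyx : ⁅y, x⁆ = y) (hN : ∀ v : L, ⁅y, v⁆ = 0 → ∃ r : ℝ, v = r • y)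
    (hsp : ¬ ∀ v : L, ∃ s t : ℝ, v = s • y + t • x) : ∃ z : L, ⁅y, z⁆ = x ∧ ⁅x, z⁆ = z := by
  obtain ⟨v, hv, hvS⟩ : ∃ v, ⁅y, v⁆ ∈ Submodule.span ℝ {y, x} ∧
      v ∉ Submodule.span ℝ {y, x} := by
    by_contra! hS
    refine hsp fun v => ?_
    obtain ⟨s, t, h⟩ := Submodule.mem_span_pair.1 (mem_of_lie_mem_imp hyx hS v)
    exact ⟨s, t, h.symm⟩
  obtain ⟨α, β, h⟩ := Submodule.mem_span_pair.1 hv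
  have hβ : β ≠ 0 := by
    rintro rfl
    obtain ⟨r, hr⟩ := hN (v - α • x) (by rw [lie_sub, lie_smul, hyx, ← h]; module)
    exact hvS (Submodule.mem_span_pair.2 ⟨r, α, by rw [← hr]; module⟩)
  have h0 : ⁅y, β⁻¹ • (v - α • x)⁆ = x := by
    rw [lie_smul, lie_sub, lie_smul, hyx, ← h, add_sub_cancel_left, inv_smul_smul₀ hβ]
  generalize β⁻¹ • (v - α • x) = z at h0
  have hxy : ⁅x, y⁆ = -y := by rw [← lie_skew, hyx]
  obtain ⟨d, hd⟩ := hN (⁅x, z⁆ - z) (by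
    rw [lie_sub, leibniz_lie, hyx, h0, lie_self, add_zero, sub_self])
  refine ⟨z + (d / 2) • y, ?_, ?_⟩
  · rw [lie_add, h0, lie_smul, lie_self, smul_zero, add_zero]
  · rw [lie_add, lie_smul, hxy, sub_eq_iff_eq_add.1 hd]
    module

/-- A string `y, x, z` of `ad y` that cannot be continued spans, if the centralizer of `y` is the
line through `y`. -/
theorem exists_eq_of_lie_ne {z : L} (hyx : ⁅y, x⁆ = y) (hyz : ⁅y, z⁆ = x) (hxz : ⁅x, z⁆ = z)
    (hN : ∀ v : L, ⁅y, v⁆ = 0 → ∃ r : ℝ, v = r • y)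
    (hW : ∀ (w : L) (d : ℝ), ⁅y, w⁆ = z → ⁅x, w⁆ ≠ (2 : ℝ) • w + d • y) (v : L) :
    ∃ r s t : ℝ, v = r • y + s • x + t • z := by
  suffices v ∈ Submodule.span ℝ {y, x, z} by
    obtain ⟨r, s, t, h⟩ := Submodule.mem_span_triple.1 this
    exact ⟨r, s, t, h.symm⟩
  refine mem_of_lie_mem_imp hyx (fun v hv => ?_) v
  obtain ⟨α, β, γ, h⟩ := Submodule.mem_span_triple.1 hv
  have h0 : ⁅y, v - α • x - β • z⁆ = γ • z := by
    rw [lie_sub, lie_sub, lie_smul, lie_smul, hyx, hyz, ← h]; module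
  by_cases hγ : γ = 0
  · obtain ⟨r, hr⟩ := hN _ (h0.trans (by rw [hγ, zero_smul]))
    exact Submodule.mem_span_triple.2 ⟨r, α, β, by rw [← hr]; module⟩
  · exfalso
    have hw : ⁅y, γ⁻¹ • (v - α • x - β • z)⁆ = z := by rw [lie_smul, h0, inv_smul_smul₀ hγ]
    generalize γ⁻¹ • (v - α • x - β • z) = w at hw
    obtain ⟨d, hd⟩ := hN (⁅x, w⁆ - (2 : ℝ) • w) (by
      rw [lie_sub, leibniz_lie, hyx, hw, hxz, lie_smul, hw]; module)
    exact hW w d hw (by rw [← hd]; module)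

end abstract

theorem isDiagonal_or_isRound_of_lie_eq_zero {A : Coeff} {v : killing A}
    (hv : ⁅translationK A, v⁆ = 0) (hne : ∀ r : ℝ, v ≠ r • translationK A) :
    IsDiagonal A ∨ IsRound A := by
  refine isDiagonal_or_isRound v.2 (fun k x hx => ?_) fun r h => hne r (Subtype.ext h)
  have h0 : ⁅translation, v.1⁆ = 0 := congrArg Subtype.val hv
  rw [← translation_lie_apply _ _ hx, h0]
  rfl

theorem IsSpecial.nonempty_lieEquiv {A : Coeff} {q : ℝ} (h : IsSpecial A 0 q)
    (hA : ¬ IsDiagonal A) : Nonempty (killing A ≃ₗ⁅ℝ⁆ SO21) := by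
  have hN : ∀ v : killing A, ⁅translationK A, v⁆ = 0 → ∃ r : ℝ, v = r • translationK A := by
    intro v hv
    by_contra! hne
    exact (isDiagonal_or_isRound_of_lie_eq_zero hv hne).elim hA h.not_isRound
  let Z : killing A := ⟨_, h.field_mem⟩
  have hYX := translationK_lie_dilationK A
  have hYZ : ⁅translationK A, Z⁆ = dilationK A := Subtype.ext (translation_lie_field q)
  have hXZ : ⁅dilationK A, Z⁆ = Z := Subtype.ext (dilation_lie_field q)
  have hXY : ⁅dilationK A, translationK A⁆ = -translationK A := by rw [← lie_skew, hYX]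
  have hZY : ⁅Z, translationK A⁆ = -dilationK A := by rw [← lie_skew, hYZ]
  have hsp := exists_eq_of_lie_ne hYX hYZ hXZ hN fun w d hw hx =>
    h.lie_ne (d := d) w.2 (congrArg Subtype.val hw) (congrArg Subtype.val hx)
  refine nonempty_lieEquiv_SO21 (e₁ := translationK A) (e₂ := dilationK A) (e₃ := (-2 : ℝ) • Z)
    hYX (by rw [lie_smul, hXZ]) (by rw [smul_lie, hZY]; module) (fun r s t h0 => ?_)
    fun v => ?_
  · -- bracketing with `Y` lowers the relation to one between `Y` and `X`
    have h1 := congrArg (fun u => ⁅translationK A, u⁆) h0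
    simp only [lie_add, lie_smul, lie_self, hYX, hYZ, lie_zero] at h1
    obtain ⟨hs, ht⟩ := linearIndependent_translation_dilation A (s := s) (t := t * -2) (by
      rw [← h1]; module)
    have ht' : t = 0 := by linarith
    rw [hs, ht'] at h0
    exact ⟨(linearIndependent_translation_dilation A (s := r) (t := 0) (by
      rw [← h0]; module)).1, hs, ht'⟩
  · obtain ⟨r, s, t, rfl⟩ := hsp v
    exact ⟨r, s, -t / 2, by module⟩

theorem ModelSO21.nonempty_lieEquiv {B : Coeff} (hB : ModelSO21 B) :
    Nonempty (killing B ≃ₗ⁅ℝ⁆ SO21) :=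
  let ⟨_, h⟩ := hB.isSpecial
  h.nonempty_lieEquiv hB.not_isDiagonal

/-! ### The dimension of the Killing algebra -/

theorem linearIndependent_pair (A : Coeff) :
    LinearIndependent ℝ ![translationK A, dilationK A] :=
  LinearIndependent.pair_iff.2 fun _ _ h => linearIndependent_translation_dilation A h

theorem rank_killing_eq_two {A : Coeff} (h : ¬ 2 < Module.rank ℝ (killing A)) :
    Module.rank ℝ (killing A) = 2 := by
  refine le_antisymm (not_lt.1 h) ?_
  simpa using (linearIndependent_pair A).cardinal_le_rank

/-- `∂₂` and `X` span the Killing algebra exactly if its dimension is two. -/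
theorem not_two_lt_rank_iff {A : Coeff} : ¬ 2 < Module.rank ℝ (killing A) ↔
    ∀ v : killing A, ∃ s t : ℝ, v = s • translationK A + t • dilationK A := by
  constructor
  · intro h v
    have h2 : Module.finrank ℝ (killing A) = 2 :=
      Module.finrank_eq_of_rank_eq (by simpa using rank_killing_eq_two h)
    have hs := (linearIndependent_pair A).span_eq_top_of_card_eq_finrank' (by simp [h2])
    have hv : v ∈ Submodule.span ℝ (Set.range ![translationK A, dilationK A]) := by
      rw [hs]; trivial
    rw [Matrix.range_cons_cons_empty, Submodule.mem_span_pair] at hv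
    obtain ⟨s, t, hst⟩ := hv
    exact ⟨s, t, hst.symm⟩
  · intro h
    have hs : Submodule.span ℝ {translationK A, dilationK A} = ⊤ := by
      refine Submodule.eq_top_iff'.2 fun v => Submodule.mem_span_pair.2 ?_
      obtain ⟨s, t, rfl⟩ := h v
      exact ⟨s, t, rfl⟩
    rw [not_lt, ← rank_top ℝ (killing A), ← hs]
    refine (rank_span_le _).trans (Cardinal.mk_insert_le.trans ?_)
    rw [Cardinal.mk_singleton]
    norm_num

theorem nonempty_lieEquiv_KB_of_rank {A : Coeff} (h : ¬ 2 < Module.rank ℝ (killing A)) :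
    Nonempty (killing A ≃ₗ⁅ℝ⁆ KB) :=
  nonempty_lieEquiv_KB (translationK_lie_dilationK A)
    (fun _ _ => linearIndependent_translation_dilation A) (not_two_lt_rank_iff.1 h)

/-- Either some Killing field commutes with `∂₂` without being a multiple of it, or there is a
Killing field `Z` with `[∂₂, Z] = X` and `[X, Z] = Z`. -/
theorem cases_of_two_lt_rank {A : Coeff} (h : 2 < Module.rank ℝ (killing A)) :
    IsDiagonal A ∨ IsRound A ∨ ∃ p q, IsSpecial A p q := by
  by_cases hN : ∀ v : killing A, ⁅translationK A, v⁆ = 0 → ∃ r : ℝ, v = r • translationK A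
  · obtain ⟨Z, hY, hX⟩ := exists_lie_eq (translationK_lie_dilationK A) hN
      fun hs => not_two_lt_rank_iff.2 hs h
    exact Or.inr (Or.inr
      (exists_isSpecial Z.2 (congrArg Subtype.val hY) (congrArg Subtype.val hX)))
  · push Not at hN
    obtain ⟨v, hv, hne⟩ := hN
    exact (isDiagonal_or_isRound_of_lie_eq_zero hv hne).imp_right Or.inl

/-- A polynomial in the coefficients that vanishes whenever there are more than two independent
Killing fields. -/
noncomputable def genericPoly : MvPolynomial (Fin 2 × Fin 2 × Fin 2) ℝ :=
  let a := fun i j k : Fin 2 => (MvPolynomial.X (i, j, k) : MvPolynomial _ ℝ)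
  3 * a 1 1 0 * (a 0 1 1 - a 1 0 1) + (a 0 1 0 - a 1 0 0) * (a 0 1 0 + a 1 0 0 - a 1 1 1)

theorem eval_genericPoly (A : Coeff) :
    MvPolynomial.eval (fun t => A t.1 t.2.1 t.2.2) genericPoly =
      3 * A 1 1 0 * (A 0 1 1 - A 1 0 1) + (A 0 1 0 - A 1 0 0) * (A 0 1 0 + A 1 0 0 - A 1 1 1) := by
  simp [genericPoly]

theorem genericPoly_ne_zero : genericPoly ≠ 0 := by
  intro h
  have h1 := eval_genericPoly ![![![0, 0], ![1, 0]], ![![0, 0], ![0, 0]]]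
  rw [h] at h1
  simp at h1

theorem eval_genericPoly_of_two_lt_rank {A : Coeff} (h : 2 < Module.rank ℝ (killing A)) :
    MvPolynomial.eval (fun t => A t.1 t.2.1 t.2.2) genericPoly = 0 := by
  rw [eval_genericPoly]
  rcases cases_of_two_lt_rank h with ⟨h1, h2, h3, h4⟩ | hr | ⟨p, q, hs⟩
  · simp [h1, h2, h3]
  · have h1 : A 0 1 1 = A 1 0 1 := mul_left_cancel₀ hr.e110 (hr.e011.trans hr.e101.symm)
    simp [h1, hr.e010, hr.e100]
  · have h1 : A 0 1 1 - A 1 0 1 = -p * (A 0 1 0 - A 1 0 0) := by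
      linear_combination hs.e100 - hs.e010
    rw [h1]
    linear_combination (A 0 1 0 - A 1 0 0) * hs.e110

theorem exists_and_nonempty_lieEquiv {A : Coeff} {P : Coeff → Prop} {L : Type*} [LieRing L]
    [LieAlgebra ℝ L] (hP : ∀ B, P B → Nonempty (killing B ≃ₗ⁅ℝ⁆ L)) (h : ∃ B, P B ∧ LinEquiv A B) :
    (∃ B, P B ∧ LinEquiv A B) ∧ Nonempty (killing A ≃ₗ⁅ℝ⁆ L) := by
  refine ⟨h, ?_⟩
  obtain ⟨B, hB, hAB⟩ := h
  obtain ⟨e⟩ := hAB.nonempty_lieEquiv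
  obtain ⟨e'⟩ := hP B hB
  exact ⟨e.trans e'⟩

theorem exists_model_of_two_lt_rank {A : Coeff} (h : 2 < Module.rank ℝ (killing A)) :
    (∃ B, ModelA6 B ∧ LinEquiv A B) ∨ (∃ B, ModelKBKB B ∧ LinEquiv A B) ∨
      (∃ B, ModelA49 B ∧ LinEquiv A B) ∨ ∃ B, ModelSO21 B ∧ LinEquiv A B := by
  have hdiag : IsDiagonal A → (∃ B, ModelA6 B ∧ LinEquiv A B) ∨
      (∃ B, ModelKBKB B ∧ LinEquiv A B) ∨ ∃ B, ModelA49 B ∧ LinEquiv A B := fun hA => by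
    by_cases hf : IsFlatDiagonal A
    · exact Or.inl hf.exists_model
    · exact Or.inr (hA.exists_model hf)
  rcases cases_of_two_lt_rank h with hA | hA | ⟨p, q, hA⟩
  · exact (hdiag hA).imp_right (Or.imp_right Or.inl)
  · exact Or.inl hA.exists_model
  · rcases hA.exists_model with hA | hA
    · exact (hdiag hA).imp_right (Or.imp_right Or.inl)
    · exact Or.inr (Or.inr (Or.inr hA))

end TypeB

theorem mainTheorem5 :
    -- Generically the Killing algebra is two-dimensional and isomorphic to `𝔎_ℬ`.
    (∃ p : MvPolynomial (Fin 2 × Fin 2 × Fin 2) ℝ, p ≠ 0 ∧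
      ∀ A : TypeB.Coeff, MvPolynomial.eval (fun t => A t.1 t.2.1 t.2.2) p ≠ 0 →
        Module.rank ℝ (TypeB.killing A) = 2 ∧ Nonempty (TypeB.killing A ≃ₗ⁅ℝ⁆ TypeB.KB)) ∧
    -- The Killing algebra is `𝔎_ℬ` whenever its dimension is not greater than two.
    (∀ A : TypeB.Coeff, ¬ 2 < Module.rank ℝ (TypeB.killing A) →
      Nonempty (TypeB.killing A ≃ₗ⁅ℝ⁆ TypeB.KB)) ∧
    -- If its dimension is greater than two, the model is linearly equivalent to a listed one and
    -- the Killing algebra has the corresponding structure.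
    (∀ A : TypeB.Coeff, 2 < Module.rank ℝ (TypeB.killing A) →
      (TypeB.IsTorsionFree A ∧ (∃ B, TypeB.ModelA6 B ∧ TypeB.LinEquiv A B) ∧
        Nonempty (TypeB.killing A ≃ₗ⁅ℝ⁆ TypeB.A6)) ∨
      ((∃ B, TypeB.ModelKBKB B ∧ TypeB.LinEquiv A B) ∧
        Nonempty (TypeB.killing A ≃ₗ⁅ℝ⁆ TypeB.KB × TypeB.KB)) ∨
      ((∃ B, TypeB.ModelA49 B ∧ TypeB.LinEquiv A B) ∧
        Nonempty (TypeB.killing A ≃ₗ⁅ℝ⁆ TypeB.A49)) ∨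
      ((∃ B, TypeB.ModelSO21 B ∧ TypeB.LinEquiv A B) ∧
        Nonempty (TypeB.killing A ≃ₗ⁅ℝ⁆ TypeB.SO21))) ∧
    -- Conversely, each listed model has the Killing algebra under which it is listed.
    (∀ B : TypeB.Coeff, TypeB.ModelA6 B → Nonempty (TypeB.killing B ≃ₗ⁅ℝ⁆ TypeB.A6)) ∧
    (∀ B : TypeB.Coeff, TypeB.ModelKBKB B →
      Nonempty (TypeB.killing B ≃ₗ⁅ℝ⁆ TypeB.KB × TypeB.KB)) ∧
    (∀ B : TypeB.Coeff, TypeB.ModelA49 B → Nonempty (TypeB.killing B ≃ₗ⁅ℝ⁆ TypeB.A49)) ∧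
    (∀ B : TypeB.Coeff, TypeB.ModelSO21 B → Nonempty (TypeB.killing B ≃ₗ⁅ℝ⁆ TypeB.SO21)) := by
  refine ⟨⟨TypeB.genericPoly, TypeB.genericPoly_ne_zero, fun A hA => ?_⟩,
    fun A => TypeB.nonempty_lieEquiv_KB_of_rank, fun A h => ?_,
    fun B => TypeB.ModelA6.nonempty_lieEquiv, fun B => TypeB.ModelKBKB.nonempty_lieEquiv,
    fun B => TypeB.ModelA49.nonempty_lieEquiv, fun B => TypeB.ModelSO21.nonempty_lieEquiv⟩
  · have h : ¬ 2 < Module.rank ℝ (TypeB.killing A) := fun h =>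
      hA (TypeB.eval_genericPoly_of_two_lt_rank h)
    exact ⟨TypeB.rank_killing_eq_two h, TypeB.nonempty_lieEquiv_KB_of_rank h⟩
  · rcases TypeB.exists_model_of_two_lt_rank h with hA | hA | hA | hA
    · refine Or.inl ⟨?_, TypeB.exists_and_nonempty_lieEquiv
        (fun _ => TypeB.ModelA6.nonempty_lieEquiv) hA⟩
      obtain ⟨B, hB, hAB⟩ := hA
      exact hAB.isTorsionFree hB.isTorsionFree
    · exact Or.inr (Or.inl (TypeB.exists_and_nonempty_lieEquiv
        (fun _ => TypeB.ModelKBKB.nonempty_lieEquiv) hA))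
    · exact Or.inr (Or.inr (Or.inl
        (TypeB.exists_and_nonempty_lieEquiv (fun _ => TypeB.ModelA49.nonempty_lieEquiv) hA)))
    · exact Or.inr (Or.inr (Or.inr
        (TypeB.exists_and_nonempty_lieEquiv (fun _ => TypeB.ModelSO21.nonempty_lieEquiv) hA)))
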